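/- Setting. Let $X$ be a closed smooth oriented Riemannian spin four-manifold, with spin structure a principal $\mathrm{Spin}(4)=Sp_+(1)\times Sp_-(1)$-bundle $\pi\colon Q\to X$: a point $f\in Q$ determines an oriented isometry $\varkappa_f\colon T_{\pi(f)}X\to\mathbb H$ and $\varkappa_{f(q_+,q_-)}=\bar q_+\varkappa_f q_-$. Let $\theta\in\Omega^1(Q;\mathbb H)$ be the tautological form, $\theta(v)=\varkappa_f(\pi_*v)$, let $(\varphi,\psi)\in\Omega^1(Q;\operatorname{Im}\mathbb H\oplus\operatorname{Im}\mathbb H)$ be the Levi-Civita connection, normalized to take the value $(\xi,\zeta)$ on the fundamental vector field of $(\xi,\zeta)$, so that $d\theta+\varphi\wedge\theta+\theta\wedge\psi=0$, and let $\Phi=d\varphi+\varphi\wedge\varphi$ be the curvature of $\varphi$. Let $\mathbb W^+=Q\times_{\mathrm{Spin}(4)}\mathbb H$, with $Sp_+(1)$ acting on $\mathbb H$ by left multiplication, be the positive spinor bundle. With $\eta=dx+\varphi x\in\Omega^1(Q\times\mathbb H;\mathbb H)$, the $\mathrm{Spin}(4)$-invariant basic form $$\Omega=-\tfrac1{24}\operatorname{Re}\bigl(\theta\wedge\bar\theta\wedge\theta\wedge\bar\theta-6\,\theta\wedge\bar\theta\wedge\eta\wedge\bar\eta+\eta\wedge\bar\eta\wedge\eta\wedge\bar\eta\bigr)$$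 descends to the Bryant–Salamon $\mathrm{Spin}(7)$-structure on the total space of $\mathbb W^+$, with metric $\operatorname{Re}(\theta\otimes\bar\theta+\eta\otimes\bar\eta)$ and the orientation for which $\Omega\wedge\Omega>0$. Let $G$ be a Lie group with Lie algebra $\mathfrak g$, and let $P\to\mathbb R^4=\mathbb H$ be a principal $G$-bundle with a lift to $P$, commuting with $G$, of the action of $Sp(1)$ on $\mathbb H$ by left multiplication. Put $\mathbb P=Q\times_{\mathrm{Spin}(4)}P=Q_+\times_{Sp_+(1)}P$, where $Q_+=Q/Sp_-(1)$; this is a principal $G$-bundle over $\mathbb W^+$. Call a smooth connection $A$ on $\mathbb P$, with curvature $F_A$, $\Omega$-anti-self-dual if $*(\Omega\wedge F_A)=-F_A$. Let $\mathcal A(P)$ be the space of smooth connections on $P$ and $\mathcal L=\Omega^0(\mathbb R^4;\mathrm{ad}\,P)$ the Lie algebra of its gauge group, and let $\mathbb A,\mathbb L\to X$ be the bundles associated with $Q$ with fibres $\mathcal A(P)$ and $\mathcal L$. (No decay at infinity is needed; the hyperkähler space $\mathcal A^0(P)$ of connections with prescribed asymptotics is contained in $\mathcal A(P)$.) A section $a\in\Gamma(\mathbb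 A)$ is a smooth equivariant map $f\mapsto a_f$ from $Q$ to $\mathcal A(P)$, and $b\in\Omega^1(X;\mathbb L)$ is a smooth horizontal equivariant one-form on $Q$ with values in $\mathcal L$. For $\xi\in\operatorname{Im}\mathbb H=\mathfrak{sp}(1)$ let $K_\xi=\frac d{dt}\big|_0\exp(t\xi)\cdot$ be the vector field on $P$ generated by $\xi$. Write $A=\hat a+\hat b$ if the pull-back of $A$ to $Q\times P$ is $$(v,w)\mapsto a_f\bigl(w+K_{\varphi(v)}\bigr)+b(v),\qquad (v,w)\in T_fQ\times T_pP .$$ Let $F_b=d_\varphi b+[b,b]\in\Omega^2(X;\mathbb L)$, and let $\imath_\Phi a\in\Omega^2(X;\mathbb L)$ be $(v,v')\mapsto a(K_{\Phi(v,v')})$. Let $\nabla^Ba\in\Omega^1(X;\Omega^1(\mathbb R^4;\mathrm{ad}\,P))$ be $v\mapsto\nabla^\varphi_v a-\nabla^a(b(v))$, the covariant derivative of $a$ with respect to $B=b+\varphi$, where $-\nabla^a\xi$ is the infinitesimal action of $\xi\in\mathcal L$ at $a$. Let $J_1,J_2,J_3$ be left multiplication by $i,j,k$ on $T_xX\cong\mathbb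 H$ and let $(I_l\alpha)(e)=-\alpha(i_l e)$, $(i_1,i_2,i_3)=(i,j,k)$, be the induced complex structures on $T\mathcal A(P)=\Omega^1(\mathbb R^4;\mathrm{ad}\,P)$. The generalized Dirac operator is $\mathcal D_b a=\mathcal C(\nabla^Ba)$, where $\mathcal C(T)=\frac14\bigl(T-\sum_l I_lTJ_l\bigr)$ is the projection onto quaternion-linear maps. Finally, the gauge group acts on $\mathcal A(P)$ with moment map $\mu(a)=F_a^+\in\Omega^2_+(\mathbb R^4;\mathrm{ad}\,P)\cong\operatorname{Im}\mathbb H\otimes\mathcal L$, whose $i$-, $j$- and $k$-components are the contractions of $F_a$ with $dx_0\wedge dx_1+dx_2\wedge dx_3$, $dx_0\wedge dx_2+dx_3\wedge dx_1$, $dx_0\wedge dx_3+dx_1\wedge dx_2$; with the identification $\operatorname{Im}\mathbb H=\mathfrak{sp}_+(1)\cong\Lambda^2_+T^*X$, $\zeta\mapsto\frac14\langle\zeta,\theta\wedge\bar\theta\rangle$, it gives $\nu\circ a\in\Omega^2_+(X;\mathbb L)$. (Under the identification of $\Lambda^2_+T_x^*X$ with $\Lambda^2_+(\mathbb W^+_x)^*$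 by frames, $\nu\circ a$ is $-F_a^+$.) Theorem. Every smooth connection $A$ on $\mathbb P\to\mathbb W^+$ is $A=\hat a+\hat b$ for a unique pair $(a,b)\in\Gamma(\mathbb A)\times\Omega^1(X;\mathbb L)$, and $A$ is $\Omega$-anti-self-dual if and only if $(a,b)$ solves the Taubes–Pidstrygach-type equations $$\mathcal D_b a=0,\qquad F_b^+ +\nu\circ a=-(\imath_\Phi a)^+ .$$ -/

import Mathlib

open scoped Manifold ContDiff Quaternion
open Bundle

noncomputable section

namespace SpinInstanton

/-! ### Differential one-forms on a manifold -/

section Forms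

variable {E H : Type*} [NormedAddCommGroup E] [NormedSpace ℝ E] [TopologicalSpace H]
  (I : ModelWithCorners ℝ E H) (M : Type*) [TopologicalSpace M] [ChartedSpace H M]
  (F : Type*) [NormedAddCommGroup F] [NormedSpace ℝ F]

/-- (Not necessarily smooth) one-forms on `M` with values in the vector space `F`. -/
abbrev OneForm : Type _ := ∀ x : M, TangentSpace I x →L[ℝ] F

variable {I M F}

/-- A one-form is smooth if it is smooth as a function on the total space of the tangent bundle. -/
def OneForm.IsSmooth [IsManifold I ∞ M] (α : OneForm I M F) : Prop :=
  ContMDiff I.tangent 𝓘(ℝ, F) ∞ (fun v : TangentBundle I M => α v.1 v.2)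

/-- The coordinate expression of a one-form in the preferred chart at `x`. -/
def OneForm.inChart (α : OneForm I M F) (x : M) (y : E) : E →L[ℝ] F :=
  (α ((extChartAt I x).symm y)).comp (mfderiv 𝓘(ℝ, E) I (extChartAt I x).symm y)

/-- The exterior derivative `dα (u, v)` of a one-form on a manifold without boundary, computed in
the preferred chart at `x` (whose differential at `x` is the identification `T_x M = E`). -/
def OneForm.d (α : OneForm I M F) (x : M) (u v : TangentSpace I x) : F :=
  fderiv ℝ (α.inChart x) (extChartAt I x x) u v - fderiv ℝ (α.inChart x) (extChartAt I x x) v u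

variable (I) in
/-- The derivative of a vector-valued function along a tangent vector. -/
def derivAlong (h : M → F) (x : M) (v : TangentSpace I x) : F := mfderiv I 𝓘(ℝ, F) h x v

end Forms

/-! ### Principal bundles and associated bundles -/

section Bundles

variable {EB HB EG HG EP HP EM HM : Type*}
  [NormedAddCommGroup EB] [NormedSpace ℝ EB] [TopologicalSpace HB]
  [NormedAddCommGroup EG] [NormedSpace ℝ EG] [TopologicalSpace HG]
  [NormedAddCommGroup EP] [NormedSpace ℝ EP] [TopologicalSpace HP]
  [NormedAddCommGroup EM] [NormedSpace ℝ EM] [TopologicalSpace HM]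
  (IB : ModelWithCorners ℝ EB HB) (IG : ModelWithCorners ℝ EG HG)
  (IP : ModelWithCorners ℝ EP HP) (IM : ModelWithCorners ℝ EM HM)
  (B G P M : Type*)
  [TopologicalSpace B] [ChartedSpace HB B] [TopologicalSpace G] [ChartedSpace HG G] [Group G]
  [TopologicalSpace P] [ChartedSpace HP P] [TopologicalSpace M] [ChartedSpace HM M]

/-- A smooth principal `G`-bundle `P → B`: a smooth right action of `G` on `P` over the smooth map
`proj`, such that `P` is locally equivariantly diffeomorphic to `U × G`. -/
structure PrincipalBundle where
  proj : P → B
  act : P → G → P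
  act_one : ∀ p, act p 1 = p
  act_mul : ∀ p g h, act p (g * h) = act (act p g) h
  proj_act : ∀ p g, proj (act p g) = proj p
  contMDiff_proj : ContMDiff IP IB ∞ proj
  contMDiff_act : ContMDiff (IP.prod IG) IP ∞ (fun z : P × G => act z.1 z.2)
  exists_triv : ∀ b : B, ∃ e : Trivialization G proj, b ∈ e.baseSet ∧
    ContMDiffOn IP (IB.prod IG) ∞ e e.source ∧
    ContMDiffOn (IB.prod IG) IP ∞ e.toOpenPartialHomeomorph.symm e.target ∧
    ∀ p ∈ e.source, ∀ g, (e (act p g)).2 = (e p).2 * g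

/-- A smooth left action of `G` on `M`. -/
structure SmoothLeftAction where
  smul : G → M → M
  one_smul : ∀ m, smul 1 m = m
  mul_smul : ∀ g h m, smul (g * h) m = smul g (smul h m)
  contMDiff_smul : ContMDiff (IG.prod IM) IM ∞ (fun z : G × M => smul z.1 z.2)

variable {IB IG IP IM B G P M}

/-- The smooth equivariant local trivializations of a principal bundle. -/
def PrincipalBundle.IsTriv (𝒬 : PrincipalBundle IB IG IP B G P) (e : Trivialization G 𝒬.proj) :
    Prop :=
  ContMDiffOn IP (IB.prod IG) ∞ e e.source ∧
    ContMDiffOn (IB.prod IG) IP ∞ e.toOpenPartialHomeomorph.symm e.target ∧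
    ∀ p ∈ e.source, ∀ g, (e (𝒬.act p g)).2 = (e p).2 * g

/-- Two points of `P × M` are equivalent if they lie on one orbit of
`(p, m) · g = (p · g, g⁻¹ · m)`. -/
def assocSetoid (𝒬 : PrincipalBundle IB IG IP B G P) (ρ : SmoothLeftAction IG IM G M) :
    Setoid (P × M) where
  r z w := ∃ g : G, w = (𝒬.act z.1 g, ρ.smul g⁻¹ z.2)
  iseqv :=
    { refl := fun z => ⟨1, by simp [𝒬.act_one, ρ.one_smul]⟩
      symm := by
        rintro z _ ⟨g, rfl⟩
        exact ⟨g⁻¹, by simp [← 𝒬.act_mul, ← ρ.mul_smul, 𝒬.act_one, ρ.one_smul]⟩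
      trans := by
        rintro z _ _ ⟨g, rfl⟩ ⟨h, rfl⟩
        exact ⟨g * h, by simp [𝒬.act_mul, ρ.mul_smul]⟩ }

/-- The associated bundle `P ×_G M`. -/
def Assoc (𝒬 : PrincipalBundle IB IG IP B G P) (ρ : SmoothLeftAction IG IM G M) : Type _ :=
  Quotient (assocSetoid 𝒬 ρ)

namespace Assoc

variable (𝒬 : PrincipalBundle IB IG IP B G P) (ρ : SmoothLeftAction IG IM G M)

instance : TopologicalSpace (Assoc 𝒬 ρ) :=
  inferInstanceAs (TopologicalSpace (Quotient (assocSetoid 𝒬 ρ)))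

/-- The quotient map `P × M → P ×_G M`. -/
def mk (z : P × M) : Assoc 𝒬 ρ := Quotient.mk (assocSetoid 𝒬 ρ) z

/-- The bundle projection `P ×_G M → B`. -/
def proj : Assoc 𝒬 ρ → B :=
  Quotient.lift (fun z => 𝒬.proj z.1) (by rintro z _ ⟨g, rfl⟩; exact (𝒬.proj_act _ _).symm)

theorem isQuotientMap_mk : Topology.IsQuotientMap (mk 𝒬 ρ) := isQuotientMap_quotient_mk'

theorem mk_act (p : P) (g : G) (m : M) : mk 𝒬 ρ (𝒬.act p g, m) = mk 𝒬 ρ (p, ρ.smul g m) :=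
  Quotient.sound ⟨g⁻¹, by simp [← 𝒬.act_mul, 𝒬.act_one]⟩

theorem out_spec (z : Assoc 𝒬 ρ) : mk 𝒬 ρ z.out = z := Quotient.out_eq z

theorem continuous_mk : Continuous (mk 𝒬 ρ) := (isQuotientMap_mk 𝒬 ρ).continuous

theorem continuous_proj : Continuous (proj 𝒬 ρ) :=
  (isQuotientMap_mk 𝒬 ρ).continuous_iff.2 (𝒬.contMDiff_proj.continuous.comp continuous_fst)

theorem exists_isTriv (b : B) : ∃ e : Trivialization G 𝒬.proj, b ∈ e.baseSet ∧ 𝒬.IsTriv e :=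
  𝒬.exists_triv b

variable {𝒬}

theorem apply_eq {e : Trivialization G 𝒬.proj} (he : 𝒬.IsTriv e) {z w : P × M}
    (h : mk 𝒬 ρ z = mk 𝒬 ρ w) (hz : z.1 ∈ e.source) :
    ρ.smul (e w.1).2 w.2 = ρ.smul (e z.1).2 z.2 := by
  obtain ⟨g, rfl⟩ := Quotient.exact h
  rw [he.2.2 _ hz, ← ρ.mul_smul]
  simp

theorem section_eq {e : Trivialization G 𝒬.proj} (he : 𝒬.IsTriv e) {p : P} (hp : p ∈ e.source) :
    𝒬.act (e.toOpenPartialHomeomorph.symm (𝒬.proj p, 1)) (e p).2 = p := by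
  have hb : 𝒬.proj p ∈ e.baseSet := e.mem_source.1 hp
  have ht : (𝒬.proj p, (1 : G)) ∈ e.target := e.mem_target.2 hb
  set s := e.toOpenPartialHomeomorph.symm (𝒬.proj p, 1) with hs
  have hss : s ∈ e.source := e.toOpenPartialHomeomorph.map_target ht
  have hes : e s = (𝒬.proj p, 1) := e.apply_symm_apply ht
  have hps : 𝒬.proj s = 𝒬.proj p := by rw [← e.coe_fst hss, hes]
  have hact : 𝒬.act s (e p).2 ∈ e.source := by
    rw [e.mem_source, 𝒬.proj_act, hps]; exact hb
  refine e.toOpenPartialHomeomorph.injOn hact hp ?_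
  change e _ = e _
  refine Prod.ext ?_ ?_
  · rw [e.coe_fst hact, e.coe_fst hp, 𝒬.proj_act, hps]
  · rw [he.2.2 _ hss, hes, one_mul]

/-- The local trivialization `[p, m] ↦ (π p, g · m)` of `P ×_G M` induced by a local trivialization
`p ↦ (π p, g)` of `P`. -/
def triv (e : Trivialization G 𝒬.proj) (he : 𝒬.IsTriv e) :
    OpenPartialHomeomorph (Assoc 𝒬 ρ) (B × M) where
  toFun z := (proj 𝒬 ρ z, ρ.smul (e z.out.1).2 z.out.2)
  invFun y := mk 𝒬 ρ (e.toOpenPartialHomeomorph.symm (y.1, 1), y.2)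
  source := proj 𝒬 ρ ⁻¹' e.baseSet
  target := e.baseSet ×ˢ Set.univ
  map_source' := fun z hz => ⟨hz, trivial⟩
  map_target' := by
    rintro ⟨b, m⟩ ⟨hb, -⟩
    change 𝒬.proj (e.toOpenPartialHomeomorph.symm (b, 1)) ∈ e.baseSet
    rwa [e.proj_symm_apply' hb]
  left_inv' := by
    intro z hz
    have h1 : z.out.1 ∈ e.source := by
      rw [e.mem_source]
      have := out_spec 𝒬 ρ z
      rw [← this] at hz
      exact hz
    have h2 : proj 𝒬 ρ z = 𝒬.proj z.out.1 := by
      conv_lhs => rw [← out_spec 𝒬 ρ z]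
      rfl
    change mk 𝒬 ρ (e.toOpenPartialHomeomorph.symm (proj 𝒬 ρ z, 1), _) = z
    rw [h2, ← mk_act, section_eq he h1]
    exact out_spec 𝒬 ρ z
  right_inv' := by
    rintro ⟨b, m⟩ ⟨hb, -⟩
    have ht : (b, (1 : G)) ∈ e.target := e.mem_target.2 hb
    have hs := e.toOpenPartialHomeomorph.map_target ht
    refine Prod.ext ?_ ?_
    · exact e.proj_symm_apply' hb
    · change ρ.smul _ _ = m
      rw [apply_eq ρ he (out_spec 𝒬 ρ (mk 𝒬 ρ (e.toOpenPartialHomeomorph.symm (b, 1), m))).symm hs]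
      change ρ.smul (e (e.toOpenPartialHomeomorph.symm (b, 1))).2 m = m
      rw [e.apply_symm_apply ht, ρ.one_smul]
  open_source := e.open_baseSet.preimage (continuous_proj 𝒬 ρ)
  open_target := e.open_baseSet.prod isOpen_univ
  continuousOn_toFun := by
    refine ((continuous_proj 𝒬 ρ).continuousOn).prodMk ?_
    have hopen := e.open_baseSet.preimage (continuous_proj 𝒬 ρ)
    rw [(isQuotientMap_mk 𝒬 ρ).continuousOn_isOpen_iff hopen]
    have hc : ContinuousOn (fun z : P × M => ρ.smul (e z.1).2 z.2)
        (mk 𝒬 ρ ⁻¹' (proj 𝒬 ρ ⁻¹' e.baseSet)) := by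
      refine ρ.contMDiff_smul.continuous.comp_continuousOn
        (ContinuousOn.prodMk ?_ continuous_snd.continuousOn)
      refine continuous_snd.comp_continuousOn
        (e.toOpenPartialHomeomorph.continuousOn.comp continuous_fst.continuousOn ?_)
      intro z hz
      exact e.mem_source.2 hz
    refine hc.congr ?_
    intro z hz
    exact apply_eq ρ he (out_spec 𝒬 ρ (mk 𝒬 ρ z)).symm (e.mem_source.2 hz)
  continuousOn_invFun := by
    refine (continuous_mk 𝒬 ρ).comp_continuousOn
      (ContinuousOn.prodMk ?_ continuous_snd.continuousOn)
    refine e.toOpenPartialHomeomorph.symm.continuousOn.comp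
      (continuous_fst.prodMk continuous_const).continuousOn ?_
    rintro ⟨b, m⟩ ⟨hb, -⟩
    exact e.mem_target.2 hb

theorem triv_mk {e : Trivialization G 𝒬.proj} (he : 𝒬.IsTriv e) {z : P × M}
    (hz : z.1 ∈ e.source) : triv ρ e he (mk 𝒬 ρ z) = (𝒬.proj z.1, ρ.smul (e z.1).2 z.2) :=
  Prod.ext rfl (apply_eq ρ he (out_spec 𝒬 ρ (mk 𝒬 ρ z)).symm hz)

theorem contMDiffOn_triv_symm_trans {e e' : Trivialization G 𝒬.proj} (he : 𝒬.IsTriv e)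
    (he' : 𝒬.IsTriv e') :
    ContMDiffOn (IB.prod IM) (IB.prod IM) ∞ ((triv ρ e he).symm.trans (triv ρ e' he'))
      ((triv ρ e he).symm.trans (triv ρ e' he')).source := by
  have hsrc : ∀ y ∈ ((triv ρ e he).symm.trans (triv ρ e' he')).source,
      y.1 ∈ e.baseSet ∧ y.1 ∈ e'.baseSet := by
    rintro ⟨b, m⟩ ⟨⟨hb, -⟩, hb'⟩
    refine ⟨hb, ?_⟩
    have : 𝒬.proj (e.toOpenPartialHomeomorph.symm (b, 1)) ∈ e'.baseSet := hb'
    rwa [e.proj_symm_apply' hb] at this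
  have hs : ContMDiffOn (IB.prod IM) IP ∞
      (fun y : B × M => e.toOpenPartialHomeomorph.symm (y.1, 1))
      ((triv ρ e he).symm.trans (triv ρ e' he')).source :=
    he.2.1.comp (contMDiff_fst.prodMk contMDiff_const).contMDiffOn
      (fun y hy => e.mem_target.2 (hsrc y hy).1)
  have hmem : ∀ y ∈ ((triv ρ e he).symm.trans (triv ρ e' he')).source,
      e.toOpenPartialHomeomorph.symm (y.1, 1) ∈ e'.source := by
    intro y hy
    rw [e'.mem_source, e.proj_symm_apply' (hsrc y hy).1]
    exact (hsrc y hy).2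
  have hg : ContMDiffOn (IB.prod IM) IG ∞
      (fun y : B × M => (e' (e.toOpenPartialHomeomorph.symm (y.1, 1))).2)
      ((triv ρ e he).symm.trans (triv ρ e' he')).source :=
    contMDiff_snd.comp_contMDiffOn (he'.1.comp hs hmem)
  have hfin : ContMDiffOn (IB.prod IM) (IB.prod IM) ∞
      (fun y : B × M => (y.1, ρ.smul (e' (e.toOpenPartialHomeomorph.symm (y.1, 1))).2 y.2))
      ((triv ρ e he).symm.trans (triv ρ e' he')).source :=
    contMDiff_fst.contMDiffOn.prodMk
      (ρ.contMDiff_smul.comp_contMDiffOn (hg.prodMk contMDiff_snd.contMDiffOn))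
  refine hfin.congr ?_
  intro y hy
  change triv ρ e' he' (mk 𝒬 ρ (e.toOpenPartialHomeomorph.symm (y.1, 1), y.2)) = _
  rw [triv_mk ρ he' (hmem y hy)]
  change (𝒬.proj (e.toOpenPartialHomeomorph.symm (y.1, 1)), _) = _
  rw [e.proj_symm_apply' (hsrc y hy).1]

variable (𝒬)

/-- The charts of `P ×_G M`: a local trivialization followed by a chart of `B × M`. -/
instance : ChartedSpace (ModelProd HB HM) (Assoc 𝒬 ρ) where
  atlas := {c | ∃ (e : Trivialization G 𝒬.proj) (he : 𝒬.IsTriv e) (y : B × M),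
    c = (triv ρ e he).trans (chartAt (ModelProd HB HM) y)}
  chartAt z := (triv ρ _ (exists_isTriv 𝒬 (proj 𝒬 ρ z)).choose_spec.2).trans
    (chartAt (ModelProd HB HM) (triv ρ _ (exists_isTriv 𝒬 (proj 𝒬 ρ z)).choose_spec.2 z))
  mem_chart_source z := by
    simp only [OpenPartialHomeomorph.trans_source, Set.mem_inter_iff, Set.mem_preimage,
      mem_chart_source, and_true]
    exact (exists_isTriv 𝒬 (proj 𝒬 ρ z)).choose_spec.1
  chart_mem_atlas z := ⟨_, _, _, rfl⟩

theorem contMDiffOn_transition [IsManifold IB ∞ B] [IsManifold IM ∞ M]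
    {e e' : Trivialization G 𝒬.proj} (he : 𝒬.IsTriv e) (he' : 𝒬.IsTriv e') (y y' : B × M) :
    ContMDiffOn (IB.prod IM) (IB.prod IM) ∞
      (((triv ρ e he).trans (chartAt (ModelProd HB HM) y)).symm.trans
        ((triv ρ e' he').trans (chartAt (ModelProd HB HM) y')))
      (((triv ρ e he).trans (chartAt (ModelProd HB HM) y)).symm.trans
        ((triv ρ e' he').trans (chartAt (ModelProd HB HM) y'))).source := by
  have h1 := contMDiffOn_chart_symm (I := IB.prod IM) (n := ∞) (x := y)
  have h2 := contMDiffOn_triv_symm_trans ρ he he'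
  have h3 := contMDiffOn_chart (I := IB.prod IM) (n := ∞) (x := y')
  have h23 := h3.comp' h2
  have h123 := h23.comp' h1
  refine h123.mono ?_
  intro u hu
  simp only [OpenPartialHomeomorph.trans_source, OpenPartialHomeomorph.symm_source,
    Set.mem_inter_iff, Set.mem_preimage,
    OpenPartialHomeomorph.trans_symm_eq_symm_trans_symm, OpenPartialHomeomorph.coe_trans,
    Function.comp_apply] at hu ⊢
  tauto

instance [IsManifold IB ∞ B] [IsManifold IM ∞ M] :
    IsManifold (IB.prod IM) ∞ (Assoc 𝒬 ρ) := by
  have key : HasGroupoid (Assoc 𝒬 ρ) (contDiffGroupoid ∞ (IB.prod IM)) := by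
    refine ⟨?_⟩
    rintro _ _ ⟨e, he, y, rfl⟩ ⟨e', he', y', rfl⟩
    rw [contDiffGroupoid, mem_groupoid_of_pregroupoid]
    have h1 := contMDiffOn_transition 𝒬 ρ he he' y y'
    have h2 := contMDiffOn_transition 𝒬 ρ he' he y' y
    refine ⟨contMDiffOn_iff_contDiffOn.1 ?_, contMDiffOn_iff_contDiffOn.1 ?_⟩
    · exact (IB.prod IM).contMDiff.comp_contMDiffOn
        (h1.comp ((IB.prod IM).contMDiffOn_symm.mono (by simp)) (by intro u hu; exact hu.1))
    · exact (IB.prod IM).contMDiff.comp_contMDiffOn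
        (h2.comp ((IB.prod IM).contMDiffOn_symm.mono (by simp)) (by intro u hu; exact hu.1))
  exact { key with }

end Assoc

end Bundles

/-! ### Quaternions, `Sp(1)` and `Spin(4)` -/

instance : Fact (Module.finrank ℝ ℍ[ℝ] = 3 + 1) := ⟨Quaternion.finrank_eq_four⟩

/-- The group `Sp(1)` of unit quaternions, a smooth manifold as the unit sphere of `ℍ`. -/
abbrev Sp1 : Type := Metric.sphere (0 : ℍ[ℝ]) 1

/-- `Spin(4) = Sp₊(1) × Sp₋(1)`. -/
abbrev Spin4 : Type := Sp1 × Sp1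

/-- The model with corners of `Spin(4)`. -/
abbrev ISpin4 := (𝓡 3).prod (𝓡 3)

/-- The exponential map `Im ℍ = sp(1) → Sp(1)` (applied to the imaginary part of `ξ`). -/
def expSp1 (ξ : ℍ[ℝ]) : Sp1 :=
  ⟨NormedSpace.exp ξ.im, by simp [Quaternion.norm_exp]⟩

/-- The quaternions `1, i, j, k`. -/
def qvec : Fin 4 → ℍ[ℝ] := ![⟨1, 0, 0, 0⟩, ⟨0, 1, 0, 0⟩, ⟨0, 0, 1, 0⟩, ⟨0, 0, 0, 1⟩]

/-- The standard basis `1, i, j, k` of `ℍ`. -/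
def qbasis : Module.Basis (Fin 4) ℝ ℍ[ℝ] := QuaternionAlgebra.basisOneIJK (-1 : ℝ) 0 (-1)

/-- The left regular action of `Sp(1)` on `ℍ`; composed with the projection of `Spin(4)` onto
its first factor `Sp₊(1)`, this is the positive spin representation. -/
theorem contMDiff_spinRep : ContMDiff (ISpin4.prod 𝓘(ℝ, ℍ[ℝ])) 𝓘(ℝ, ℍ[ℝ]) ∞
    (fun z : Spin4 × ℍ[ℝ] => (z.1.1 : ℍ[ℝ]) * z.2) := by
  have h : ContMDiff (ISpin4.prod 𝓘(ℝ, ℍ[ℝ])) 𝓘(ℝ, ℍ[ℝ]) ∞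
      (fun z : Spin4 × ℍ[ℝ] => (z.1.1 : ℍ[ℝ])) :=
    contMDiff_coe_sphere.comp (contMDiff_fst.comp contMDiff_fst)
  have hm : ContDiff ℝ ∞ (fun z : ℍ[ℝ] × ℍ[ℝ] => z.1 * z.2) := contDiff_fst.mul contDiff_snd
  exact hm.contMDiff.comp (h.prodMk_space contMDiff_snd)

/-! ### Two-forms and the Cayley form in linear algebra -/

/-- The three imaginary units `i, j, k`. -/
def imQ (l : Fin 3) : ℍ[ℝ] := qvec l.succ

/-- The Hodge star on two-forms on `ℍ = ℝ⁴` (orientation and orthonormal basis `1, i, j, k`):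
`(*β)(u, v) = (u♭ ∧ v♭ ∧ β)(1, i, j, k)`. -/
def star2 {V : Type*} [AddCommGroup V] [Module ℝ V] (β : ℍ[ℝ] → ℍ[ℝ] → V) (u v : ℍ[ℝ]) : V :=
  (1 / 2 : ℝ) • ∑ σ : Equiv.Perm (Fin 4),
    (((Equiv.Perm.sign σ : ℤ) : ℝ) * inner ℝ u (qvec (σ 0)) * inner ℝ v (qvec (σ 1))) •
      β (qvec (σ 2)) (qvec (σ 3))

/-- The self-dual part `β⁺ = (β + *β) / 2` of a two-form on `ℍ = ℝ⁴`. -/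
def selfDual {V : Type*} [AddCommGroup V] [Module ℝ V] (β : ℍ[ℝ] → ℍ[ℝ] → V) (u v : ℍ[ℝ]) : V :=
  (1 / 2 : ℝ) • (β u v + star2 β u v)

/-- `(α₁ ∧ ᾱ₂ ∧ α₃ ∧ ᾱ₄)(v₀, v₁, v₂, v₃)` for `ℍ`-valued linear forms `α₁, …, α₄`, where the bar is
quaternionic conjugation. -/
def wedge4 {V : Type*} (α₁ α₂ α₃ α₄ : V → ℍ[ℝ]) (v : Fin 4 → V) : ℍ[ℝ] :=
  ∑ σ : Equiv.Perm (Fin 4), ((Equiv.Perm.sign σ : ℤ) : ℝ) •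
    (α₁ (v (σ 0)) * star (α₂ (v (σ 1))) * α₃ (v (σ 2)) * star (α₄ (v (σ 3))))

/-- The standard Cayley form on `ℝ⁸ = ℍ ⊕ ℍ`, with `θ` and `η` the two projections:
`Ω = -1/24 Re (θ ∧ θ̄ ∧ θ ∧ θ̄ - 6 θ ∧ θ̄ ∧ η ∧ η̄ + η ∧ η̄ ∧ η ∧ η̄)`. -/
def cayley (v : Fin 4 → ℍ[ℝ] × ℍ[ℝ]) : ℝ :=
  -(1 / 24) * (wedge4 Prod.fst Prod.fst Prod.fst Prod.fst v
    - (6 : ℝ) • wedge4 Prod.fst Prod.fst Prod.snd Prod.snd v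
    + wedge4 Prod.snd Prod.snd Prod.snd Prod.snd v).re

/-- The standard oriented orthonormal basis of `ℝ⁸ = ℍ ⊕ ℍ`. -/
def basis8 : Fin 8 → ℍ[ℝ] × ℍ[ℝ] :=
  ![(qvec 0, 0), (qvec 1, 0), (qvec 2, 0), (qvec 3, 0),
    (0, qvec 0), (0, qvec 1), (0, qvec 2), (0, qvec 3)]

/-- The standard scalar product on `ℝ⁸ = ℍ ⊕ ℍ`. -/
def inner8 (u v : ℍ[ℝ] × ℍ[ℝ]) : ℝ := inner ℝ u.1 v.1 + inner ℝ u.2 v.2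

/-- `*(Ω ∧ β)` for a two-form `β` on `ℝ⁸ = ℍ ⊕ ℍ`, by
`(*(Ω ∧ β))(u, v) = (u♭ ∧ v♭ ∧ Ω ∧ β)(e₀, …, e₇)`, where `e` is the standard basis. -/
def starCayley {V : Type*} [AddCommGroup V] [Module ℝ V]
    (β : ℍ[ℝ] × ℍ[ℝ] → ℍ[ℝ] × ℍ[ℝ] → V) (u v : ℍ[ℝ] × ℍ[ℝ]) : V :=
  (1 / 48 : ℝ) • ∑ σ : Equiv.Perm (Fin 8),
    (((Equiv.Perm.sign σ : ℤ) : ℝ) * inner8 u (basis8 (σ 0)) * inner8 v (basis8 (σ 1)) *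
      cayley ![basis8 (σ 2), basis8 (σ 3), basis8 (σ 4), basis8 (σ 5)]) •
      β (basis8 (σ 6)) (basis8 (σ 7))

/-! ### Connections on principal bundles -/

/-- The Lie algebra of a `k`-dimensional Lie group, as a vector space. -/
abbrev LieAlg (k : ℕ) : Type := EuclideanSpace ℝ (Fin k)

section Connections

variable {k : ℕ} (G : Type*) [TopologicalSpace G] [ChartedSpace (EuclideanSpace ℝ (Fin k)) G]
  [Group G]

/-- The Lie bracket of `Lie(G) = T₁G`. -/
def lieBr (x y : LieAlg k) : LieAlg k :=
  Bracket.bracket (L := GroupLieAlgebra (𝓡 k) G) (M := GroupLieAlgebra (𝓡 k) G) x y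

variable {G}

/-- The adjoint representation of `G` on `Lie(G) = T₁G`. -/
def Ad (g : G) (x : LieAlg k) : LieAlg k :=
  mfderiv (𝓡 k) (𝓡 k) (fun h : G => g * h * g⁻¹) 1 x

variable {E H : Type*} [NormedAddCommGroup E] [NormedSpace ℝ E] [TopologicalSpace H]
  (I : ModelWithCorners ℝ E H) {N : Type*} [TopologicalSpace N] [ChartedSpace H N]
  [IsManifold I ∞ N]

/-- Smooth connections on a principal `G`-bundle with total space `N` and right action `R`. -/
structure Connection (k : ℕ) {G : Type*} [TopologicalSpace G]
    [ChartedSpace (EuclideanSpace ℝ (Fin k)) G] [Group G] (R : N → G → N) where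
  form : OneForm I N (LieAlg k)
  smooth : form.IsSmooth
  fundamental : ∀ z (ξ : LieAlg k), form (R z 1) (mfderiv (𝓡 k) I (fun g => R z g) 1 ξ) = ξ
  equivariant : ∀ z g (v : TangentSpace I z),
    form (R z g) (mfderiv I I (fun z' => R z' g) z v) = Ad g⁻¹ (form z v)

variable {I}

/-- The curvature `F_A = dA + ½ [A ∧ A]`, a two-form on the total space. -/
def Connection.curvature {R : N → G → N} (A : Connection I k R) (z : N) (u v : TangentSpace I z) :
    LieAlg k :=
  A.form.d z u v + lieBr G (A.form z u) (A.form z v)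

end Connections

/-! ### Spin structures and the Levi-Civita connection -/

section Spin

variable {X : Type*} [TopologicalSpace X] [ChartedSpace (EuclideanSpace ℝ (Fin 4)) X]
  [IsManifold (𝓡 4) ∞ X]

/-- A smooth Riemannian metric on a four-manifold. -/
abbrev Metric4 (X : Type*) [TopologicalSpace X] [ChartedSpace (EuclideanSpace ℝ (Fin 4)) X]
    [IsManifold (𝓡 4) ∞ X] :=
  ContMDiffRiemannianMetric (𝓡 4) ∞ (EuclideanSpace ℝ (Fin 4))
    (fun x : X => TangentSpace (𝓡 4) x)

variable (g : Metric4 X) (o : ∀ x : X, Orientation ℝ (TangentSpace (𝓡 4) x) (Fin 4))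
  (Q : Type*) [TopologicalSpace Q] [ChartedSpace (EuclideanSpace ℝ (Fin 10)) Q]
  [IsManifold (𝓡 10) ∞ Q]

/-- A spin structure on the Riemannian four-manifold `(X, g)` with orientation `o`: a principal
`Spin(4)`-bundle `Q → X` with a smooth map, equivariant over `Spin(4) → SO(4)`, to the bundle of
oriented isometries `T_x X → ℍ`. Here `(q₊, q₋)` acts on isometries from the right by
`ϰ ↦ q̄₊ ϰ q₋`. -/
structure SpinStructure extends PrincipalBundle (𝓡 4) ISpin4 (𝓡 10) X Spin4 Q where
  frame : ∀ f : Q, TangentSpace (𝓡 4) (proj f) ≃L[ℝ] ℍ[ℝ]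
  isometry : ∀ f u v, g.inner (proj f) u v = inner ℝ (frame f u) (frame f v)
  oriented : ∀ f, Orientation.map (Fin 4) (frame f).toLinearEquiv (o (proj f)) =
    qbasis.orientation
  equivariant : ∀ (f : Q) (h : Spin4) (v : TangentSpace (𝓡 10) f),
    frame (act f h) (mfderiv (𝓡 10) (𝓡 4) proj (act f h)
      (mfderiv (𝓡 10) (𝓡 10) (fun f' => act f' h) f v)) =
    star (h.1 : ℍ[ℝ]) * frame f (mfderiv (𝓡 10) (𝓡 4) proj f v) * (h.2 : ℍ[ℝ])
  smooth_frame : OneForm.IsSmooth (I := 𝓡 10)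
    (fun f => ((frame f : TangentSpace (𝓡 4) (proj f) →L[ℝ] ℍ[ℝ])).comp
      (mfderiv (𝓡 10) (𝓡 4) proj f))

variable {g o Q}

/-- The tautological `ℍ`-valued one-form `θ` on `Q`. -/
def SpinStructure.theta (S : SpinStructure g o Q) : OneForm (𝓡 10) Q ℍ[ℝ] := fun f =>
  ((S.frame f : TangentSpace (𝓡 4) (S.proj f) →L[ℝ] ℍ[ℝ])).comp (mfderiv (𝓡 10) (𝓡 4) S.proj f)

/-- The fundamental vector field on `Q` of `(ξ, ζ) ∈ sp₊(1) ⊕ sp₋(1) = Im ℍ ⊕ Im ℍ`. -/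
def SpinStructure.fund (S : SpinStructure g o Q) (f : Q) (ξ ζ : ℍ[ℝ]) : TangentSpace (𝓡 10) f :=
  mfderiv 𝓘(ℝ, ℝ) (𝓡 10) (fun t : ℝ => S.act f (expSp1 (t • ξ), expSp1 (t • ζ))) 0 (1 : ℝ)

/-- The Levi-Civita connection on `Q`: the torsion-free connection `(φ, ψ)` with values in
`sp₊(1) ⊕ sp₋(1) = Im ℍ ⊕ Im ℍ`; the torsion is `dθ + φ ∧ θ + θ ∧ ψ`. -/
structure LeviCivita (S : SpinStructure g o Q) where
  φ : OneForm (𝓡 10) Q ℍ[ℝ]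
  ψ : OneForm (𝓡 10) Q ℍ[ℝ]
  smooth_φ : φ.IsSmooth
  smooth_ψ : ψ.IsSmooth
  re_φ : ∀ f v, (φ f v).re = 0
  re_ψ : ∀ f v, (ψ f v).re = 0
  φ_fund : ∀ f ξ ζ, φ f (S.fund f ξ ζ) = ξ.im
  ψ_fund : ∀ f ξ ζ, ψ f (S.fund f ξ ζ) = ζ.im
  φ_equivariant : ∀ f h v, φ (S.act f h) (mfderiv (𝓡 10) (𝓡 10) (fun f' => S.act f' h) f v) =
    star (h.1 : ℍ[ℝ]) * φ f v * (h.1 : ℍ[ℝ])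
  ψ_equivariant : ∀ f h v, ψ (S.act f h) (mfderiv (𝓡 10) (𝓡 10) (fun f' => S.act f' h) f v) =
    star (h.2 : ℍ[ℝ]) * ψ f v * (h.2 : ℍ[ℝ])
  torsion_free : ∀ f u v, S.theta.d f u v + (φ f u * S.theta f v - φ f v * S.theta f u) +
    (S.theta f u * ψ f v - S.theta f v * ψ f u) = 0

/-- The horizontal lift to `T_f Q` of the vector `c ∈ ℍ ≅ T_{π f} X` (identified by the frame `f`):
the vector `v` with `θ v = c` and `φ v = ψ v = 0`. -/
def LeviCivita.lift {S : SpinStructure g o Q} (L : LeviCivita S) (f : Q) (c : ℍ[ℝ]) :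
    TangentSpace (𝓡 10) f :=
  Function.invFun (fun v : TangentSpace (𝓡 10) f => (S.theta f v, L.φ f v, L.ψ f v)) (c, 0, 0)

/-- The curvature form `Φ = dφ + φ ∧ φ` of `φ`, evaluated on horizontal vectors, in the frame `f`;
its values are in `sp₊(1) = Im ℍ`. -/
def LeviCivita.Phi {S : SpinStructure g o Q} (L : LeviCivita S) (f : Q) (c c' : ℍ[ℝ]) : ℍ[ℝ] :=
  L.φ.d f (L.lift f c) (L.lift f c')
    + (L.φ f (L.lift f c) * L.φ f (L.lift f c') - L.φ f (L.lift f c') * L.φ f (L.lift f c))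

/-- The action of `Spin(4)` on `ℍ` by left multiplication with the first factor `Sp₊(1)`. -/
def spinRep : SmoothLeftAction ISpin4 𝓘(ℝ, ℍ[ℝ]) Spin4 ℍ[ℝ] where
  smul h x := (h.1 : ℍ[ℝ]) * x
  one_smul x := by simp
  mul_smul h h' x := by simp [mul_assoc]
  contMDiff_smul := contMDiff_spinRep

/-- The total space of the positive spinor bundle, `𝕎⁺ = Q ×_{Spin(4)} ℍ`. -/
abbrev SpinStructure.WPlus (S : SpinStructure g o Q) : Type _ :=
  Assoc S.toPrincipalBundle spinRep

/-- The `ℍ ⊕ ℍ`-valued one-form `(θ, η)` on `Q × ℍ`, where `η = dx + φ x` (`φ` takes the value `ξ`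
on the fundamental vector field of `ξ`). It is horizontal and equivariant for the action of
`Spin(4)` on `Q × ℍ`. -/
def LeviCivita.thetaEta {S : SpinStructure g o Q} (L : LeviCivita S) (f : Q) (x : ℍ[ℝ])
    (v : TangentSpace (𝓡 10) f) (y : ℍ[ℝ]) : ℍ[ℝ] × ℍ[ℝ] :=
  (S.theta f v, y + L.φ f v * x)

/-- The coframes of the Bryant-Salamon `Spin(7)`-structure on `𝕎⁺`. The coframe
`u : T_w 𝕎⁺ → ℍ ⊕ ℍ = ℝ⁸` at `w = [f, x]` defined by the point `(f, x)` of `Q × ℍ` is the one whose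
pull-back to `Q × ℍ` is `(θ, η)`. The Cayley form, the metric and the orientation of `𝕎⁺` at `w` are
the pull-backs by `u` of the standard ones of `ℝ⁸`; they do not depend on the choice of `(f, x)`. -/
def LeviCivita.IsCoframe {S : SpinStructure g o Q} (L : LeviCivita S) (f : Q) (x : ℍ[ℝ])
    (u : TangentSpace ((𝓡 4).prod 𝓘(ℝ, ℍ[ℝ])) (Assoc.mk S.toPrincipalBundle spinRep (f, x))
      ≃L[ℝ] ℍ[ℝ] × ℍ[ℝ]) : Prop :=
  ∀ (v : TangentSpace (𝓡 10) f) (y : ℍ[ℝ]),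
    u (mfderiv ((𝓡 10).prod 𝓘(ℝ, ℍ[ℝ])) ((𝓡 4).prod 𝓘(ℝ, ℍ[ℝ]))
      (Assoc.mk S.toPrincipalBundle spinRep) (f, x) (v, y)) = L.thetaEta f x v y

end Spin

/-! ### The `Sp(1)`-equivariant bundle over `ℝ⁴` and the induced bundle over `𝕎⁺` -/

section Target

variable (k : ℕ) (G : Type*) [TopologicalSpace G] [ChartedSpace (EuclideanSpace ℝ (Fin k)) G]
  [Group G]
  (P : Type*) [TopologicalSpace P] [ChartedSpace (EuclideanSpace ℝ (Fin (4 + k))) P]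
  [IsManifold (𝓡 (4 + k)) ∞ P]

/-- A principal `G`-bundle `P → ℝ⁴ = ℍ` with a lift to `P`, commuting with `G`, of the action of
`Sp(1)` on `ℍ` by left multiplication. -/
structure LiftedBundle extends
    PrincipalBundle 𝓘(ℝ, ℍ[ℝ]) (𝓡 k) (𝓡 (4 + k)) ℍ[ℝ] G P where
  lift : SmoothLeftAction (𝓡 3) (𝓡 (4 + k)) Sp1 P
  lift_act : ∀ q p g, lift.smul q (act p g) = act (lift.smul q p) g
  proj_lift : ∀ q p, proj (lift.smul q p) = (q : ℍ[ℝ]) * proj p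

variable {k G P}

namespace LiftedBundle

variable (PB : LiftedBundle k G P)

/-- The action of `Spin(4)` on `P` through its first factor `Sp₊(1)`. -/
def spinAct : SmoothLeftAction ISpin4 (𝓡 (4 + k)) Spin4 P where
  smul h p := PB.lift.smul h.1 p
  one_smul p := PB.lift.one_smul p
  mul_smul h h' p := PB.lift.mul_smul h.1 h'.1 p
  contMDiff_smul := PB.lift.contMDiff_smul.comp
    ((contMDiff_fst.comp contMDiff_fst).prodMk contMDiff_snd)

/-- The vector field `K_ξ` on `P` generated by `ξ ∈ sp(1) = Im ℍ`. -/
def killing (ξ : ℍ[ℝ]) (p : P) : TangentSpace (𝓡 (4 + k)) p :=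
  mfderiv 𝓘(ℝ, ℝ) (𝓡 (4 + k)) (fun t : ℝ => PB.lift.smul (expSp1 (t • ξ)) p) 0 (1 : ℝ)

/-- The space `𝒜(P)` of connections on `P`. -/
abbrev Conn : Type _ := Connection (𝓡 (4 + k)) k PB.act

variable {PB}

/-- The horizontal lift, with respect to `a ∈ 𝒜(P)`, of `e ∈ ℍ = T_y ℝ⁴` to `T_p P`. -/
def hlift (a : PB.Conn) (p : P) (e : ℍ[ℝ]) : TangentSpace (𝓡 (4 + k)) p :=
  Function.invFun (fun w : TangentSpace (𝓡 (4 + k)) p =>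
    ((mfderiv (𝓡 (4 + k)) 𝓘(ℝ, ℍ[ℝ]) PB.proj p w : ℍ[ℝ]), a.form p w)) (e, 0)

/-- The curvature `F_a ∈ Ω²(ℝ⁴; ad P)` of `a ∈ 𝒜(P)`, as a two-form on `ℍ = ℝ⁴` at each `p ∈ P`. -/
def curv (a : PB.Conn) (p : P) (e e' : ℍ[ℝ]) : LieAlg k :=
  a.curvature p (hlift a p e) (hlift a p e')

/-- The moment map `μ(a) = F_a⁺`, as an element of `Im ℍ ⊗ Lie(𝒢)`: its `i`-, `j`- and
`k`-components are the contractions of `F_a` with the self-dual forms `dx₀ ∧ dx₁ + dx₂ ∧ dx₃`,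
`dx₀ ∧ dx₂ + dx₃ ∧ dx₁` and `dx₀ ∧ dx₃ + dx₁ ∧ dx₂`. It is the moment map for the complex structures
`(I_l α)(e) = -α(i_l e)`, the forms `⟨I_l α, β⟩` and the infinitesimal action `ξ ↦ -∇ᵃ ξ`. -/
def momentMap (a : PB.Conn) (p : P) (l : Fin 3) : LieAlg k :=
  curv a p 1 (imQ l) + curv a p (imQ (l + 1)) (imQ (l + 2))

end LiftedBundle

variable {X : Type*} [TopologicalSpace X] [ChartedSpace (EuclideanSpace ℝ (Fin 4)) X]
  [IsManifold (𝓡 4) ∞ X]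
  {g : Metric4 X} {o : ∀ x : X, Orientation ℝ (TangentSpace (𝓡 4) x) (Fin 4)}
  {Q : Type*} [TopologicalSpace Q] [ChartedSpace (EuclideanSpace ℝ (Fin 10)) Q]
  [IsManifold (𝓡 10) ∞ Q]

section TotalBundle

variable (S : SpinStructure g o Q) (PB : LiftedBundle k G P)

/-- The total space of `ℙ = Q ×_{Spin(4)} P = Q₊ ×_{Sp₊(1)} P`. -/
abbrev PTotal : Type _ := Assoc S.toPrincipalBundle PB.spinAct

/-- The quotient map `Q × P → ℙ`. -/
def mkP (f : Q) (p : P) : PTotal S PB := Assoc.mk S.toPrincipalBundle PB.spinAct (f, p)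

/-- The right action `[f, p] · g = [f, p · g]` of `G` on `ℙ`. -/
def actP (z : PTotal S PB) (c : G) : PTotal S PB :=
  Quotient.map' (s₁ := assocSetoid S.toPrincipalBundle PB.spinAct)
    (s₂ := assocSetoid S.toPrincipalBundle PB.spinAct) (fun z => (z.1, PB.act z.2 c))
    (by rintro z _ ⟨h, rfl⟩; exact ⟨h, Prod.ext rfl (PB.lift_act _ _ _).symm⟩) z

/-- The projection `ℙ → 𝕎⁺`, `[f, p] ↦ [f, π p]`. -/
def projP (z : PTotal S PB) : S.WPlus :=
  Quotient.map' (s₁ := assocSetoid S.toPrincipalBundle PB.spinAct)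
    (s₂ := assocSetoid S.toPrincipalBundle spinRep) (fun z => (z.1, PB.proj z.2))
    (by rintro z _ ⟨h, rfl⟩; exact ⟨h, Prod.ext rfl (PB.proj_lift _ _)⟩) z

/-- Connections on the principal `G`-bundle `ℙ → 𝕎⁺`. -/
abbrev ConnP : Type _ := Connection ((𝓡 4).prod (𝓡 (4 + k))) k (actP S PB)

end TotalBundle

variable {S : SpinStructure g o Q} {PB : LiftedBundle k G P}

/-- `Ω`-anti-self-duality, `*(Ω ∧ F_A) = -F_A`, of a connection on `ℙ → 𝕎⁺`: at each `[f, p] ∈ ℙ`,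
the curvature is the pull-back by `ℙ → 𝕎⁺` of a two-form on `T_w 𝕎⁺`, `w = [f, π p]`, which in the
coframe `u : T_w 𝕎⁺ ≅ ℝ⁸` of the `Spin(7)`-structure is a two-form `β` with
`*(Ω ∧ β) = -β`. -/
def IsASD (L : LeviCivita S) (A : ConnP S PB) : Prop :=
  ∀ (f : Q) (p : P),
    ∃ u : TangentSpace ((𝓡 4).prod 𝓘(ℝ, ℍ[ℝ]))
        (Assoc.mk S.toPrincipalBundle spinRep (f, PB.proj p)) ≃L[ℝ] ℍ[ℝ] × ℍ[ℝ],
      L.IsCoframe f (PB.proj p) u ∧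
      ∃ β : ℍ[ℝ] × ℍ[ℝ] →L[ℝ] ℍ[ℝ] × ℍ[ℝ] →L[ℝ] LieAlg k,
        (∀ V V' : TangentSpace ((𝓡 4).prod (𝓡 (4 + k))) (mkP S PB f p),
          A.curvature (mkP S PB f p) V V' =
            β (u (mfderiv ((𝓡 4).prod (𝓡 (4 + k))) ((𝓡 4).prod 𝓘(ℝ, ℍ[ℝ])) (projP S PB)
                (mkP S PB f p) V))
              (u (mfderiv ((𝓡 4).prod (𝓡 (4 + k))) ((𝓡 4).prod 𝓘(ℝ, ℍ[ℝ])) (projP S PB)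
                (mkP S PB f p) V'))) ∧
        ∀ s t, starCayley (fun s t => β s t) s t = -β s t

variable (S PB)

/-- Sections `a ∈ Γ(𝔸)` of the bundle `𝔸 → X` with fibre `𝒜(P)`, as smooth equivariant maps
`Q → 𝒜(P)`, where `q ∈ Sp₊(1)` acts on `𝒜(P)` by pull-back with `q⁻¹`. -/
structure SectionA where
  toFun : Q → PB.Conn
  equivariant : ∀ (f : Q) (h : Spin4) (p : P) (w : TangentSpace (𝓡 (4 + k)) p),
    (toFun (S.act f h)).form p w =
      (toFun f).form (PB.lift.smul h.1 p)
        (mfderiv (𝓡 (4 + k)) (𝓡 (4 + k)) (fun p' => PB.lift.smul h.1 p') p w)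
  smooth : ContMDiff ((𝓡 10).prod (𝓡 (4 + k)).tangent) 𝓘(ℝ, LieAlg k) ∞
    (fun z : Q × TangentBundle (𝓡 (4 + k)) P => (toFun z.1).form z.2.1 z.2.2)

/-- One-forms `b ∈ Ω¹(X; 𝕃)`, where `𝕃 → X` is the bundle with fibre
`Ω⁰(ℝ⁴; ad P) = {ξ : P → Lie(G) equivariant}`, as smooth horizontal equivariant one-forms on `Q` with
values in `Ω⁰(ℝ⁴; ad P)`. -/
structure OneFormL where
  toFun : ∀ f : Q, P → (TangentSpace (𝓡 10) f →L[ℝ] LieAlg k)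
  act_right : ∀ f p (c : G) v, toFun f (PB.act p c) v = Ad c⁻¹ (toFun f p v)
  horizontal : ∀ f p v, mfderiv (𝓡 10) (𝓡 4) S.proj f v = 0 → toFun f p v = 0
  equivariant : ∀ (f : Q) (h : Spin4) (p : P) (v : TangentSpace (𝓡 10) f),
    toFun (S.act f h) p (mfderiv (𝓡 10) (𝓡 10) (fun f' => S.act f' h) f v) =
      toFun f (PB.lift.smul h.1 p) v
  smooth : ContMDiff ((𝓡 10).tangent.prod (𝓡 (4 + k))) 𝓘(ℝ, LieAlg k) ∞
    (fun z : TangentBundle (𝓡 10) Q × P => toFun z.1.1 z.2 z.1.2)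

variable {S PB}

/-- `A = â + b̂`. On `Q × P`, `â` is the form `(v, w) ↦ a_f (w + K_{φ(v)})`, which extends `a_f` from
the fibres of `ℙ → X` by zero on the horizontal subspace defined by `φ`, and `b̂` is the form
`(v, w) ↦ b(v)`; their sum descends to `ℙ`. -/
def IsSum (L : LeviCivita S) (A : ConnP S PB) (a : SectionA S PB) (b : OneFormL S PB) : Prop :=
  ∀ (f : Q) (p : P) (v : TangentSpace (𝓡 10) f) (w : TangentSpace (𝓡 (4 + k)) p),
    A.form (mkP S PB f p) (mfderiv ((𝓡 10).prod (𝓡 (4 + k))) ((𝓡 4).prod (𝓡 (4 + k)))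
        (Assoc.mk S.toPrincipalBundle PB.spinAct) (f, p) (v, w)) =
      (a.toFun f).form p (w + PB.killing (L.φ f v) p) + b.toFun f p v

/-! ### The Taubes-Pidstrygach operators

Sections over `X` are written in the frame `f ∈ Q` (identifying `T_x X` with `ℍ`), and elements of
`Ω⁰(ℝ⁴; ad P)` and `Ω¹(ℝ⁴; ad P)` are evaluated at `p ∈ P`. -/

section Operators

variable (L : LeviCivita S) (a : SectionA S PB) (b : OneFormL S PB) (f : Q) (p : P)

/-- The covariant derivative `∇ᴮ a ∈ Hom(T_x X, Ω¹(ℝ⁴; ad P))`, evaluated on `c ∈ ℍ ≅ T_x X` and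
`e ∈ ℍ = T_y ℝ⁴`. In the direction of the horizontal vector `v`, it is the derivative of
`a : Q → 𝒜(P)` along `v` plus the infinitesimal gauge action `-∇ᵃ(b(v))` of `b(v)` on `a`. -/
def nablaB (c e : ℍ[ℝ]) : LieAlg k :=
  let v := L.lift f c
  let w := LiftedBundle.hlift (a.toFun f) p e
  derivAlong (𝓡 10) (fun f' => (a.toFun f').form p w) f v -
    (derivAlong (𝓡 (4 + k)) (fun p' => b.toFun f p' v) p w +
      lieBr G ((a.toFun f).form p w) (b.toFun f p v))

/-- The complex structures `I₁, I₂, I₃` on `T𝒜(P) = Ω¹(ℝ⁴; ad P)`, induced by left multiplication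
with `i, j, k` on `ℝ⁴ = ℍ` through the identification of vectors and covectors by the metric. -/
def complexI {V : Type*} [AddCommGroup V] (l : Fin 3) (α : ℍ[ℝ] → V) : ℍ[ℝ] → V :=
  fun e => -α (imQ l * e)

/-- The projection `T ↦ ¼ (T - Σ I_l T J_l)` of `Hom_ℝ(T_x X, Ω¹(ℝ⁴; ad P))` onto the subspace of
quaternion-linear maps, where `J_l` is left multiplication with `i, j, k` on `T_x X ≅ ℍ`; its kernel
consists of the `T` with `Σ I_l T J_l = T`. -/
def cliffordProj {V : Type*} [AddCommGroup V] [Module ℝ V] (T : ℍ[ℝ] → ℍ[ℝ] → V)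
    (c e : ℍ[ℝ]) : V :=
  (1 / 4 : ℝ) • (T c e - ∑ l : Fin 3, complexI l (T (imQ l * c)) e)

/-- The generalized Dirac operator `𝒟_b a = 𝒞(∇ᴮ a)`. -/
def dirac (c e : ℍ[ℝ]) : LieAlg k := cliffordProj (nablaB L a b f p) c e

/-- The curvature `F_b = d_φ b + [b, b] ∈ Ω²(X; 𝕃)`. -/
def curvB (c c' : ℍ[ℝ]) : LieAlg k :=
  OneForm.d (fun f' => b.toFun f' p) f (L.lift f c) (L.lift f c') +
    lieBr G (b.toFun f p (L.lift f c)) (b.toFun f p (L.lift f c'))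

/-- The contraction `ι_Φ a ∈ Ω²(X; 𝕃)`, `(c, c') ↦ a(K_{Φ(c, c')})`. -/
def iotaPhi (c c' : ℍ[ℝ]) : LieAlg k :=
  (a.toFun f).form p (PB.killing (L.Phi f c c') p)

/-- The section `ν ∘ a ∈ Ω²₊(X; 𝕃)` given by the moment map `μ(a) ∈ Im ℍ ⊗ 𝕃` and the identification
`Im ℍ = sp₊(1) ≅ Λ²₊ T*X`, `ζ ↦ ¼ ⟨ζ, θ ∧ θ̄⟩`. -/
def nu (c c' : ℍ[ℝ]) : LieAlg k :=
  (1 / 4 : ℝ) • ∑ l : Fin 3, (inner ℝ (imQ l) (c * star c' - c' * star c) : ℝ) •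
    LiftedBundle.momentMap (a.toFun f) p l

end Operators

end Target

end SpinInstanton
end

/-!
The pull-back of a connection `A` to `Q × P` is a form invariant under `Spin(4)`. Its restriction to
`{f} × P` is a connection `a_f` on `P`, and what remains after subtracting `a_f(w + K_{φ(v)})` is the
form `v ↦ A(v, -K_{φ(v)})`. For vertical `v`, the vector `(v, -K_{φ(v)})` is tangent to an orbit of
`Spin(4)`, so that this form is horizontal; it is the form `b`. This gives the unique decomposition
`A = â + b̂` (`ConnP.existsUnique_isSum`).

The form `(θ, η)` on `Q × ℍ` has the same kernel as the differential of the quotient map to `𝕎⁺`, so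
the coframes of the `Spin(7)`-structure exist, and the vectors of `T_f Q × T_p P` that are horizontal
for `(φ, ψ)` and for `a_f` represent `T 𝕎⁺ ≅ ℍ ⊕ ℍ`. The curvature of `A` vanishes on vertical vectors
(`Connection.curvature_vertical`), hence it is determined by its values on these lifts. As `φ` and
`a_f` vanish there, computing the exterior derivative on `Q × P` shows that its three components are
`F_b + ι_Φ a` along `X`, `∇ᴮ a` in the mixed directions, and `F_a` along the fibres
(`ConnP.liftedCurv_base`, `ConnP.liftedCurv_mixed`, `ConnP.liftedCurv_fibre`).

It remains to solve the equation `*(Ω ∧ β) = -β` for two-forms `β` on `ℝ⁸ = ℍ ⊕ ℍ`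
(`starCayley_eq_neg_iff`). In the standard basis, numbered by `0, …, 7`, the Cayley form is a signed
sum over the affine planes of the cube `{0, 1}³`, and contraction with it permutes the seven blocks of
pairs `(a, b)` with given `a xor b ≠ 0`, each of which contributes one equation. Four of them say that
the mixed component of `β` is killed by the Clifford projection, and three of them say that the
self-dual parts of the components on the two summands `ℍ` agree. As `ζ ↦ ¼ ⟨ζ, θ ∧ θ̄⟩` sends the
contractions of a form with the standard self-dual forms to minus its self-dual part, these are for
the curvature of `A` the two equations for `(a, b)`.
-/

namespace SpinInstanton

/-! ### Signed sums over permutations -/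

/-- The vector obtained from `v` by moving its entry `i` to the front (by a transposition) and
deleting it. -/
def swapTail {X : Type*} {n : ℕ} (v : Fin (n + 1) → X) (i : Fin (n + 1)) : Fin n → X :=
  fun j => v (Equiv.swap 0 i j.succ)

/-- The sign of the transposition of `0` and `i`. -/
def swapSign {n : ℕ} (i : Fin (n + 1)) : ℤ := if i = 0 then 1 else -1

/-- Expansion of a signed sum over permutations by the image of `0`. -/
theorem sum_perm_sign_succ {X A : Type*} [AddCommGroup A] {n : ℕ} (v : Fin (n + 1) → X)
    (h : X → (Fin n → X) → A) :
    ∑ σ : Equiv.Perm (Fin (n + 1)), (Equiv.Perm.sign σ : ℤ) • h (v (σ 0)) (fun j => v (σ j.succ)) =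
      ∑ i, swapSign i • ∑ τ : Equiv.Perm (Fin n), (Equiv.Perm.sign τ : ℤ) •
        h (v i) (fun j => swapTail v i (τ j)) := by
  rw [← (Equiv.Perm.decomposeFin (n := n)).symm.sum_comp, Fintype.sum_prod_type]
  refine Finset.sum_congr rfl fun i _ => ?_
  rw [Finset.smul_sum]
  refine Finset.sum_congr rfl fun τ _ => ?_
  rw [Equiv.Perm.decomposeFin.symm_sign, Equiv.Perm.decomposeFin_symm_apply_zero]
  simp only [Equiv.Perm.decomposeFin_symm_apply_succ, swapTail, swapSign]
  split_ifs <;> simp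

/-- The part of a signed sum in which the first entry is prescribed. -/
theorem sum_perm_sign_pick {X : Type*} [DecidableEq X] {n : ℕ} (v : Fin (n + 1) → X) (x : X)
    (h : (Fin n → X) → ℤ) :
    ∑ σ : Equiv.Perm (Fin (n + 1)), (Equiv.Perm.sign σ : ℤ) *
        (if v (σ 0) = x then h (fun j => v (σ j.succ)) else 0) =
      ∑ i, if v i = x then swapSign i * ∑ τ : Equiv.Perm (Fin n), (Equiv.Perm.sign τ : ℤ) *
        h (fun j => swapTail v i (τ j)) else 0 := by
  refine (sum_perm_sign_succ v (fun y w => if y = x then h w else 0)).trans ?_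
  refine Finset.sum_congr rfl fun i _ => ?_
  split_ifs <;> simp

theorem sum_perm_two {X A : Type*} [AddCommGroup A] (h : X → X → A) (v : Fin 2 → X) :
    ∑ σ : Equiv.Perm (Fin 2), (Equiv.Perm.sign σ : ℤ) •
      h (v (σ 0)) (v (σ 1)) =
      h (v 0) (v 1) - h (v 1) (v 0) := by
  have := sum_perm_sign_succ v (fun x w => h x (w 0))
  refine this.trans ?_
  rw [Fin.sum_univ_two]
  simp only [Finset.univ_unique, Finset.sum_singleton,
    Subsingleton.elim (default : Equiv.Perm (Fin 1)) 1, Equiv.Perm.sign_one, Units.val_one, one_smul,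
    Equiv.Perm.one_apply]
  change (1 : ℤ) • h (v 0) (v 1) + (-1 : ℤ) • h (v 1) (v 0) = _
  module

/-- The antisymmetrization of a function of three variables, written out. -/
def alt3 {X A : Type*} [AddCommGroup A] (h : X → X → X → A) (a b c : X) : A :=
  (h a b c - h a c b) - (h b a c - h b c a) - (h c b a - h c a b)

theorem sum_perm_three {X A : Type*} [AddCommGroup A] (h : X → X → X → A) (v : Fin 3 → X) :
    ∑ σ : Equiv.Perm (Fin 3), (Equiv.Perm.sign σ : ℤ) •
      h (v (σ 0)) (v (σ 1)) (v (σ 2)) =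
      alt3 h (v 0) (v 1) (v 2) := by
  have := sum_perm_sign_succ v (fun x w => h x (w 0) (w 1))
  refine this.trans ?_
  rw [Fin.sum_univ_three, sum_perm_two (h (v 0)), sum_perm_two (h (v 1)), sum_perm_two (h (v 2))]
  change (1 : ℤ) • (h (v 0) (v 1) (v 2) - h (v 0) (v 2) (v 1)) +
    (-1 : ℤ) • (h (v 1) (v 0) (v 2) - h (v 1) (v 2) (v 0)) +
    (-1 : ℤ) • (h (v 2) (v 1) (v 0) - h (v 2) (v 0) (v 1)) = _
  rw [alt3]
  module

/-- The antisymmetrization of a function of four variables, written out. -/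
def alt4 {X A : Type*} [AddCommGroup A] (h : X → X → X → X → A) (a b c d : X) : A :=
  alt3 (h a) b c d - alt3 (h b) a c d - alt3 (h c) b a d - alt3 (h d) b c a

theorem sum_perm_four {X A : Type*} [AddCommGroup A] (h : X → X → X → X → A) (v : Fin 4 → X) :
    ∑ σ : Equiv.Perm (Fin 4), (Equiv.Perm.sign σ : ℤ) •
      h (v (σ 0)) (v (σ 1)) (v (σ 2)) (v (σ 3)) = alt4 h (v 0) (v 1) (v 2) (v 3) := by
  have := sum_perm_sign_succ v (fun x w => h x (w 0) (w 1) (w 2))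
  refine this.trans ?_
  rw [Fin.sum_univ_four, sum_perm_three (h (v 0)), sum_perm_three (h (v 1)),
    sum_perm_three (h (v 2)), sum_perm_three (h (v 3))]
  change (1 : ℤ) • alt3 (h (v 0)) (v 1) (v 2) (v 3) + (-1 : ℤ) • alt3 (h (v 1)) (v 0) (v 2) (v 3) +
    (-1 : ℤ) • alt3 (h (v 2)) (v 1) (v 0) (v 3) + (-1 : ℤ) • alt3 (h (v 3)) (v 1) (v 2) (v 0) = _
  rw [alt4]
  module

/-! ### The Cayley form in the standard basis -/

/-- The sign in `q_i * star q_j = ± q_(i xor j)`, where `q_0, …, q_3` are `1, i, j, k`;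
it is positive if the bit `4 * i + j` of the mask is set. -/
def conjSign (i j : ℕ) : ℤ := if Nat.testBit 0xd7b1 (4 * i + j) then 1 else -1

/-- The real part of `q_i * star q_j * (q_k * star q_l)`. -/
def quadRe (i j k l : ℕ) : ℤ :=
  if i ^^^ j = k ^^^ l then
    conjSign i j * conjSign k l * (if i ^^^ j = 0 then 1 else -1) else 0

/-- The coefficients of the four-tensor whose antisymmetrization is `-24` times the Cayley form. -/
def cayleyCoeff (p q r s : ℕ) : ℤ :=
  if p < 4 ∧ q < 4 then
    if r < 4 ∧ s < 4 then quadRe p q r s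
    else if 4 ≤ r ∧ 4 ≤ s then -6 * quadRe p q (r - 4) (s - 4) else 0
  else if 4 ≤ p ∧ 4 ≤ q ∧ 4 ≤ r ∧ 4 ≤ s then quadRe (p - 4) (q - 4) (r - 4) (s - 4) else 0

/-- The sign of `b - a`, for distinct `a` and `b`. -/
def orderSign (a b : ℕ) : ℤ := if a < b then 1 else -1

/-- The values of the Cayley form on the standard basis of `ℝ⁸`. The form is the sum, with
signs, of the fourteen products `dx_a ∧ dx_b ∧ dx_c ∧ dx_d` such that the binary expansions of
`a`, `b`, `c` and `d` form an affine plane over the field with two elements; the sign is positive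
for the four planes listed here by the sums `2 ^ a + 2 ^ b + 2 ^ c + 2 ^ d`. -/
def cayleyTable (a b c d : ℕ) : ℤ :=
  if a ^^^ b ^^^ c = d ∧ a ≠ b ∧ a ≠ c ∧ b ≠ c then
    (if 2 ^ a + 2 ^ b + 2 ^ c + 2 ^ d ∈ [15, 165, 90, 240] then 1 else -1) *
      (orderSign a b * orderSign a c * orderSign a d * orderSign b c * orderSign b d *
        orderSign c d) else 0

theorem alt4_cayleyCoeff : ∀ a b c d : Fin 8,
    alt4 cayleyCoeff a b c d = -24 * cayleyTable a b c d := by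
  decide +kernel

theorem alt4_cayleyTable : ∀ a b c d : Fin 8,
    alt4 (fun a b c d : Fin 8 => cayleyTable a b c d) a b c d = 24 * cayleyTable a b c d := by
  decide +kernel

/-- The part of the signed sum of `cayleyTable` over the last four entries of a permutation of
`0, …, 7` in which the first four entries are prescribed, as an iterated sum. -/
def dualSum (a b c d : Fin 8) : ℤ :=
  ∑ i₀, if (id : Fin 8 → Fin 8) i₀ = a then swapSign i₀ *
    ∑ i₁, if swapTail (id : Fin 8 → Fin 8) i₀ i₁ = b then swapSign i₁ *
      ∑ i₂, if swapTail (swapTail (id : Fin 8 → Fin 8) i₀) i₁ i₂ = c then swapSign i₂ *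
        ∑ i₃, if swapTail (swapTail (swapTail (id : Fin 8 → Fin 8) i₀) i₁) i₂ i₃ = d then swapSign i₃ *
          (24 * (fun w : Fin 4 → Fin 8 => cayleyTable (w 0) (w 1) (w 2) (w 3))
            (swapTail (swapTail (swapTail (swapTail (id : Fin 8 → Fin 8) i₀) i₁) i₂) i₃))
          else 0
        else 0
      else 0
    else 0

theorem dualSum_eq : ∀ a b c d : Fin 8, dualSum a b c d = 24 * cayleyTable a b c d := by
  decide +kernel

/-- Self-duality of the Cayley form, in the standard basis: summing the form over the last four
entries of the permutations with prescribed first four entries gives the form on the latter. -/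
theorem sum_perm_cayleyTable (a b c d : Fin 8) :
    ∑ σ : Equiv.Perm (Fin 8), (Equiv.Perm.sign σ : ℤ) *
      (if σ 0 = a then if σ 1 = b then if σ 2 = c then if σ 3 = d then
        cayleyTable (σ 4) (σ 5) (σ 6) (σ 7) else 0 else 0 else 0 else 0) =
      24 * cayleyTable a b c d := by
  rw [← dualSum_eq, dualSum]
  refine (sum_perm_sign_pick (id : Fin 8 → Fin 8) a
    (fun w => if w 0 = b then if w 1 = c then if w 2 = d then
      cayleyTable (w 3) (w 4) (w 5) (w 6) else 0 else 0 else 0)).trans ?_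
  refine Finset.sum_congr rfl fun i₀ _ => ?_
  congr 2
  refine (sum_perm_sign_pick (swapTail (id : Fin 8 → Fin 8) i₀) b
    (fun w => if w 0 = c then if w 1 = d then
      cayleyTable (w 2) (w 3) (w 4) (w 5) else 0 else 0)).trans ?_
  refine Finset.sum_congr rfl fun i₁ _ => ?_
  congr 2
  refine (sum_perm_sign_pick (swapTail (swapTail (id : Fin 8 → Fin 8) i₀) i₁) c
    (fun w => if w 0 = d then cayleyTable (w 1) (w 2) (w 3) (w 4) else 0)).trans ?_
  refine Finset.sum_congr rfl fun i₂ _ => ?_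
  congr 2
  refine (sum_perm_sign_pick (swapTail (swapTail (swapTail (id : Fin 8 → Fin 8) i₀) i₁) i₂) d
    (fun w => cayleyTable (w 0) (w 1) (w 2) (w 3))).trans ?_
  refine Finset.sum_congr rfl fun i₃ _ => ?_
  congr 2
  refine Eq.trans ?_ (alt4_cayleyTable _ _ _ _)
  exact sum_perm_four (fun a b c d : Fin 8 => cayleyTable a b c d)
    (swapTail (swapTail (swapTail (swapTail (id : Fin 8 → Fin 8) i₀) i₁) i₂) i₃)

theorem qvec_mul_star_qvec (i j : Fin 4) :
    qvec i * star (qvec j) = (conjSign i j : ℝ) • qvec (i ^^^ j) := by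
  apply Quaternion.ext <;>
  simp only [Quaternion.re_mul, Quaternion.imI_mul, Quaternion.imJ_mul, Quaternion.imK_mul,
    Quaternion.re_star, Quaternion.imI_star, Quaternion.imJ_star, Quaternion.imK_star,
    Quaternion.re_smul, Quaternion.imI_smul, Quaternion.imJ_smul, Quaternion.imK_smul] <;>
  fin_cases i <;> fin_cases j <;> simp [qvec, conjSign, Nat.testBit]

theorem re_qvec_mul_qvec (i j : Fin 4) :
    (qvec i * qvec j).re = if i = j then (if i = 0 then 1 else -1) else 0 := by
  rw [Quaternion.re_mul]
  fin_cases i <;> fin_cases j <;> simp [qvec]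

theorem re_qvec_quad (i j k l : Fin 4) :
    (qvec i * star (qvec j) * qvec k * star (qvec l)).re = (quadRe i j k l : ℝ) := by
  have key : ∀ i j k l : Fin 4, quadRe i j k l = conjSign i j * conjSign k l *
      (if i ^^^ j = k ^^^ l then (if i ^^^ j = 0 then 1 else -1) else 0) := by decide +kernel
  rw [mul_assoc, qvec_mul_star_qvec, qvec_mul_star_qvec, key]
  simp only [smul_mul_smul_comm, Quaternion.re_smul, re_qvec_mul_qvec, smul_eq_mul]
  push_cast
  rfl

theorem basis8_castAdd (i : Fin 4) : basis8 (Fin.castAdd 4 i) = (qvec i, 0) := by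
  fin_cases i <;> rfl

theorem basis8_natAdd (i : Fin 4) : basis8 (Fin.natAdd 4 i) = (0, qvec i) := by
  fin_cases i <;> rfl

theorem re_basis8_quad (p q r s : Fin 8) :
    ((basis8 p).1 * star (basis8 q).1 * (basis8 r).1 * star (basis8 s).1
      - (6 : ℝ) • ((basis8 p).1 * star (basis8 q).1 * (basis8 r).2 * star (basis8 s).2)
      + (basis8 p).2 * star (basis8 q).2 * (basis8 r).2 * star (basis8 s).2).re =
      (cayleyCoeff p q r s : ℝ) := by
  revert p q r s
  suffices h : ∀ p q r s : Fin (4 + 4),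
      ((basis8 p).1 * star (basis8 q).1 * (basis8 r).1 * star (basis8 s).1
      - (6 : ℝ) • ((basis8 p).1 * star (basis8 q).1 * (basis8 r).2 * star (basis8 s).2)
      + (basis8 p).2 * star (basis8 q).2 * (basis8 r).2 * star (basis8 s).2).re =
      (cayleyCoeff p q r s : ℝ) from h
  intro p q r s
  refine Fin.addCases (fun p => ?_) (fun p => ?_) p <;>
  refine Fin.addCases (fun q => ?_) (fun q => ?_) q <;>
  refine Fin.addCases (fun r => ?_) (fun r => ?_) r <;>
  refine Fin.addCases (fun s => ?_) (fun s => ?_) s <;>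
  simp only [basis8_castAdd, basis8_natAdd, star_zero, mul_zero, zero_mul, smul_zero, sub_zero,
    add_zero, zero_add, zero_sub, Quaternion.re_neg, Quaternion.re_smul, Quaternion.re_zero,
    re_qvec_quad, cayleyCoeff, Fin.val_castAdd, Fin.val_natAdd, Fin.is_lt,
    and_true, if_true, not_le.2 (Fin.is_lt _), Nat.le_add_right, Nat.add_sub_cancel_left,
    not_lt.2 (Nat.le_add_right _ _), and_false, if_false, and_self, smul_eq_mul,
    Int.cast_mul, Int.cast_neg, Int.cast_ofNat, Int.cast_zero, neg_mul]

theorem cayley_basis8 (a b c d : Fin 8) :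
    cayley ![basis8 a, basis8 b, basis8 c, basis8 d] = (cayleyTable a b c d : ℝ) := by
  have hre : ∀ F : Equiv.Perm (Fin 4) → ℍ[ℝ], (∑ σ, F σ).re = ∑ σ, (F σ).re := by
    intro F
    refine Finset.induction_on (Finset.univ : Finset (Equiv.Perm (Fin 4))) (by simp) ?_
    intro σ s hσ hs
    rw [Finset.sum_insert hσ, Finset.sum_insert hσ, Quaternion.re_add, hs]
  have h1 : cayley ![basis8 a, basis8 b, basis8 c, basis8 d] =
      -(1 / 24) * ∑ σ : Equiv.Perm (Fin 4), ((Equiv.Perm.sign σ : ℤ) : ℝ) *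
        (cayleyCoeff (![a, b, c, d] (σ 0)) (![a, b, c, d] (σ 1)) (![a, b, c, d] (σ 2))
          (![a, b, c, d] (σ 3)) : ℝ) := by
    have hv : ![basis8 a, basis8 b, basis8 c, basis8 d] = fun i => basis8 (![a, b, c, d] i) := by
      funext i
      fin_cases i <;> rfl
    rw [cayley, hv, wedge4, wedge4, wedge4, Finset.smul_sum, ← Finset.sum_sub_distrib,
      ← Finset.sum_add_distrib]
    congr 1
    rw [hre]
    refine Finset.sum_congr rfl fun σ _ => ?_
    rw [← re_basis8_quad, smul_comm (6 : ℝ), ← smul_sub, ← smul_add, Quaternion.re_smul,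
      smul_eq_mul]
  have h2 := sum_perm_four (fun a b c d : Fin 8 => cayleyCoeff a b c d) ![a, b, c, d]
  have h3 := alt4_cayleyCoeff a b c d
  have h4 : ∑ σ : Equiv.Perm (Fin 4), ((Equiv.Perm.sign σ : ℤ) : ℝ) *
        (cayleyCoeff (![a, b, c, d] (σ 0)) (![a, b, c, d] (σ 1)) (![a, b, c, d] (σ 2))
          (![a, b, c, d] (σ 3)) : ℝ) = ((-24 * cayleyTable a b c d : ℤ) : ℝ) := by
    rw [← h3]
    exact_mod_cast h2
  rw [h1, h4]
  push_cast
  ring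

theorem inner8_basis8 (a b : Fin 8) : inner8 (basis8 a) (basis8 b) = if a = b then 1 else 0 := by
  have hq : ∀ i j : Fin 4, inner ℝ (qvec i) (qvec j) = if i = j then (1 : ℝ) else 0 := by
    intro i j
    rw [Quaternion.inner_def, qvec_mul_star_qvec, Quaternion.re_smul]
    fin_cases i <;> fin_cases j <;> simp [qvec, conjSign, Nat.testBit]
  revert a b
  suffices h : ∀ a b : Fin (4 + 4),
      inner8 (basis8 a) (basis8 b) = if a = b then 1 else 0 from h
  intro a b
  refine Fin.addCases (fun a => ?_) (fun a => ?_) a <;>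
  refine Fin.addCases (fun b => ?_) (fun b => ?_) b <;>
  simp only [basis8_castAdd, basis8_natAdd, inner8, hq, inner_zero_left, inner_zero_right,
    Fin.ext_iff, Fin.val_castAdd, Fin.val_natAdd, Nat.add_left_cancel_iff, add_zero, zero_add]
  · rw [if_neg (by omega)]
  · rw [if_neg (by omega)]

/-- Contraction formula: `*(Ω ∧ β)` is the contraction of the Cayley form with `β`. -/
theorem starCayley_basis8 {V : Type*} [AddCommGroup V] [Module ℝ V]
    (β : ℍ[ℝ] × ℍ[ℝ] → ℍ[ℝ] × ℍ[ℝ] → V) (a b : Fin 8) :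
    starCayley β (basis8 a) (basis8 b) = (1 / 2 : ℝ) • ∑ c : Fin 8, ∑ d : Fin 8,
      (cayleyTable a b c d : ℝ) • β (basis8 c) (basis8 d) := by
  have key : ∀ c d : Fin 8, ∑ σ : Equiv.Perm (Fin 8), (Equiv.Perm.sign σ : ℤ) *
      (if σ 0 = a then if σ 1 = b then if σ 6 = c then if σ 7 = d then
        cayleyTable (σ 2) (σ 3) (σ 4) (σ 5) else 0 else 0 else 0 else 0) =
      24 * cayleyTable a b c d := by
    intro c d
    rw [← sum_perm_cayleyTable]
    -- the reordering `0, 1, 4, 5, 6, 7, 2, 3` of `0, …, 7` is an even permutation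
    let ρ : Equiv.Perm (Fin 8) :=
      ⟨![0, 1, 4, 5, 6, 7, 2, 3], ![0, 1, 6, 7, 2, 3, 4, 5], by decide, by decide⟩
    have hρ : Equiv.Perm.sign ρ = 1 := by decide +kernel
    rw [← Equiv.sum_comp (Equiv.mulRight ρ)]
    refine Finset.sum_congr rfl fun σ _ => ?_
    rw [Equiv.coe_mulRight, Equiv.Perm.sign_mul, hρ, mul_one]
    rfl
  have h1 : ∀ σ : Equiv.Perm (Fin 8),
      (((Equiv.Perm.sign σ : ℤ) : ℝ) * inner8 (basis8 a) (basis8 (σ 0)) *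
          inner8 (basis8 b) (basis8 (σ 1)) *
          cayley ![basis8 (σ 2), basis8 (σ 3), basis8 (σ 4), basis8 (σ 5)]) •
        β (basis8 (σ 6)) (basis8 (σ 7)) =
      ∑ c : Fin 8, ∑ d : Fin 8, (((Equiv.Perm.sign σ : ℤ) *
        (if σ 0 = a then if σ 1 = b then if σ 6 = c then if σ 7 = d then
          cayleyTable (σ 2) (σ 3) (σ 4) (σ 5) else 0 else 0 else 0 else 0) : ℤ) : ℝ) •
        β (basis8 c) (basis8 d) := by
    intro σ
    rw [Finset.sum_eq_single (σ 6), Finset.sum_eq_single (σ 7)]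
    · rw [inner8_basis8, inner8_basis8, cayley_basis8, if_pos rfl, if_pos rfl]
      congr 1
      simp only [eq_comm (a := a), eq_comm (a := b)]
      split_ifs <;> simp
    · intro d _ hd
      simp [hd.symm]
    · simp
    · intro c _ hc
      simp [hc.symm]
    · simp
  rw [starCayley, Finset.sum_congr rfl fun σ _ => h1 σ, Finset.sum_comm, Finset.smul_sum,
    Finset.smul_sum]
  refine Finset.sum_congr rfl fun c _ => ?_
  rw [Finset.sum_comm, Finset.smul_sum, Finset.smul_sum]
  refine Finset.sum_congr rfl fun d _ => ?_
  rw [← Finset.sum_smul, ← Int.cast_sum, key, smul_smul, smul_smul]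
  congr 1
  push_cast
  ring

/-! ### The anti-self-duality equations in `ℝ⁸ = ℍ ⊕ ℍ` -/

/-- Twice the coefficient of `β(e_c, e_d)` in `(*(Ω ∧ β) + β)(e_a, e_b)`, antisymmetrized. -/
def asdCoeff (a b c d : ℕ) : ℤ :=
  (if c = a ∧ d = b then 1 else 0) - (if c = b ∧ d = a then 1 else 0) + cayleyTable a b c d

/-- The anti-self-duality equations for the pairs `(e_a, e_b)` with the same `a xor b` coincide up
to sign. -/
theorem asdCoeff_eq : ∀ a b c d : Fin 8,
    asdCoeff a b c d = asdCoeff 0 (a ^^^ b : ℕ) a b * asdCoeff 0 (a ^^^ b : ℕ) c d := by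
  decide +kernel

section Bilinear

variable {V : Type*} [AddCommGroup V] [Module ℝ V]
  (B : ℍ[ℝ] × ℍ[ℝ] →ₗ[ℝ] ℍ[ℝ] × ℍ[ℝ] →ₗ[ℝ] V)

theorem starCayley_add (u u' v : ℍ[ℝ] × ℍ[ℝ]) (β : ℍ[ℝ] × ℍ[ℝ] → ℍ[ℝ] × ℍ[ℝ] → V) :
    starCayley β (u + u') v = starCayley β u v + starCayley β u' v := by
  simp only [starCayley, inner8, Prod.fst_add, Prod.snd_add, inner_add_left]
  rw [← smul_add, ← Finset.sum_add_distrib]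
  congr 1
  refine Finset.sum_congr rfl fun σ _ => ?_
  rw [← add_smul]
  congr 1
  ring

theorem starCayley_add_right (u v v' : ℍ[ℝ] × ℍ[ℝ]) (β : ℍ[ℝ] × ℍ[ℝ] → ℍ[ℝ] × ℍ[ℝ] → V) :
    starCayley β u (v + v') = starCayley β u v + starCayley β u v' := by
  simp only [starCayley, inner8, Prod.fst_add, Prod.snd_add, inner_add_left]
  rw [← smul_add, ← Finset.sum_add_distrib]
  congr 1
  refine Finset.sum_congr rfl fun σ _ => ?_
  rw [← add_smul]
  congr 1
  ring

theorem starCayley_smul (t : ℝ) (u v : ℍ[ℝ] × ℍ[ℝ]) (β : ℍ[ℝ] × ℍ[ℝ] → ℍ[ℝ] × ℍ[ℝ] → V) :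
    starCayley β (t • u) v = t • starCayley β u v := by
  simp only [starCayley, inner8, Prod.smul_fst, Prod.smul_snd, real_inner_smul_left]
  rw [smul_comm t (1 / 48 : ℝ)]
  refine congrArg ((1 / 48 : ℝ) • ·) ?_
  rw [Finset.smul_sum]
  refine Finset.sum_congr rfl fun σ _ => ?_
  rw [smul_smul]
  congr 1
  ring

theorem starCayley_smul_right (t : ℝ) (u v : ℍ[ℝ] × ℍ[ℝ]) (β : ℍ[ℝ] × ℍ[ℝ] → ℍ[ℝ] × ℍ[ℝ] → V) :
    starCayley β u (t • v) = t • starCayley β u v := by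
  simp only [starCayley, inner8, Prod.smul_fst, Prod.smul_snd, real_inner_smul_left]
  rw [smul_comm t (1 / 48 : ℝ)]
  refine congrArg ((1 / 48 : ℝ) • ·) ?_
  rw [Finset.smul_sum]
  refine Finset.sum_congr rfl fun σ _ => ?_
  rw [smul_smul]
  congr 1
  ring

theorem quaternion_eq_sum (c : ℍ[ℝ]) :
    c = c.re • qvec 0 + c.imI • qvec 1 + c.imJ • qvec 2 + c.imK • qvec 3 := by
  apply Quaternion.ext <;> simp only [Quaternion.re_add, Quaternion.imI_add, Quaternion.imJ_add,
    Quaternion.imK_add, Quaternion.re_smul, Quaternion.imI_smul, Quaternion.imJ_smul,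
    Quaternion.imK_smul] <;> simp [qvec]

theorem mem_span_basis8 (u : ℍ[ℝ] × ℍ[ℝ]) : u ∈ Submodule.span ℝ (Set.range basis8) := by
  have h : ∀ i, basis8 i ∈ Submodule.span ℝ (Set.range basis8) := fun i =>
    Submodule.subset_span ⟨i, rfl⟩
  have hu : u = u.1.re • basis8 0 + u.1.imI • basis8 1 + u.1.imJ • basis8 2 + u.1.imK • basis8 3 +
      (u.2.re • basis8 4 + u.2.imI • basis8 5 + u.2.imJ • basis8 6 + u.2.imK • basis8 7) := by
    refine Prod.ext ?_ ?_
    · refine (quaternion_eq_sum u.1).trans ?_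
      simp [basis8]
    · refine (quaternion_eq_sum u.2).trans ?_
      simp [basis8]
  rw [hu]
  have := fun (t : ℝ) i => Submodule.smul_mem _ t (h i)
  exact add_mem (add_mem (add_mem (add_mem (this _ _) (this _ _)) (this _ _)) (this _ _))
    (add_mem (add_mem (add_mem (this _ _) (this _ _)) (this _ _)) (this _ _))

/-- It suffices to check anti-self-duality on the standard basis. -/
theorem starCayley_eq_neg_iff_basis :
    (∀ s t, starCayley (fun s t => B s t) s t = -B s t) ↔
      ∀ a b, starCayley (fun s t => B s t) (basis8 a) (basis8 b) = -B (basis8 a) (basis8 b) := by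
  refine ⟨fun h a b => h _ _, fun h s t => ?_⟩
  induction mem_span_basis8 s using Submodule.span_induction with
  | mem s hs =>
    obtain ⟨a, rfl⟩ := hs
    induction mem_span_basis8 t using Submodule.span_induction with
    | mem t ht => obtain ⟨b, rfl⟩ := ht; exact h a b
    | zero => simpa using starCayley_smul_right 0 (basis8 a) 0 (fun s t => B s t)
    | add t t' _ _ ht ht' => rw [starCayley_add_right, ht, ht', map_add, neg_add]
    | smul r t _ ht => rw [starCayley_smul_right, ht, map_smul, smul_neg]
  | zero => simpa using starCayley_smul 0 0 t (fun s t => B s t)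
  | add s s' _ _ hs hs' => rw [starCayley_add, hs, hs', map_add, LinearMap.add_apply, neg_add]
  | smul r s _ hs => rw [starCayley_smul, hs, map_smul, LinearMap.smul_apply, smul_neg]

theorem starCayley_eq_neg_iff_asdCoeff (hB : ∀ s, B s s = 0) (a b : Fin 8) :
    starCayley (fun s t => B s t) (basis8 a) (basis8 b) = -B (basis8 a) (basis8 b) ↔
      ∑ c : Fin 8, ∑ d : Fin 8, (asdCoeff a b c d : ℝ) • B (basis8 c) (basis8 d) = 0 := by
  have hanti : B (basis8 b) (basis8 a) = -B (basis8 a) (basis8 b) := by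
    have := hB (basis8 a + basis8 b)
    simp only [map_add, LinearMap.add_apply, hB, zero_add, add_zero] at this
    exact eq_neg_of_add_eq_zero_left this
  have h1 : ∀ a b : Fin 8, ∑ c : Fin 8, ∑ d : Fin 8,
      ((if (c : ℕ) = a ∧ (d : ℕ) = b then (1 : ℝ) else 0) • B (basis8 c) (basis8 d)) =
        B (basis8 a) (basis8 b) := by
    intro a b
    rw [Finset.sum_eq_single a, Finset.sum_eq_single b]
    · simp
    · intro d _ hd
      rw [if_neg (fun h => hd (Fin.ext h.2)), zero_smul]
    · simp
    · intro c _ hc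
      refine Finset.sum_eq_zero fun d _ => ?_
      rw [if_neg (fun h => hc (Fin.ext h.1)), zero_smul]
    · simp
  have h2 : ∑ c : Fin 8, ∑ d : Fin 8, (asdCoeff a b c d : ℝ) • B (basis8 c) (basis8 d) =
      B (basis8 a) (basis8 b) - B (basis8 b) (basis8 a) +
        (2 : ℝ) • starCayley (fun s t => B s t) (basis8 a) (basis8 b) := by
    rw [starCayley_basis8, smul_smul, mul_one_div_cancel two_ne_zero, one_smul, ← h1 a b, ← h1 b a]
    simp only [← Finset.sum_sub_distrib, ← Finset.sum_add_distrib, ← sub_smul, ← add_smul]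
    refine Finset.sum_congr rfl fun c _ => Finset.sum_congr rfl fun d _ => ?_
    congr 1
    simp only [asdCoeff]
    push_cast
    rfl
  rw [h2, hanti, sub_neg_eq_add, ← two_smul ℝ, ← smul_add,
    smul_eq_zero_iff_right (two_ne_zero (α := ℝ)), add_comm, eq_neg_iff_add_eq_zero]

end Bilinear

section Equations

variable {V : Type*} [AddCommGroup V] [Module ℝ V]
  (B : ℍ[ℝ] × ℍ[ℝ] →ₗ[ℝ] ℍ[ℝ] × ℍ[ℝ] →ₗ[ℝ] V)

theorem asdCoeff_zero_left : ∀ m c d : Fin 8,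
    asdCoeff 0 m c d = if d = c ^^^ m then asdCoeff 0 m c (c ^^^ m : Fin 8) else 0 := by
  decide +kernel

/-- Anti-self-duality amounts to seven equations. -/
theorem starCayley_eq_neg_iff_seven (hB : ∀ s, B s s = 0) :
    (∀ s t, starCayley (fun s t => B s t) s t = -B s t) ↔
      ∀ m : Fin 8, ∑ c : Fin 8, (asdCoeff 0 m c (c ^^^ m : Fin 8) : ℝ) •
        B (basis8 c) (basis8 (c ^^^ m)) = 0 := by
  have h0 : ∀ m : Fin 8, ∑ c : Fin 8, ∑ d : Fin 8, (asdCoeff 0 m c d : ℝ) •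
      B (basis8 c) (basis8 d) = ∑ c : Fin 8, (asdCoeff 0 m c (c ^^^ m : Fin 8) : ℝ) •
        B (basis8 c) (basis8 (c ^^^ m)) := by
    intro m
    refine Finset.sum_congr rfl fun c _ => ?_
    rw [Finset.sum_eq_single (c ^^^ m)]
    · intro d _ hd
      rw [asdCoeff_zero_left, if_neg hd, Int.cast_zero, zero_smul]
    · simp
  rw [starCayley_eq_neg_iff_basis]
  simp only [starCayley_eq_neg_iff_asdCoeff B hB]
  refine ⟨fun h m => ?_, fun h a b => ?_⟩
  · rw [← h0]
    exact h 0 m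
  · have hab : (a ^^^ b : ℕ) = ((a ^^^ b : Fin 8) : ℕ) := by
      revert a b; decide +kernel
    simp only [asdCoeff_eq a b, hab, Int.cast_mul, mul_smul]
    simp only [← Finset.smul_sum]
    rw [h0, h, smul_zero]

theorem bilinear_eq_sum_qvec (f : ℍ[ℝ] →ₗ[ℝ] ℍ[ℝ] →ₗ[ℝ] V) (c e : ℍ[ℝ]) :
    f c e = (c.re * e.re) • f (qvec 0) (qvec 0)
      + (c.re * e.imI) • f (qvec 0) (qvec 1)
      + (c.re * e.imJ) • f (qvec 0) (qvec 2)
      + (c.re * e.imK) • f (qvec 0) (qvec 3)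
      + (c.imI * e.re) • f (qvec 1) (qvec 0)
      + (c.imI * e.imI) • f (qvec 1) (qvec 1)
      + (c.imI * e.imJ) • f (qvec 1) (qvec 2)
      + (c.imI * e.imK) • f (qvec 1) (qvec 3)
      + (c.imJ * e.re) • f (qvec 2) (qvec 0)
      + (c.imJ * e.imI) • f (qvec 2) (qvec 1)
      + (c.imJ * e.imJ) • f (qvec 2) (qvec 2)
      + (c.imJ * e.imK) • f (qvec 2) (qvec 3)
      + (c.imK * e.re) • f (qvec 3) (qvec 0)
      + (c.imK * e.imI) • f (qvec 3) (qvec 1)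
      + (c.imK * e.imJ) • f (qvec 3) (qvec 2)
      + (c.imK * e.imK) • f (qvec 3) (qvec 3) := by
  conv_lhs => rw [quaternion_eq_sum c, quaternion_eq_sum e]
  simp only [map_add, map_smul, LinearMap.add_apply, LinearMap.smul_apply]
  module

/-- The Clifford projection of a bilinear map depends on `(c, e)` only through `star c * e`; its four
components are the mixed anti-self-duality equations. -/
theorem cliffordProj_eq (f : ℍ[ℝ] →ₗ[ℝ] ℍ[ℝ] →ₗ[ℝ] V) (c e : ℍ[ℝ]) :
    cliffordProj (fun c e => f c e) c e = (1 / 4 : ℝ) •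
      ((star c * e).re • (f (qvec 0) (qvec 0) + f (qvec 1) (qvec 1) + f (qvec 2) (qvec 2) +
          f (qvec 3) (qvec 3)) +
        (star c * e).imI • (f (qvec 0) (qvec 1) - f (qvec 1) (qvec 0) - f (qvec 2) (qvec 3) +
          f (qvec 3) (qvec 2)) +
        (star c * e).imJ • (f (qvec 0) (qvec 2) + f (qvec 1) (qvec 3) - f (qvec 2) (qvec 0) -
          f (qvec 3) (qvec 1)) +
        (star c * e).imK • (f (qvec 0) (qvec 3) - f (qvec 1) (qvec 2) + f (qvec 2) (qvec 1) -
          f (qvec 3) (qvec 0))) := by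
  have h1 : (imQ 0).re = 0 ∧ (imQ 0).imI = 1 ∧ (imQ 0).imJ = 0 ∧ (imQ 0).imK = 0 := by
    simp [imQ, qvec]
  have h2 : (imQ 1).re = 0 ∧ (imQ 1).imI = 0 ∧ (imQ 1).imJ = 1 ∧ (imQ 1).imK = 0 := by
    simp [imQ, qvec]
  have h3 : (imQ 2).re = 0 ∧ (imQ 2).imI = 0 ∧ (imQ 2).imJ = 0 ∧ (imQ 2).imK = 1 := by
    simp [imQ, qvec]
  simp only [cliffordProj, complexI, Fin.sum_univ_three]
  rw [bilinear_eq_sum_qvec f c e, bilinear_eq_sum_qvec f (imQ 0 * c) (imQ 0 * e),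
    bilinear_eq_sum_qvec f (imQ 1 * c) (imQ 1 * e), bilinear_eq_sum_qvec f (imQ 2 * c) (imQ 2 * e)]
  simp only [Quaternion.re_mul, Quaternion.imI_mul, Quaternion.imJ_mul, Quaternion.imK_mul,
    Quaternion.re_star, Quaternion.imI_star, Quaternion.imJ_star, Quaternion.imK_star, h1, h2, h3]
  module

/-- The self-dual part of a two-form in terms of its contractions with the basis of the self-dual
forms. The sign comes from `⟨i, θ ∧ θ̄⟩ (1, i) = -2`. -/
theorem selfDual_eq (f : ℍ[ℝ] →ₗ[ℝ] ℍ[ℝ] →ₗ[ℝ] V) (hf : ∀ c, f c c = 0) (c c' : ℍ[ℝ]) :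
    selfDual (fun c c' => f c c') c c' = -(1 / 4 : ℝ) • ∑ l : Fin 3,
      (inner ℝ (imQ l) (c * star c' - c' * star c) : ℝ) •
        (f 1 (imQ l) + f (imQ (l + 1)) (imQ (l + 2))) := by
  have hanti : ∀ c c', f c c' = -f c' c := by
    intro c c'
    have := hf (c + c')
    simp only [map_add, LinearMap.add_apply, hf, zero_add, add_zero] at this
    exact eq_neg_of_add_eq_zero_right this
  have h1 : (imQ 0).re = 0 ∧ (imQ 0).imI = 1 ∧ (imQ 0).imJ = 0 ∧ (imQ 0).imK = 0 := by
    simp [imQ, qvec]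
  have h2 : (imQ 1).re = 0 ∧ (imQ 1).imI = 0 ∧ (imQ 1).imJ = 1 ∧ (imQ 1).imK = 0 := by
    simp [imQ, qvec]
  have h3 : (imQ 2).re = 0 ∧ (imQ 2).imI = 0 ∧ (imQ 2).imJ = 0 ∧ (imQ 2).imK = 1 := by
    simp [imQ, qvec]
  have hi : ∀ c, inner ℝ c (qvec 0) = c.re ∧ inner ℝ c (qvec 1) = c.imI ∧
      inner ℝ c (qvec 2) = c.imJ ∧ inner ℝ c (qvec 3) = c.imK := by
    intro c
    simp only [Quaternion.inner_def, Quaternion.re_mul, Quaternion.re_star, Quaternion.imI_star,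
      Quaternion.imJ_star, Quaternion.imK_star]
    simp [qvec]
  have hs : star2 (fun c c' => f c c') c c' = (1 / 2 : ℝ) • alt4 (fun i j k l : Fin 4 =>
      ((inner ℝ c (qvec i) : ℝ) * inner ℝ c' (qvec j)) • f (qvec k) (qvec l)) 0 1 2 3 := by
    rw [star2]
    refine congrArg ((1 / 2 : ℝ) • ·) ?_
    refine Eq.trans ?_ (sum_perm_four (fun i j k l : Fin 4 =>
      ((inner ℝ c (qvec i) : ℝ) * inner ℝ c' (qvec j)) • f (qvec k) (qvec l)) id)
    refine Finset.sum_congr rfl fun σ _ => ?_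
    rw [mul_assoc, mul_smul, Int.cast_smul_eq_zsmul]
    rfl
  have hq : (1 : ℍ[ℝ]) = qvec 0 := by ext <;> simp [qvec]
  rw [selfDual, hs, bilinear_eq_sum_qvec f c c', Fin.sum_univ_three, hq]
  change _ = -(1 / 4 : ℝ) • ((inner ℝ (imQ 0) (c * star c' - c' * star c) : ℝ) •
      (f (qvec 0) (qvec 1) + f (qvec 2) (qvec 3)) +
    (inner ℝ (imQ 1) (c * star c' - c' * star c) : ℝ) •
      (f (qvec 0) (qvec 2) + f (qvec 3) (qvec 1)) +
    (inner ℝ (imQ 2) (c * star c' - c' * star c) : ℝ) •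
      (f (qvec 0) (qvec 3) + f (qvec 1) (qvec 2)))
  simp only [alt4, alt3, hi, hf, hanti (qvec 1) (qvec 0), hanti (qvec 2) (qvec 0),
    hanti (qvec 2) (qvec 1), hanti (qvec 3) (qvec 0), hanti (qvec 3) (qvec 1),
    hanti (qvec 3) (qvec 2)]
  simp only [Quaternion.inner_def, Quaternion.re_mul, Quaternion.imI_mul, Quaternion.imJ_mul,
    Quaternion.imK_mul, Quaternion.re_sub, Quaternion.imI_sub, Quaternion.imJ_sub,
    Quaternion.imK_sub, Quaternion.re_star, Quaternion.imI_star, Quaternion.imJ_star,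
    Quaternion.imK_star, h1, h2, h3]
  module

/-- Anti-self-duality of a two-form on `ℝ⁸ = ℍ ⊕ ℍ`: the mixed components lie in the kernel of the
Clifford projection, and the self-dual parts of the two remaining components agree. The
sum over `l` is minus the self-dual part on the second summand. -/
theorem starCayley_eq_neg_iff (hB : ∀ s, B s s = 0) :
    (∀ s t, starCayley (fun s t => B s t) s t = -B s t) ↔
      (∀ c e, cliffordProj (fun c e => B (c, 0) (0, e)) c e = 0) ∧
      ∀ c c', selfDual (fun c c' => B (c, 0) (c', 0)) c c' + (1 / 4 : ℝ) • ∑ l : Fin 3,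
        (inner ℝ (imQ l) (c * star c' - c' * star c) : ℝ) •
          (B (0, 1) (0, imQ l) + B (0, imQ (l + 1)) (0, imQ (l + 2))) = 0 := by
  have hanti : ∀ s t, B s t = -B t s := by
    intro s t
    have := hB (s + t)
    simp only [map_add, LinearMap.add_apply, hB, zero_add, add_zero] at this
    exact eq_neg_of_add_eq_zero_right this
  let ι₁ := LinearMap.inl ℝ ℍ[ℝ] ℍ[ℝ]
  let ι₂ := LinearMap.inr ℝ ℍ[ℝ] ℍ[ℝ]
  have hc : ∀ c e, cliffordProj (fun c e => B (c, 0) (0, e)) c e = _ :=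
    cliffordProj_eq ((B.comp ι₁).compl₂ ι₂)
  have hs : ∀ c c', selfDual (fun c c' => B (c, 0) (c', 0)) c c' = _ :=
    selfDual_eq ((B.comp ι₁).compl₂ ι₁) fun c => hB (c, 0)
  simp only [hc, hs, LinearMap.compl₂_apply, LinearMap.comp_apply]
  change _ ↔ (∀ c e, _ = (0 : V)) ∧ ∀ c c', _ = (0 : V)
  have hq : (1 : ℍ[ℝ]) = qvec 0 := by ext <;> simp [qvec]
  set b : Fin 8 → Fin 8 → V := fun i j => B (basis8 i) (basis8 j) with hb
  -- the seven equations
  have h8 : (∀ m : Fin 8, ∑ c : Fin 8, (asdCoeff 0 m c (c ^^^ m : Fin 8) : ℝ) •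
        B (basis8 c) (basis8 (c ^^^ m)) = 0) ↔
      (b 0 1 + b 2 3 - (b 4 5 + b 6 7) = 0 ∧ b 0 2 + b 3 1 - (b 4 6 + b 7 5) = 0 ∧
        b 0 3 + b 1 2 - (b 4 7 + b 5 6) = 0) ∧
      (b 0 4 + b 1 5 + b 2 6 + b 3 7 = 0 ∧ b 0 5 - b 1 4 - b 2 7 + b 3 6 = 0 ∧
        b 0 6 + b 1 7 - b 2 4 - b 3 5 = 0 ∧ b 0 7 - b 1 6 + b 2 5 - b 3 4 = 0) := by
    have hba : ∀ i j, b j i = -b i j := fun i j => hanti _ _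
    have htwo : ∀ x y : V, x = (2 : ℝ) • y → (x = 0 ↔ y = 0) := by
      rintro x y rfl
      exact smul_eq_zero_iff_right two_ne_zero
    have e0 : ∑ c : Fin 8, (asdCoeff 0 (0 : Fin 8) c (c ^^^ 0 : Fin 8) : ℝ) • b c (c ^^^ 0) = 0 := by
      simp [asdCoeff, cayleyTable]
    have e1 : ∑ c : Fin 8, (asdCoeff 0 (1 : Fin 8) c (c ^^^ 1 : Fin 8) : ℝ) • b c (c ^^^ 1) =
        (2 : ℝ) • (b 0 1 + b 2 3 - (b 4 5 + b 6 7)) := by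
      simp [Fin.sum_univ_eight, asdCoeff, cayleyTable, orderSign]
      rw [hba 0 1, hba 2 3, hba 4 5, hba 6 7]
      module
    have e2 : ∑ c : Fin 8, (asdCoeff 0 (2 : Fin 8) c (c ^^^ 2 : Fin 8) : ℝ) • b c (c ^^^ 2) =
        (2 : ℝ) • (b 0 2 + b 3 1 - (b 4 6 + b 7 5)) := by
      simp [Fin.sum_univ_eight, asdCoeff, cayleyTable, orderSign]
      rw [hba 0 2, hba 1 3, hba 4 6, hba 5 7]
      module
    have e3 : ∑ c : Fin 8, (asdCoeff 0 (3 : Fin 8) c (c ^^^ 3 : Fin 8) : ℝ) • b c (c ^^^ 3) =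
        (2 : ℝ) • (b 0 3 + b 1 2 - (b 4 7 + b 5 6)) := by
      simp [Fin.sum_univ_eight, asdCoeff, cayleyTable, orderSign]
      rw [hba 0 3, hba 1 2, hba 4 7, hba 5 6]
      module
    have e4 : ∑ c : Fin 8, (asdCoeff 0 (4 : Fin 8) c (c ^^^ 4 : Fin 8) : ℝ) • b c (c ^^^ 4) =
        (2 : ℝ) • (b 0 4 + b 1 5 + b 2 6 + b 3 7) := by
      simp [Fin.sum_univ_eight, asdCoeff, cayleyTable, orderSign]
      rw [hba 0 4, hba 1 5, hba 2 6, hba 3 7]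
      module
    have e5 : ∑ c : Fin 8, (asdCoeff 0 (5 : Fin 8) c (c ^^^ 5 : Fin 8) : ℝ) • b c (c ^^^ 5) =
        (2 : ℝ) • (b 0 5 - b 1 4 - b 2 7 + b 3 6) := by
      simp [Fin.sum_univ_eight, asdCoeff, cayleyTable, orderSign]
      rw [hba 0 5, hba 1 4, hba 2 7, hba 3 6]
      module
    have e6 : ∑ c : Fin 8, (asdCoeff 0 (6 : Fin 8) c (c ^^^ 6 : Fin 8) : ℝ) • b c (c ^^^ 6) =
        (2 : ℝ) • (b 0 6 + b 1 7 - b 2 4 - b 3 5) := by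
      simp [Fin.sum_univ_eight, asdCoeff, cayleyTable, orderSign]
      rw [hba 0 6, hba 1 7, hba 2 4, hba 3 5]
      module
    have e7 : ∑ c : Fin 8, (asdCoeff 0 (7 : Fin 8) c (c ^^^ 7 : Fin 8) : ℝ) • b c (c ^^^ 7) =
        (2 : ℝ) • (b 0 7 - b 1 6 + b 2 5 - b 3 4) := by
      simp [Fin.sum_univ_eight, asdCoeff, cayleyTable, orderSign]
      rw [hba 0 7, hba 1 6, hba 2 5, hba 3 4]
      module
    constructor
    · intro h
      exact ⟨⟨(htwo _ _ e1).1 (h 1), (htwo _ _ e2).1 (h 2), (htwo _ _ e3).1 (h 3)⟩,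
        (htwo _ _ e4).1 (h 4), (htwo _ _ e5).1 (h 5), (htwo _ _ e6).1 (h 6), (htwo _ _ e7).1 (h 7)⟩
    · rintro ⟨⟨h1, h2, h3⟩, h4, h5, h6, h7⟩ m
      fin_cases m
      exacts [e0, (htwo _ _ e1).2 h1, (htwo _ _ e2).2 h2, (htwo _ _ e3).2 h3, (htwo _ _ e4).2 h4,
        (htwo _ _ e5).2 h5, (htwo _ _ e6).2 h6, (htwo _ _ e7).2 h7]
  rw [starCayley_eq_neg_iff_seven B hB, h8, and_comm]
  have hsum : ∀ c c' : ℍ[ℝ], -(1 / 4 : ℝ) • ∑ l : Fin 3,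
      (inner ℝ (imQ l) (c * star c' - c' * star c) : ℝ) •
        (B (1, 0) (imQ l, 0) + B (imQ (l + 1), 0) (imQ (l + 2), 0)) + (1 / 4 : ℝ) • ∑ l : Fin 3,
      (inner ℝ (imQ l) (c * star c' - c' * star c) : ℝ) •
        (B (0, 1) (0, imQ l) + B (0, imQ (l + 1)) (0, imQ (l + 2))) =
      -(1 / 4 : ℝ) • ((inner ℝ (imQ 0) (c * star c' - c' * star c) : ℝ) •
          (b 0 1 + b 2 3 - (b 4 5 + b 6 7)) +
        (inner ℝ (imQ 1) (c * star c' - c' * star c) : ℝ) • (b 0 2 + b 3 1 - (b 4 6 + b 7 5)) +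
        (inner ℝ (imQ 2) (c * star c' - c' * star c) : ℝ) • (b 0 3 + b 1 2 - (b 4 7 + b 5 6))) := by
    intro c c'
    rw [Fin.sum_univ_three, Fin.sum_univ_three, hq]
    change -(1 / 4 : ℝ) • (_ • (b 0 1 + b 2 3) + _ • (b 0 2 + b 3 1) + _ • (b 0 3 + b 1 2)) +
      (1 / 4 : ℝ) • (_ • (b 4 5 + b 6 7) + _ • (b 4 6 + b 7 5) + _ • (b 4 7 + b 5 6)) = _
    module
  refine and_congr ?_ ?_
  · constructor
    · rintro ⟨h4, h5, h6, h7⟩ c e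
      change (1 / 4 : ℝ) • (_ • (b 0 4 + b 1 5 + b 2 6 + b 3 7) +
        _ • (b 0 5 - b 1 4 - b 2 7 + b 3 6) + _ • (b 0 6 + b 1 7 - b 2 4 - b 3 5) +
        _ • (b 0 7 - b 1 6 + b 2 5 - b 3 4)) = 0
      simp only [h4, h5, h6, h7, smul_zero, add_zero]
    · intro h
      have h' : ∀ e : ℍ[ℝ], (1 / 4 : ℝ) • (e.re • (b 0 4 + b 1 5 + b 2 6 + b 3 7) +
          e.imI • (b 0 5 - b 1 4 - b 2 7 + b 3 6) + e.imJ • (b 0 6 + b 1 7 - b 2 4 - b 3 5) +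
          e.imK • (b 0 7 - b 1 6 + b 2 5 - b 3 4)) = 0 := by
        intro e
        have := h 1 e
        rw [star_one, one_mul] at this
        exact this
      have g : ∀ e, _ := fun e => (smul_eq_zero_iff_right (by norm_num)).1 (h' e)
      exact ⟨by simpa using g ⟨1, 0, 0, 0⟩, by simpa using g ⟨0, 1, 0, 0⟩,
        by simpa using g ⟨0, 0, 1, 0⟩, by simpa using g ⟨0, 0, 0, 1⟩⟩
  · constructor
    · rintro ⟨h1, h2, h3⟩ c c'
      refine (hsum c c').trans ?_
      simp only [h1, h2, h3, smul_zero, add_zero]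
    · intro h
      have hw : ∀ l m : Fin 3, inner ℝ (imQ l) (1 * star (imQ m) - imQ m * star 1) =
          if l = m then (-2 : ℝ) else 0 := by
        intro l m
        rw [star_one, one_mul, mul_one]
        simp only [Quaternion.inner_def, Quaternion.re_mul, Quaternion.re_star,
          Quaternion.imI_star, Quaternion.imJ_star, Quaternion.imK_star, Quaternion.re_sub,
          Quaternion.imI_sub, Quaternion.imJ_sub, Quaternion.imK_sub]
        fin_cases l <;> fin_cases m <;> simp [imQ, qvec] <;> norm_num
      have g := fun m => (hsum 1 (imQ m)).symm.trans (h 1 (imQ m))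
      simp only [hw] at g
      exact ⟨by simpa using g 0, by simpa using g 1, by simpa using g 2⟩

end Equations

/-! ### Pull-backs of one-forms to vector spaces -/

theorem two_le_infty : (2 : WithTop ℕ∞) ≤ ∞ := WithTop.coe_le_coe.2 le_top

section Pullback

variable {E H : Type*} [NormedAddCommGroup E] [NormedSpace ℝ E] [TopologicalSpace H]
  {I : ModelWithCorners ℝ E H} {M : Type*} [TopologicalSpace M] [ChartedSpace H M]
  {F : Type*} [NormedAddCommGroup F] [NormedSpace ℝ F]
  {E' : Type*} [NormedAddCommGroup E'] [NormedSpace ℝ E']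
  {E'' : Type*} [NormedAddCommGroup E''] [NormedSpace ℝ E'']

/-- The pull-back of a one-form by a map defined on a vector space. -/
noncomputable def OneForm.pullback (α : OneForm I M F) (Ψ : E' → M) (x : E') : E' →L[ℝ] F :=
  (α (Ψ x)).comp (mfderiv 𝓘(ℝ, E') I Ψ x)

theorem OneForm.pullback_apply (α : OneForm I M F) (Ψ : E' → M) (x u : E') :
    α.pullback Ψ x u = α (Ψ x) (mfderiv 𝓘(ℝ, E') I Ψ x u) := rfl

theorem OneForm.pullback_comp (α : OneForm I M F) {Ψ : E' → M} {f : E'' → E'} {x : E''}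
    (hΨ : MDifferentiableAt 𝓘(ℝ, E') I Ψ (f x)) (hf : DifferentiableAt ℝ f x) :
    α.pullback (Ψ ∘ f) x = (α.pullback Ψ (f x)).comp (fderiv ℝ f x) := by
  have h := mfderiv_comp x hΨ hf.mdifferentiableAt
  ext u
  change α _ (mfderiv 𝓘(ℝ, E'') I (Ψ ∘ f) x u) = _
  rw [h, mfderiv_eq_fderiv]
  rfl

theorem OneForm.IsSmooth.contDiffOn_pullback [IsManifold I ∞ M] [FiniteDimensional ℝ E']
    {α : OneForm I M F} (hα : α.IsSmooth) {Ψ : E' → M} {U : Set E'} (hU : IsOpen U)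
    (hΨ : ContMDiffOn 𝓘(ℝ, E') I ∞ Ψ U) : ContDiffOn ℝ ∞ (α.pullback Ψ) U := by
  rw [contDiffOn_clm_apply]
  intro u
  rw [← contMDiffOn_iff_contDiffOn]
  have h1 : ContMDiffOn 𝓘(ℝ, E').tangent I.tangent ∞ (tangentMapWithin 𝓘(ℝ, E') I Ψ U)
      (TotalSpace.proj ⁻¹' U) :=
    hΨ.contMDiffOn_tangentMapWithin (by simp) hU.uniqueMDiffOn
  have h2 : ContMDiff 𝓘(ℝ, E') 𝓘(ℝ, E').tangent ∞
      (fun x : E' => (⟨x, u⟩ : TangentBundle 𝓘(ℝ, E') E')) := by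
    intro x
    exact contMDiffAt_vectorSpace_iff_contDiffAt.2 contDiffAt_const
  refine (ContMDiff.comp_contMDiffOn hα (h1.comp h2.contMDiffOn fun x hx => hx)).congr ?_
  intro x hx
  change α.pullback Ψ x u = α (Ψ x) (mfderivWithin 𝓘(ℝ, E') I Ψ U x u)
  rw [mfderivWithin_of_isOpen hU hx]
  rfl

variable [I.Boundaryless]

theorem mfderiv_extChartAt_symm_self [IsManifold I 1 M] (x : M) (v : E) :
    mfderiv 𝓘(ℝ, E) I (extChartAt I x).symm (extChartAt I x x) v = v := by
  have h := mfderivWithin_range_extChartAt_symm (I := I) (x := x)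
  rw [I.range_eq_univ, mfderivWithin_univ] at h
  rw [h]
  rfl

theorem OneForm.inChart_self [IsManifold I 1 M] (α : OneForm I M F) (x : M) (v : E) :
    α.inChart x (extChartAt I x x) v = α x v := by
  have h1 : (extChartAt I x).symm (extChartAt I x x) = x := extChartAt_to_inv x
  change α ((extChartAt I x).symm (extChartAt I x x))
    (mfderiv 𝓘(ℝ, E) I (extChartAt I x).symm (extChartAt I x x) v) = α x v
  rw [mfderiv_extChartAt_symm_self]
  have : ∀ y, y = x → α y (v : E) = α x (v : E) := by rintro _ rfl; rfl
  exact this _ h1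

/-- The exterior derivative of the pull-back of a one-form by a map defined on a vector space. -/
theorem OneForm.IsSmooth.d_pullback [IsManifold I ∞ M] [FiniteDimensional ℝ E]
    {α : OneForm I M F} (hα : α.IsSmooth) {Ψ : E' → M} {x : E'}
    (hΨ : ∀ᶠ y in nhds x, ContMDiffAt 𝓘(ℝ, E') I ∞ Ψ y) (u v : E') :
    α.d (Ψ x) (mfderiv 𝓘(ℝ, E') I Ψ x u) (mfderiv 𝓘(ℝ, E') I Ψ x v) =
      fderiv ℝ (α.pullback Ψ) x u v - fderiv ℝ (α.pullback Ψ) x v u := by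
  have : IsManifold I 1 M := IsManifold.of_le (n := ∞) (by simp)
  set c := extChartAt I (Ψ x) with hc
  set ψ : E' → E := c ∘ Ψ with hψ
  have hx : ContMDiffAt 𝓘(ℝ, E') I ∞ Ψ x := hΨ.self_of_nhds
  have hsrc : ∀ᶠ y in nhds x, Ψ y ∈ c.source :=
    hx.continuousAt.eventually (extChartAt_source_mem_nhds (Ψ x))
  have hψs : ∀ᶠ y in nhds x, ContDiffAt ℝ ∞ ψ y := by
    filter_upwards [hΨ, hsrc] with y hy hy'
    rw [← contMDiffAt_iff_contDiffAt]
    exact (contMDiffAt_extChartAt' (by rwa [← extChartAt_source I])).comp y hy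
  have htgt : IsOpen c.target := isOpen_extChartAt_target (Ψ x)
  have hchart : ContDiffOn ℝ ∞ (α.inChart (Ψ x)) c.target :=
    hα.contDiffOn_pullback htgt (contMDiffOn_extChartAt_symm (Ψ x))
  -- near `x`, the map is `c.symm ∘ ψ`
  have hpull : α.pullback Ψ =ᶠ[nhds x] fun y => (α.inChart (Ψ x) (ψ y)).comp (fderiv ℝ ψ y) := by
    filter_upwards [hsrc.eventually_nhds, hψs] with y hy hy'
    have hΨy : Ψ =ᶠ[nhds y] c.symm ∘ ψ := by
      filter_upwards [hy] with z hz
      exact (c.left_inv hz).symm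
    have h1 : α.pullback Ψ y = α.pullback (c.symm ∘ ψ) y := by
      ext w
      rw [OneForm.pullback_apply, OneForm.pullback_apply, hΨy.mfderiv_eq]
      have : ∀ z z', z = z' → ∀ w : E, α z w = α z' w := by rintro _ _ rfl w; rfl
      exact this _ _ hΨy.self_of_nhds _
    rw [h1]
    refine OneForm.pullback_comp α ?_ (hy'.differentiableAt (by simp))
    have : ψ y ∈ c.target := c.map_source hy.self_of_nhds
    exact ((contMDiffOn_extChartAt_symm (n := ∞) (Ψ x)).contMDiffAt
      (htgt.mem_nhds this)).mdifferentiableAt (by simp)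
  have hψx : ContDiffAt ℝ ∞ ψ x := hψs.self_of_nhds
  have hd1 : DifferentiableAt ℝ (α.inChart (Ψ x)) (ψ x) :=
    (hchart.contDiffAt (htgt.mem_nhds (mem_extChartAt_target (Ψ x)))).differentiableAt (by simp)
  have hd2 : DifferentiableAt ℝ ψ x := hψx.differentiableAt (by simp)
  have hd3 : DifferentiableAt ℝ (fderiv ℝ ψ) x :=
    (hψx.fderiv_right (m := 1) (by norm_cast)).differentiableAt (by simp)
  have hsymm : ∀ u v, fderiv ℝ (fderiv ℝ ψ) x u v = fderiv ℝ (fderiv ℝ ψ) x v u := by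
    intro u v
    exact (hψx.isSymmSndFDerivAt (by simpa using two_le_infty)) u v
  have hD : ∀ u v, fderiv ℝ (α.pullback Ψ) x u v =
      fderiv ℝ (α.inChart (Ψ x)) (ψ x) (fderiv ℝ ψ x u) (fderiv ℝ ψ x v) +
        α.inChart (Ψ x) (ψ x) (fderiv ℝ (fderiv ℝ ψ) x u v) := by
    intro u v
    have hcomp : HasFDerivAt (fun y => α.inChart (Ψ x) (ψ y))
      ((fderiv ℝ (α.inChart (Ψ x)) (ψ x)).comp (fderiv ℝ ψ x)) x :=
      hd1.hasFDerivAt.comp x hd2.hasFDerivAt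
    rw [hpull.fderiv_eq, (hcomp.clm_comp hd3.hasFDerivAt).fderiv]
    simp [add_comm]
  have hmf : ∀ w : E', (mfderiv 𝓘(ℝ, E') I Ψ x w : E) = fderiv ℝ ψ x w := by
    intro w
    have hm := hx.mdifferentiableAt (by simp)
    rw [hm.mfderiv]
    simp [writtenInExtChartAt]
    rfl
  rw [hD, hD, hsymm u v, add_sub_add_right_eq_sub, ← hmf u, ← hmf v]
  rfl

end Pullback

/-! ### The derivative of the adjoint representation -/

section Adjoint

variable {k : ℕ} {G : Type*} [TopologicalSpace G] [ChartedSpace (EuclideanSpace ℝ (Fin k)) G]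
  [Group G] [LieGroup (𝓡 k) ∞ G]

variable (k G) in
/-- The multiplication of a Lie group in the preferred chart at `1`. -/
noncomputable def chartMul (z : LieAlg k × LieAlg k) : LieAlg k :=
  extChartAt (𝓡 k) (1 : G) ((extChartAt (𝓡 k) (1 : G)).symm z.1 *
    (extChartAt (𝓡 k) (1 : G)).symm z.2)

theorem contDiffAt_chartMul (g : G) (hg : g ∈ (extChartAt (𝓡 k) (1 : G)).source) :
    ContDiffAt ℝ ∞ (chartMul k G) (extChartAt (𝓡 k) (1 : G) g, extChartAt (𝓡 k) (1 : G) 1) ∧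
    ContDiffAt ℝ ∞ (chartMul k G) (extChartAt (𝓡 k) (1 : G) 1, extChartAt (𝓡 k) (1 : G) g) := by
  have : IsManifold (𝓡 k) ∞ G := ContMDiffMul.toIsManifold
  have hsymm : ∀ g ∈ (extChartAt (𝓡 k) (1 : G)).source,
      ContMDiffAt 𝓘(ℝ, LieAlg k) (𝓡 k) ∞ (extChartAt (𝓡 k) (1 : G)).symm
        (extChartAt (𝓡 k) (1 : G) g) := fun g hg =>
    (contMDiffOn_extChartAt_symm (n := ∞) (1 : G)).contMDiffAt
      ((isOpen_extChartAt_target (I := 𝓡 k) (1 : G)).mem_nhds ((extChartAt (𝓡 k) (1 : G)).map_source hg))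
  have h1 : (1 : G) ∈ (extChartAt (𝓡 k) (1 : G)).source := mem_extChartAt_source 1
  have key : ∀ g h : G, g ∈ (extChartAt (𝓡 k) (1 : G)).source →
      h ∈ (extChartAt (𝓡 k) (1 : G)).source → g * h ∈ (extChartAt (𝓡 k) (1 : G)).source →
      ContDiffAt ℝ ∞ (chartMul k G) (extChartAt (𝓡 k) (1 : G) g, extChartAt (𝓡 k) (1 : G) h) := by
    intro g h hg hh hgh
    rw [← contMDiffAt_iff_contDiffAt]
    have e1 : ContMDiffAt 𝓘(ℝ, LieAlg k × LieAlg k) (𝓡 k) ∞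
        (fun z : LieAlg k × LieAlg k => (extChartAt (𝓡 k) (1 : G)).symm z.1 *
          (extChartAt (𝓡 k) (1 : G)).symm z.2)
          (extChartAt (𝓡 k) (1 : G) g, extChartAt (𝓡 k) (1 : G) h) := by
      refine ContMDiffAt.mul (I := 𝓡 k) ?_ ?_
      · exact ContMDiffAt.comp _ (hsymm g hg) contDiffAt_fst.contMDiffAt
      · exact ContMDiffAt.comp _ (hsymm h hh) contDiffAt_snd.contMDiffAt
    refine ContMDiffAt.comp _ (contMDiffAt_extChartAt' ?_) e1
    rw [← extChartAt_source (𝓡 k)]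
    simpa only [(extChartAt (𝓡 k) (1 : G)).left_inv hg, (extChartAt (𝓡 k) (1 : G)).left_inv hh]
  exact ⟨key g 1 hg h1 (by rwa [mul_one]), key 1 g h1 hg (by rwa [one_mul])⟩

/-- The differential at `1` of a self-map of the group, read in the chart at `1`. -/
theorem fderiv_chart_conj (f : G → G) (hf : MDifferentiableAt (𝓡 k) (𝓡 k) f 1)
    (hy : f 1 ∈ (extChartAt (𝓡 k) (1 : G)).source) (w : LieAlg k) :
    fderiv ℝ (fun h => extChartAt (𝓡 k) (1 : G) (f ((extChartAt (𝓡 k) (1 : G)).symm h)))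
      (extChartAt (𝓡 k) (1 : G) 1) w =
      mfderiv (𝓡 k) 𝓘(ℝ, LieAlg k) (extChartAt (𝓡 k) (1 : G)) (f 1)
        (mfderiv (𝓡 k) (𝓡 k) f 1 w) := by
  have : IsManifold (𝓡 k) ∞ G := ContMDiffMul.toIsManifold
  have : IsManifold (𝓡 k) 1 G := IsManifold.of_le (n := ∞) (by simp)
  set c := extChartAt (𝓡 k) (1 : G) with hc
  have h1 : c.symm (c 1) = 1 := extChartAt_to_inv (1 : G)
  have hcs : MDifferentiableAt 𝓘(ℝ, LieAlg k) (𝓡 k) c.symm (c 1) :=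
    ((contMDiffOn_extChartAt_symm (n := ∞) (1 : G)).contMDiffAt
      ((isOpen_extChartAt_target (I := 𝓡 k) (1 : G)).mem_nhds
        (mem_extChartAt_target (1 : G)))).mdifferentiableAt (by simp)
  have hcd : MDifferentiableAt (𝓡 k) 𝓘(ℝ, LieAlg k) c (f 1) :=
    mdifferentiableAt_extChartAt (by rwa [← extChartAt_source (𝓡 k)])
  have hcf : MDifferentiableAt (𝓡 k) 𝓘(ℝ, LieAlg k) (c ∘ f) 1 := hcd.comp 1 hf
  rw [← mfderiv_eq_fderiv]
  have e := mfderiv_comp_of_eq (x := c 1) (g := c ∘ f) (f := c.symm) hcf hcs h1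
  have e2 := mfderiv_comp (1 : G) hcd hf
  change mfderiv 𝓘(ℝ, LieAlg k) 𝓘(ℝ, LieAlg k) ((c ∘ f) ∘ c.symm) (c 1) w = _
  rw [e]
  change mfderiv (𝓡 k) 𝓘(ℝ, LieAlg k) (c ∘ f) (c.symm (c 1))
    (mfderiv 𝓘(ℝ, LieAlg k) (𝓡 k) c.symm (c 1) w) = _
  rw [mfderiv_extChartAt_symm_self]
  have e3 : ∀ z : G, z = 1 → ∀ w : LieAlg k, (mfderiv (𝓡 k) 𝓘(ℝ, LieAlg k) (c ∘ f) z w : LieAlg k) =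
      mfderiv (𝓡 k) 𝓘(ℝ, LieAlg k) (c ∘ f) 1 w := by rintro _ rfl w; rfl
  rw [e3 _ h1, e2]
  rfl

/-- In the chart at `1`, the partial differentials of the multiplication at `(g, 1)` and `(1, g)` are
the left-invariant and the right-invariant vector fields. -/
theorem fderiv_chartMul (g : G) (hg : g ∈ (extChartAt (𝓡 k) (1 : G)).source) (w : LieAlg k) :
    fderiv ℝ (chartMul k G) (extChartAt (𝓡 k) (1 : G) g, extChartAt (𝓡 k) (1 : G) 1) (0, w) =
      (mfderiv (𝓡 k) 𝓘(ℝ, LieAlg k) (extChartAt (𝓡 k) (1 : G)) g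
        (mulInvariantVectorField (I := 𝓡 k) w g) : LieAlg k) ∧
    fderiv ℝ (chartMul k G) (extChartAt (𝓡 k) (1 : G) 1, extChartAt (𝓡 k) (1 : G) g) (w, 0) =
      (mfderiv (𝓡 k) 𝓘(ℝ, LieAlg k) (extChartAt (𝓡 k) (1 : G)) g
        (mfderiv (𝓡 k) (𝓡 k) (fun h : G => h * g) 1 w : LieAlg k) : LieAlg k) := by
  have : IsManifold (𝓡 k) ∞ G := ContMDiffMul.toIsManifold
  have h1 : (extChartAt (𝓡 k) (1 : G)).symm (extChartAt (𝓡 k) (1 : G) 1) = 1 := extChartAt_to_inv (1 : G)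
  have hl : (extChartAt (𝓡 k) (1 : G)).symm (extChartAt (𝓡 k) (1 : G) g) = g :=
    (extChartAt (𝓡 k) (1 : G)).left_inv hg
  have hpt : ∀ z z' : G, z = z' → ∀ u : LieAlg k,
      (mfderiv (𝓡 k) 𝓘(ℝ, LieAlg k) (extChartAt (𝓡 k) (1 : G)) z u : LieAlg k) =
        mfderiv (𝓡 k) 𝓘(ℝ, LieAlg k) (extChartAt (𝓡 k) (1 : G)) z' u := by
    rintro _ _ rfl u; rfl
  obtain ⟨c1, c2⟩ := contDiffAt_chartMul g hg
  constructor
  · have e := fderiv_chart_conj (k := k) (fun h : G => g * h)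
      (contMDiff_mul_left.contMDiffAt.mdifferentiableAt (n := ∞) (by simp)) (by simpa using hg) w
    refine Eq.trans ?_ (e.trans (hpt (g * 1) g (mul_one g) _))
    have hd := (c1.differentiableAt (by simp)).hasFDerivAt.comp
      (extChartAt (𝓡 k) (1 : G) 1) (hasFDerivAt_prodMk_right _ _)
    have : (fun h => extChartAt (𝓡 k) (1 : G) (g * (extChartAt (𝓡 k) (1 : G)).symm h)) =
        chartMul k G ∘ fun h => (extChartAt (𝓡 k) (1 : G) g, h) := by
      funext h
      simp only [chartMul, Function.comp, hl]
    rw [this, hd.fderiv]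
    rfl
  · have e := fderiv_chart_conj (k := k) (fun h : G => h * g)
      (contMDiff_mul_right.contMDiffAt.mdifferentiableAt (n := ∞) (by simp)) (by simpa using hg) w
    refine Eq.trans ?_ (e.trans (hpt (1 * g) g (one_mul g) _))
    have hd := (c2.differentiableAt (by simp)).hasFDerivAt.comp
      (extChartAt (𝓡 k) (1 : G) 1) (f := fun h : LieAlg k => (h, extChartAt (𝓡 k) (1 : G) g)) (hasFDerivAt_prodMk_left _ _)
    have : (fun h => extChartAt (𝓡 k) (1 : G) ((extChartAt (𝓡 k) (1 : G)).symm h * g)) =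
        chartMul k G ∘ fun h => (h, extChartAt (𝓡 k) (1 : G) g) := by
      funext h
      simp only [chartMul, Function.comp, hl]
    rw [this, hd.fderiv]
    rfl

/-- The left-invariant vector fields in the chart at `1`. -/
theorem mpullbackWithin_mulInvariantVectorField (w h : LieAlg k)
    (hh : h ∈ (extChartAt (𝓡 k) (1 : G)).target) :
    (VectorField.mpullbackWithin 𝓘(ℝ, LieAlg k) (𝓡 k) (extChartAt (𝓡 k) (1 : G)).symm
      (mulInvariantVectorField (I := 𝓡 k) (G := G) w) (Set.range (𝓡 k)) h : LieAlg k) =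
    fderiv ℝ (chartMul k G) (h, extChartAt (𝓡 k) (1 : G) 1) (0, w) := by
  have : IsManifold (𝓡 k) ∞ G := ContMDiffMul.toIsManifold
  have : IsManifold (𝓡 k) 1 G := IsManifold.of_le (n := ∞) (by simp)
  have e := (fderiv_chartMul ((extChartAt (𝓡 k) (1 : G)).symm h)
    ((extChartAt (𝓡 k) (1 : G)).map_target hh) w).1
  rw [(extChartAt (𝓡 k) (1 : G)).right_inv hh] at e
  rw [e, VectorField.mpullbackWithin_apply, ContinuousLinearMap.inverse_eq
    (mfderivWithin_extChartAt_symm_comp_mfderiv_extChartAt hh)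
    (mfderiv_extChartAt_comp_mfderivWithin_extChartAt_symm hh)]

theorem fderiv_chartMul_one (w : LieAlg k) :
    fderiv ℝ (chartMul k G) (extChartAt (𝓡 k) (1 : G) 1, extChartAt (𝓡 k) (1 : G) 1) (0, w) = w ∧
    fderiv ℝ (chartMul k G) (extChartAt (𝓡 k) (1 : G) 1, extChartAt (𝓡 k) (1 : G) 1) (w, 0) = w := by
  have : IsManifold (𝓡 k) ∞ G := ContMDiffMul.toIsManifold
  have : IsManifold (𝓡 k) 1 G := IsManifold.of_le (n := ∞) (by simp)
  obtain ⟨e1, e2⟩ := fderiv_chartMul (k := k) (1 : G) (mem_extChartAt_source 1) w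
  have hid : ∀ f : G → G, f = id → (mfderiv (𝓡 k) (𝓡 k) f 1 w : LieAlg k) = w := by
    rintro _ rfl
    rw [mfderiv_id]
    rfl
  rw [e1, e2, mfderiv_extChartAt_self]
  constructor
  · change (mfderiv (𝓡 k) (𝓡 k) (fun h : G => 1 * h) 1 w : LieAlg k) = w
    exact hid _ (funext one_mul)
  · change (mfderiv (𝓡 k) (𝓡 k) (fun h : G => h * 1) 1 w : LieAlg k) = w
    exact hid _ (funext mul_one)

/-- In the chart at `1`, the Lie bracket is the antisymmetrized second derivative of the
multiplication. -/
theorem lieBr_eq_fderiv_chartMul (v w : LieAlg k) :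
    lieBr G v w =
      fderiv ℝ (fderiv ℝ (chartMul k G))
        (extChartAt (𝓡 k) (1 : G) 1, extChartAt (𝓡 k) (1 : G) 1) (v, 0) (0, w) -
      fderiv ℝ (fderiv ℝ (chartMul k G))
        (extChartAt (𝓡 k) (1 : G) 1, extChartAt (𝓡 k) (1 : G) 1) (w, 0) (0, v) := by
  have : IsManifold (𝓡 k) ∞ G := ContMDiffMul.toIsManifold
  have : IsManifold (𝓡 k) 1 G := IsManifold.of_le (n := ∞) (by simp)
  set x := extChartAt (𝓡 k) (1 : G) 1 with hx
  have hm : ContDiffAt ℝ ∞ (chartMul k G) (x, x) :=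
    (contDiffAt_chartMul (1 : G) (mem_extChartAt_source 1)).1
  have hd : DifferentiableAt ℝ (fderiv ℝ (chartMul k G)) (x, x) :=
    (hm.fderiv_right (m := 1) (by norm_cast)).differentiableAt (by simp)
  have hV : ∀ w : LieAlg k, VectorField.mpullbackWithin 𝓘(ℝ, LieAlg k) (𝓡 k)
      (extChartAt (𝓡 k) (1 : G)).symm (mulInvariantVectorField (I := 𝓡 k) (G := G) w)
      (Set.range (𝓡 k)) =ᶠ[nhds x] fun h => fderiv ℝ (chartMul k G) (h, x) (0, w) := by
    intro w
    filter_upwards [(isOpen_extChartAt_target (I := 𝓡 k) (1 : G)).mem_nhds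
      (mem_extChartAt_target (1 : G))] with h hh
    exact mpullbackWithin_mulInvariantVectorField w h hh
  have hD : ∀ v w : LieAlg k, fderiv ℝ (fun h => fderiv ℝ (chartMul k G) (h, x) (0, w)) x v =
      fderiv ℝ (fderiv ℝ (chartMul k G)) (x, x) (v, 0) (0, w) := by
    intro v w
    have h1 := (hd.hasFDerivAt.comp x (f := fun h : LieAlg k => (h, x)) (hasFDerivAt_prodMk_left x x)).clm_apply
      (hasFDerivAt_const ((0, w) : LieAlg k × LieAlg k) x)
    have h2 := h1.fderiv
    simp only [Function.comp_def] at h2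
    rw [h2]
    simp
  have e : lieBr G v w = VectorField.mlieBracketWithin (𝓡 k)
    (mulInvariantVectorField (I := 𝓡 k) (G := G) v) (mulInvariantVectorField w) Set.univ 1 := rfl
  rw [e, VectorField.mlieBracketWithin_apply, mfderiv_extChartAt_self, Set.preimage_univ,
    ModelWithCorners.range_eq_univ, Set.univ_inter]
  rw [ModelWithCorners.range_eq_univ] at hV
  have hinv : ∀ z : LieAlg k, (ContinuousLinearMap.id ℝ (LieAlg k)).inverse z = z := by simp
  refine (hinv _).trans ?_
  have key : ∀ A B : LieAlg k → LieAlg k,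
      A =ᶠ[nhds x] (fun h => fderiv ℝ (chartMul k G) (h, x) (0, v)) →
      B =ᶠ[nhds x] (fun h => fderiv ℝ (chartMul k G) (h, x) (0, w)) →
      fderivWithin ℝ B Set.univ x (A x) - fderivWithin ℝ A Set.univ x (B x) =
        fderiv ℝ (fderiv ℝ (chartMul k G)) (x, x) (v, 0) (0, w) -
          fderiv ℝ (fderiv ℝ (chartMul k G)) (x, x) (w, 0) (0, v) := by
    intro A B hA hB
    rw [fderivWithin_univ, fderivWithin_univ, hA.fderiv_eq, hB.fderiv_eq, hA.self_of_nhds,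
      hB.self_of_nhds, hD, hD]
    change fderiv ℝ (fderiv ℝ (chartMul k G)) (x, x) (fderiv ℝ (chartMul k G) (x, x) (0, v), 0)
      (0, w) - fderiv ℝ (fderiv ℝ (chartMul k G)) (x, x)
        (fderiv ℝ (chartMul k G) (x, x) (0, w), 0) (0, v) = _
    rw [(fderiv_chartMul_one (G := G) w).1, (fderiv_chartMul_one (G := G) v).1]
  exact key _ _ (hV v) (hV w)

/-- The value at `g` of the right-invariant vector field of `x` is that of the left-invariant vector
field of `Ad(g⁻¹) x`. -/
theorem mfderiv_mul_right_eq_Ad (g : G) (x : LieAlg k) :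
    (mfderiv (𝓡 k) (𝓡 k) (fun h : G => h * g) 1 x : LieAlg k) =
      mulInvariantVectorField (I := 𝓡 k) (G := G) (Ad g⁻¹ x) g := by
  have h1 : MDifferentiableAt (𝓡 k) (𝓡 k) (fun h : G => g⁻¹ * h * g⁻¹⁻¹) 1 :=
    (contMDiff_mul_right.comp (contMDiff_mul_left (a := g⁻¹))).contMDiffAt.mdifferentiableAt
      (n := ∞) (by simp)
  have h2 : MDifferentiableAt (𝓡 k) (𝓡 k) (fun h : G => g * h) 1 :=
    (contMDiff_mul_left.contMDiffAt).mdifferentiableAt (n := ∞) (by simp)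
  have e := mfderiv_comp_of_eq (x := (1 : G)) h2 h1 (by simp)
  have e' : (fun h : G => h * g) = (fun h : G => g * h) ∘ (fun h : G => g⁻¹ * h * g⁻¹⁻¹) := by
    funext h
    simp [mul_assoc]
  rw [e', e]
  have e3 : ∀ z : G, z = 1 → ∀ w : LieAlg k, (mfderiv (𝓡 k) (𝓡 k) (fun h : G => g * h) z w : LieAlg k) =
      mfderiv (𝓡 k) (𝓡 k) (fun h : G => g * h) 1 w := by rintro _ rfl w; rfl
  exact e3 _ (by simp) _

theorem Ad_one (x : LieAlg k) : Ad (1 : G) x = x := by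
  have hid : ∀ f : G → G, f = id → (mfderiv (𝓡 k) (𝓡 k) f 1 x : LieAlg k) = x := by
    rintro _ rfl
    rw [mfderiv_id]
    rfl
  exact hid _ (funext fun h => by simp)

/-- The derivative of `g ↦ Ad(g⁻¹) x` at `1` is `η ↦ -[η, x]`. -/
theorem fderiv_Ad_inv (x η : LieAlg k) :
    DifferentiableAt ℝ (fun h : LieAlg k => Ad ((extChartAt (𝓡 k) (1 : G)).symm h)⁻¹ x)
      (extChartAt (𝓡 k) (1 : G) 1) ∧
    fderiv ℝ (fun h : LieAlg k => Ad ((extChartAt (𝓡 k) (1 : G)).symm h)⁻¹ x)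
      (extChartAt (𝓡 k) (1 : G) 1) η = -lieBr G η x := by
  set c := extChartAt (𝓡 k) (1 : G) with hc
  set x₀ := c 1 with hx
  set F := fun h : LieAlg k => Ad (c.symm h)⁻¹ x with hF
  have hm : ContDiffAt ℝ ∞ (chartMul k G) (x₀, x₀) :=
    (contDiffAt_chartMul (1 : G) (mem_extChartAt_source 1)).1
  have hd : DifferentiableAt ℝ (fderiv ℝ (chartMul k G)) (x₀, x₀) :=
    (hm.fderiv_right (m := 1) (by norm_cast)).differentiableAt (by simp)
  -- `mfderiv_mul_right_eq_Ad` in the chart: a relation between the partial differentials of the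
  -- multiplication, whose derivative at `1` involves the derivative of `F`
  have hrel : (fun h => fderiv ℝ (chartMul k G) (x₀, h) (x, 0)) =ᶠ[nhds x₀]
      fun h => ((fderiv ℝ (chartMul k G) (h, x₀)).comp (.inr ℝ (LieAlg k) (LieAlg k))) (F h) := by
    filter_upwards [(isOpen_extChartAt_target (I := 𝓡 k) (1 : G)).mem_nhds
      (mem_extChartAt_target (1 : G))] with h hh
    have e := fun w => fderiv_chartMul (c.symm h) (c.map_target hh) w
    rw [c.right_inv hh] at e
    refine (e x).2.trans ?_
    refine Eq.trans ?_ ((e (F h)).1).symm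
    rw [mfderiv_mul_right_eq_Ad]
  have hL : HasFDerivAt
      (fun h => (fderiv ℝ (chartMul k G) (h, x₀)).comp (.inr ℝ (LieAlg k) (LieAlg k)))
      (((ContinuousLinearMap.compL ℝ (LieAlg k) (LieAlg k × LieAlg k) (LieAlg k)).flip
        (.inr ℝ (LieAlg k) (LieAlg k))).comp
        ((fderiv ℝ (fderiv ℝ (chartMul k G)) (x₀, x₀)).comp (.inl ℝ (LieAlg k) (LieAlg k)))) x₀ :=
    ((ContinuousLinearMap.compL ℝ (LieAlg k) (LieAlg k × LieAlg k) (LieAlg k)).flip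
        (.inr ℝ (LieAlg k) (LieAlg k))).hasFDerivAt.comp x₀
      (hd.hasFDerivAt.comp x₀ (f := fun h : LieAlg k => (h, x₀)) (hasFDerivAt_prodMk_left x₀ x₀))
  have hR : HasFDerivAt (fun h => fderiv ℝ (chartMul k G) (x₀, h) (x, 0))
      ((ContinuousLinearMap.apply ℝ (LieAlg k) ((x, 0) : LieAlg k × LieAlg k)).comp
        ((fderiv ℝ (fderiv ℝ (chartMul k G)) (x₀, x₀)).comp (.inr ℝ (LieAlg k) (LieAlg k)))) x₀ :=
    (ContinuousLinearMap.apply ℝ (LieAlg k) ((x, 0) : LieAlg k × LieAlg k)).hasFDerivAt.comp x₀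
      (hd.hasFDerivAt.comp x₀ (f := fun h : LieAlg k => (x₀, h)) (hasFDerivAt_prodMk_right x₀ x₀))
  have hL0 : (fderiv ℝ (chartMul k G) (x₀, x₀)).comp (.inr ℝ (LieAlg k) (LieAlg k)) =
      (ContinuousLinearEquiv.refl ℝ (LieAlg k) : LieAlg k →L[ℝ] LieAlg k) := by
    ext1 w
    exact (fderiv_chartMul_one (G := G) w).1
  have hinv : DifferentiableAt ℝ (ContinuousLinearMap.inverse : (LieAlg k →L[ℝ] LieAlg k) → _)
      ((fderiv ℝ (chartMul k G) (x₀, x₀)).comp (.inr ℝ (LieAlg k) (LieAlg k))) := by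
    rw [hL0]
    exact (contDiffAt_map_inverse (n := 1) (ContinuousLinearEquiv.refl ℝ (LieAlg k))).differentiableAt
      (by simp)
  -- near `1`, the relation can be solved for `F`
  have hdF : DifferentiableAt ℝ F x₀ := by
    have h1 := (hinv.comp x₀ (f := fun h => (fderiv ℝ (chartMul k G) (h, x₀)).comp
      (.inr ℝ (LieAlg k) (LieAlg k))) hL.differentiableAt).clm_apply hR.differentiableAt
    refine h1.congr_of_eventuallyEq ?_
    have hunit : ∀ᶠ h in nhds x₀, ((fderiv ℝ (chartMul k G) (h, x₀)).comp
        (.inr ℝ (LieAlg k) (LieAlg k))) ∈ Set.range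
          ((↑) : (LieAlg k ≃L[ℝ] LieAlg k) → LieAlg k →L[ℝ] LieAlg k) := by
      refine hL.continuousAt.eventually ?_
      change ∀ᶠ T in nhds ((fderiv ℝ (chartMul k G) (x₀, x₀)).comp
        (.inr ℝ (LieAlg k) (LieAlg k))), _
      rw [hL0]
      exact ContinuousLinearEquiv.nhds _
    filter_upwards [hrel, hunit] with h hh hu
    obtain ⟨e, he⟩ := hu
    simp only [Function.comp_apply]
    rw [hh, ← he, ContinuousLinearMap.inverse_equiv]
    simp
  refine ⟨hdF, ?_⟩
  have hF0 : F x₀ = x := by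
    have h1 : c.symm x₀ = 1 := extChartAt_to_inv (I := 𝓡 k) (1 : G)
    simp only [hF, h1, inv_one, Ad_one]
  have hder := Filter.EventuallyEq.fderiv_eq (𝕜 := ℝ) hrel
  rw [hR.fderiv, (hL.clm_apply hdF.hasFDerivAt).fderiv, hF0, hL0] at hder
  have := DFunLike.congr_fun hder η
  simp at this
  have hsymm := (hm.isSymmSndFDerivAt (by simpa using two_le_infty)) (0, η) (x, 0)
  rw [hsymm] at this
  rw [lieBr_eq_fderiv_chartMul, neg_sub]
  exact (sub_eq_of_eq_add this).symm

theorem lieBr_skew (x y : LieAlg k) : lieBr G x y = -lieBr G y x := by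
  rw [lieBr_eq_fderiv_chartMul, lieBr_eq_fderiv_chartMul, neg_sub]

theorem lieBr_add_left (x x' y : LieAlg k) : lieBr G (x + x') y = lieBr G x y + lieBr G x' y := by
  have h1 : ((x + x', 0) : LieAlg k × LieAlg k) = (x, 0) + (x', 0) := by simp
  have h2 : ((0, x + x') : LieAlg k × LieAlg k) = (0, x) + (0, x') := by simp
  simp only [lieBr_eq_fderiv_chartMul, h1, h2, map_add, add_apply]
  abel

theorem lieBr_smul_left (r : ℝ) (x y : LieAlg k) : lieBr G (r • x) y = r • lieBr G x y := by
  have h1 : ((r • x, 0) : LieAlg k × LieAlg k) = r • (x, 0) := by simp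
  have h2 : ((0, r • x) : LieAlg k × LieAlg k) = r • (0, x) := by simp
  simp only [lieBr_eq_fderiv_chartMul, h1, h2, map_smul, smul_apply, smul_sub]

theorem lieBr_smul_right (r : ℝ) (x y : LieAlg k) : lieBr G x (r • y) = r • lieBr G x y := by
  rw [lieBr_skew, lieBr_smul_left, ← smul_neg, ← lieBr_skew]

end Adjoint

/-! ### Horizontality of the curvature -/

section VerticalCurvature

variable {k : ℕ} {G : Type*} [TopologicalSpace G] [ChartedSpace (EuclideanSpace ℝ (Fin k)) G]
  [Group G] [LieGroup (𝓡 k) ∞ G]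
  {E H : Type*} [NormedAddCommGroup E] [NormedSpace ℝ E] [FiniteDimensional ℝ E]
  [TopologicalSpace H] {I : ModelWithCorners ℝ E H} [I.Boundaryless]
  {N : Type*} [TopologicalSpace N] [ChartedSpace H N] [IsManifold I ∞ N]

/-- Variant of `OneForm.IsSmooth.d_pullback` in which the base point is only propositionally equal to
`Ψ x`. -/
theorem OneForm.IsSmooth.d_pullback_of_eq {F E' : Type*} [NormedAddCommGroup F] [NormedSpace ℝ F]
    [NormedAddCommGroup E'] [NormedSpace ℝ E']
    {α : OneForm I N F} (hα : α.IsSmooth) {Ψ : E' → N} {x : E'}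
    (hΨ : ∀ᶠ y in nhds x, ContMDiffAt 𝓘(ℝ, E') I ∞ Ψ y) {z : N} (hz : Ψ x = z) (u v : E') :
    α.d z (mfderiv 𝓘(ℝ, E') I Ψ x u : E) (mfderiv 𝓘(ℝ, E') I Ψ x v : E) =
      fderiv ℝ (α.pullback Ψ) x u v - fderiv ℝ (α.pullback Ψ) x v u := by
  subst hz
  exact hα.d_pullback hΨ u v

/-- The curvature of a connection is horizontal: it vanishes on the vertical vectors. -/
theorem Connection.curvature_vertical {R : N → G → N} (A : Connection I k R)
    (hR : ContMDiff (I.prod (𝓡 k)) I ∞ (fun z : N × G => R z.1 z.2)) (hR1 : ∀ z, R z 1 = z)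
    (z : N) (ξ : LieAlg k) (V : E) :
    A.curvature z (mfderiv (𝓡 k) I (fun g => R z g) 1 ξ : E) V = 0 := by
  have : IsManifold (𝓡 k) ∞ G := ContMDiffMul.toIsManifold
  have : IsManifold (𝓡 k) 1 G := IsManifold.of_le (n := ∞) (by simp)
  have : IsManifold I 1 N := IsManifold.of_le (n := ∞) (by simp)
  set c := extChartAt (𝓡 k) (1 : G) with hc
  set e := extChartAt I z with he
  have hc1 : c.symm (c 1) = 1 := extChartAt_to_inv (I := 𝓡 k) (1 : G)
  have hez : e.symm (e z) = z := extChartAt_to_inv (I := I) z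
  have hpt : ∀ z z' : N, z = z' → ∀ w : E, A.form z w = A.form z' w := by rintro _ _ rfl w; rfl
  -- the action near `(1, z)`, in charts
  set Ψ : LieAlg k × E → N := fun x => R (e.symm x.2) (c.symm x.1) with hΨ
  have hU : IsOpen (c.target ×ˢ e.target) :=
    (isOpen_extChartAt_target (1 : G)).prod (isOpen_extChartAt_target z)
  have hxU : (c 1, e z) ∈ c.target ×ˢ e.target :=
    ⟨mem_extChartAt_target (1 : G), mem_extChartAt_target z⟩
  have hΨs : ContMDiffOn 𝓘(ℝ, LieAlg k × E) I ∞ Ψ (c.target ×ˢ e.target) := by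
    refine hR.comp_contMDiffOn (ContMDiffOn.prodMk ?_ ?_)
    · exact (contMDiffOn_extChartAt_symm (n := ∞) z).comp contDiff_snd.contMDiff.contMDiffOn
        fun x hx => hx.2
    · exact (contMDiffOn_extChartAt_symm (n := ∞) (1 : G)).comp contDiff_fst.contMDiff.contMDiffOn
        fun x hx => hx.1
  have hΨat : ∀ x ∈ c.target ×ˢ e.target, ContMDiffAt 𝓘(ℝ, LieAlg k × E) I ∞ Ψ x :=
    fun x hx => hΨs.contMDiffAt (hU.mem_nhds hx)
  have hΨx : Ψ (c 1, e z) = z := by simp only [hΨ, hc1, hez, hR1]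
  have hsymmE : ∀ y ∈ e.target, MDifferentiableAt 𝓘(ℝ, E) I e.symm y := fun y hy =>
    ((contMDiffOn_extChartAt_symm (n := ∞) z).contMDiffAt
      ((isOpen_extChartAt_target z).mem_nhds hy)).mdifferentiableAt (by simp)
  have hsymmG : MDifferentiableAt 𝓘(ℝ, LieAlg k) (𝓡 k) c.symm (c 1) :=
    ((contMDiffOn_extChartAt_symm (n := ∞) (1 : G)).contMDiffAt
      ((isOpen_extChartAt_target (1 : G)).mem_nhds hxU.1)).mdifferentiableAt (by simp)
  have hRg : ∀ g z', MDifferentiableAt I I (fun z' => R z' g) z' := fun g z' =>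
    (hR.comp (contMDiff_id.prodMk contMDiff_const)).contMDiffAt.mdifferentiableAt (by simp)
  have hRz : ∀ z' g, MDifferentiableAt (𝓡 k) I (fun g => R z' g) g := fun z' g =>
    (hR.comp (contMDiff_const.prodMk contMDiff_id)).contMDiffAt.mdifferentiableAt (by simp)
  have hsmooth : DifferentiableAt ℝ (A.form.pullback Ψ) (c 1, e z) :=
    ((A.smooth.contDiffOn_pullback hU hΨs).contDiffAt (hU.mem_nhds hxU)).differentiableAt (by simp)
  -- the two partial differentials of `Ψ`
  have hd2 : ∀ h ∈ c.target, ∀ v : E, (mfderiv 𝓘(ℝ, LieAlg k × E) I Ψ (h, e z) (0, v) : E) =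
      mfderiv I I (fun z' => R z' (c.symm h)) z v := by
    intro h hh v
    have h1 := mfderiv_comp_of_eq (x := e z) (g := Ψ) (f := fun y : E => ((h, y) : LieAlg k × E))
      ((hΨat (h, e z) ⟨hh, hxU.2⟩).mdifferentiableAt (by simp))
      (hasFDerivAt_prodMk_right h (e z)).differentiableAt.mdifferentiableAt rfl
    rw [mfderiv_eq_fderiv, (hasFDerivAt_prodMk_right h (e z)).fderiv] at h1
    have h2 := mfderiv_comp_of_eq (x := e z) (g := fun z' => R z' (c.symm h)) (f := e.symm)
      (hRg _ z) (hsymmE _ hxU.2) hez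
    have h3 : (mfderiv 𝓘(ℝ, E) I (fun y => R (e.symm y) (c.symm h)) (e z) v : E) =
      mfderiv 𝓘(ℝ, LieAlg k × E) I Ψ (h, e z) (0, v) := DFunLike.congr_fun h1 v
    rw [← h3]
    refine (DFunLike.congr_fun h2 v).trans ?_
    have h4 : ∀ z', z' = z → ∀ w : E, (mfderiv I I (fun z' => R z' (c.symm h)) z' w : E) =
      mfderiv I I (fun z' => R z' (c.symm h)) z w := by rintro _ rfl w; rfl
    refine (h4 _ hez _).trans ?_
    change (mfderiv I I (fun z' => R z' (c.symm h)) z (mfderiv 𝓘(ℝ, E) I e.symm (e z) v : E) : E) = _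
    rw [he, mfderiv_extChartAt_symm_self]
  have hd1 : ∀ y ∈ e.target, ∀ η : LieAlg k,
      (mfderiv 𝓘(ℝ, LieAlg k × E) I Ψ (c 1, y) (η, 0) : E) =
      mfderiv (𝓡 k) I (fun g => R (e.symm y) g) 1 η := by
    intro y hy η
    have h1 := mfderiv_comp_of_eq (x := c 1) (g := Ψ)
      (f := fun h : LieAlg k => ((h, y) : LieAlg k × E))
      ((hΨat (c 1, y) ⟨hxU.1, hy⟩).mdifferentiableAt (by simp))
      (hasFDerivAt_prodMk_left (c 1) y).differentiableAt.mdifferentiableAt rfl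
    rw [mfderiv_eq_fderiv, (hasFDerivAt_prodMk_left (c 1) y).fderiv] at h1
    have h2 := mfderiv_comp_of_eq (x := c 1) (g := fun g => R (e.symm y) g) (f := c.symm)
      (hRz _ 1) hsymmG hc1
    have h3 : (mfderiv 𝓘(ℝ, LieAlg k) I (fun h => R (e.symm y) (c.symm h)) (c 1) η : E) =
      mfderiv 𝓘(ℝ, LieAlg k × E) I Ψ (c 1, y) (η, 0) := DFunLike.congr_fun h1 η
    rw [← h3]
    refine (DFunLike.congr_fun h2 η).trans ?_
    have h4 : ∀ g, g = 1 → ∀ w : LieAlg k, (mfderiv (𝓡 k) I (fun g => R (e.symm y) g) g w : E) =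
      mfderiv (𝓡 k) I (fun g => R (e.symm y) g) 1 w := by rintro _ rfl w; rfl
    refine (h4 _ hc1 _).trans ?_
    change (mfderiv (𝓡 k) I (fun g => R (e.symm y) g) 1
      (mfderiv 𝓘(ℝ, LieAlg k) (𝓡 k) c.symm (c 1) η : LieAlg k) : E) = _
    rw [hc, mfderiv_extChartAt_symm_self]
  -- equivariance gives one derivative of the pull-back
  have hD1 : ∀ v : E, fderiv ℝ (A.form.pullback Ψ) (c 1, e z) (ξ, 0) (0, v) =
      -lieBr G ξ (A.form z v) := by
    intro v
    rw [← (fderiv_Ad_inv (G := G) (A.form z v) ξ).2]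
    have h1 := (hsmooth.hasFDerivAt.comp (c 1) (f := fun h : LieAlg k => (h, e z))
      (hasFDerivAt_prodMk_left (c 1) (e z))).clm_apply
        (hasFDerivAt_const ((0, v) : LieAlg k × E) (c 1))
    have h2 : (fun h : LieAlg k => A.form.pullback Ψ (h, e z) (0, v)) =ᶠ[nhds (c 1)]
        fun h => Ad (c.symm h)⁻¹ (A.form z v) := by
      filter_upwards [(isOpen_extChartAt_target (I := 𝓡 k) (1 : G)).mem_nhds hxU.1] with h hh
      refine Eq.trans ?_ (A.equivariant z (c.symm h) v)
      have h5 : Ψ (h, e z) = R z (c.symm h) := by simp only [hΨ, hez]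
      exact (hpt _ _ h5 _).trans (congrArg (A.form (R z (c.symm h))) (hd2 h hh v))
    rw [← h2.fderiv_eq]
    have h6 := h1.fderiv
    simp only [Function.comp_def] at h6
    rw [h6]
    simp
  -- the form is constant on fundamental vector fields, so that the other derivative vanishes
  have hD2 : ∀ v : E, fderiv ℝ (A.form.pullback Ψ) (c 1, e z) (0, v) (ξ, 0) = 0 := by
    intro v
    have h1 := (hsmooth.hasFDerivAt.comp (e z) (f := fun y : E => (c 1, y))
      (hasFDerivAt_prodMk_right (c 1) (e z))).clm_apply
        (hasFDerivAt_const ((ξ, 0) : LieAlg k × E) (e z))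
    have h2 : (fun y : E => A.form.pullback Ψ (c 1, y) (ξ, 0)) =ᶠ[nhds (e z)] fun _ => ξ := by
      filter_upwards [(isOpen_extChartAt_target (I := I) z).mem_nhds hxU.2] with y hy
      have h5 : Ψ (c 1, y) = R (e.symm y) 1 := by simp only [hΨ, hc1]
      exact ((hpt _ _ h5 _).trans (congrArg (A.form (R (e.symm y) 1)) (hd1 y hy ξ))).trans
        (A.fundamental _ _)
    have h6 := h1.fderiv
    simp only [Function.comp_def] at h6
    have h7 := h2.fderiv_eq (𝕜 := ℝ)
    rw [h6] at h7
    have h8 := DFunLike.congr_fun h7 v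
    simpa using h8
  have hξ : (mfderiv 𝓘(ℝ, LieAlg k × E) I Ψ (c 1, e z) (ξ, 0) : E) =
      mfderiv (𝓡 k) I (fun g => R z g) 1 ξ := by
    rw [hd1 _ hxU.2]
    have h4 : ∀ z', z' = z → ∀ w : LieAlg k, (mfderiv (𝓡 k) I (fun g => R z' g) 1 w : E) =
      mfderiv (𝓡 k) I (fun g => R z g) 1 w := by rintro _ rfl w; rfl
    exact h4 _ hez _
  have hV : (mfderiv 𝓘(ℝ, LieAlg k × E) I Ψ (c 1, e z) (0, V) : E) = V := by
    rw [hd2 _ hxU.1]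
    have h4 : ∀ f : N → N, f = id → (mfderiv I I f z V : E) = V := by
      rintro _ rfl; rw [mfderiv_id]; rfl
    refine h4 _ (funext fun z' => ?_)
    rw [hc1, hR1]; rfl
  have hd := A.smooth.d_pullback_of_eq
    (Filter.eventually_of_mem (hU.mem_nhds hxU) hΨat) hΨx (ξ, 0) (0, V)
  rw [hξ, hV, hD1, hD2, sub_zero] at hd
  have hfund : A.form z (mfderiv (𝓡 k) I (fun g => R z g) 1 ξ : E) = ξ :=
    (hpt _ _ (hR1 z).symm _).trans (A.fundamental z ξ)
  change A.form.d z _ _ + lieBr G (A.form z (mfderiv (𝓡 k) I (fun g => R z g) 1 ξ : E)) _ = 0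
  rw [hd, hfund, neg_add_cancel]

end VerticalCurvature

/-! ### Associated bundles as quotients -/

section Associated

variable {EB HB EG HG EP HP EM HM : Type*}
  [NormedAddCommGroup EB] [NormedSpace ℝ EB] [TopologicalSpace HB]
  [NormedAddCommGroup EG] [NormedSpace ℝ EG] [TopologicalSpace HG]
  [NormedAddCommGroup EP] [NormedSpace ℝ EP] [TopologicalSpace HP]
  [NormedAddCommGroup EM] [NormedSpace ℝ EM] [TopologicalSpace HM]
  {IB : ModelWithCorners ℝ EB HB} {IG : ModelWithCorners ℝ EG HG}
  {IP : ModelWithCorners ℝ EP HP} {IM : ModelWithCorners ℝ EM HM}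
  {B G P M : Type*}
  [TopologicalSpace B] [ChartedSpace HB B] [TopologicalSpace G] [ChartedSpace HG G] [Group G]
  [TopologicalSpace P] [ChartedSpace HP P] [TopologicalSpace M] [ChartedSpace HM M]

/-- A principal bundle has a smooth local section through each of its points. -/
theorem PrincipalBundle.exists_section (𝒬 : PrincipalBundle IB IG IP B G P) (p : P) :
    ∃ s : B → P, ContMDiffAt IB IP ∞ s (𝒬.proj p) ∧ s (𝒬.proj p) = p ∧
      ∀ᶠ b in nhds (𝒬.proj p), 𝒬.proj (s b) = b := by
  obtain ⟨e, hb, he⟩ := Assoc.exists_isTriv 𝒬 (𝒬.proj p)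
  have hp : p ∈ e.source := e.mem_source.2 hb
  refine ⟨fun b => e.toOpenPartialHomeomorph.symm (b, (e p).2), ?_, ?_, ?_⟩
  · refine ContMDiffAt.comp (I' := IB.prod IG) (x := 𝒬.proj p) (f := fun b => (b, (e p).2))
      (g := e.toOpenPartialHomeomorph.symm) ?_ (contMDiffAt_id.prodMk contMDiffAt_const)
    exact he.2.1.contMDiffAt (e.open_target.mem_nhds (e.mem_target.2 hb))
  · have : (𝒬.proj p, (e p).2) = e p := Prod.ext (e.coe_fst hp).symm rfl
    change e.toOpenPartialHomeomorph.symm (𝒬.proj p, (e p).2) = p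
    rw [this]
    exact e.toOpenPartialHomeomorph.left_inv hp
  · filter_upwards [e.open_baseSet.mem_nhds hb] with b hb'
    exact e.proj_symm_apply' hb'

theorem PrincipalBundle.surjective_mfderiv_proj (𝒬 : PrincipalBundle IB IG IP B G P) (p : P) :
    Function.Surjective (mfderiv IP IB 𝒬.proj p) := by
  obtain ⟨s, hs, hsp, hps⟩ := 𝒬.exists_section p
  intro v
  have h1 : MDifferentiableAt IP IB 𝒬.proj p := 𝒬.contMDiff_proj.contMDiffAt.mdifferentiableAt (by simp)
  have h2 := mfderiv_comp_of_eq (x := 𝒬.proj p) h1 (hs.mdifferentiableAt (by simp)) hsp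
  have h3 : mfderiv IB IB (𝒬.proj ∘ s) (𝒬.proj p) v = v := by
    have : 𝒬.proj ∘ s =ᶠ[nhds (𝒬.proj p)] id := hps
    rw [this.mfderiv_eq, mfderiv_id]
    rfl
  have h4 : ∀ q, q = p → ∀ w : EP, (mfderiv IP IB 𝒬.proj q w : EB) = mfderiv IP IB 𝒬.proj p w := by
    rintro _ rfl w; rfl
  refine ⟨(mfderiv IB IP s (𝒬.proj p) v : EP), ?_⟩
  rw [h2] at h3
  exact (h4 _ hsp _).symm.trans h3

namespace Assoc

variable (𝒬 : PrincipalBundle IB IG IP B G P) (ρ : SmoothLeftAction IG IM G M)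

theorem mk_surjective : Function.Surjective (mk 𝒬 ρ) := Quotient.mk_surjective

variable [IsManifold IB ∞ B] [IsManifold IM ∞ M]

theorem contMDiffOn_triv {e : Trivialization G 𝒬.proj} (he : 𝒬.IsTriv e) :
    ContMDiffOn (IB.prod IM) (IB.prod IM) ∞ (triv ρ e he) (triv ρ e he).source := by
  intro z hz
  set y := triv ρ e he z with hy
  set c := (triv ρ e he).trans (chartAt (ModelProd HB HM) y) with hc
  have hcat : c ∈ IsManifold.maximalAtlas (IB.prod IM) ∞ (Assoc 𝒬 ρ) :=
    IsManifold.subset_maximalAtlas ⟨e, he, y, rfl⟩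
  have hzc : z ∈ c.source := by
    rw [hc, OpenPartialHomeomorph.trans_source]
    exact ⟨hz, mem_chart_source (ModelProd HB HM) y⟩
  have h1 := (contMDiffOn_of_mem_maximalAtlas hcat).contMDiffAt (c.open_source.mem_nhds hzc)
  have h2 : ContMDiffAt (IB.prod IM) (IB.prod IM) ∞ (chartAt (ModelProd HB HM) y).symm (c z) :=
    (contMDiffOn_chart_symm (I := IB.prod IM) (x := y)).contMDiffAt
      ((chartAt (ModelProd HB HM) y).open_target.mem_nhds
        ((chartAt (ModelProd HB HM) y).map_source (mem_chart_source _ y)))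
  refine ((h2.comp z h1).congr_of_eventuallyEq ?_).contMDiffWithinAt
  filter_upwards [c.open_source.mem_nhds hzc] with w hw
  exact ((chartAt (ModelProd HB HM) y).left_inv hw.2).symm

theorem contMDiffOn_triv_symm {e : Trivialization G 𝒬.proj} (he : 𝒬.IsTriv e) :
    ContMDiffOn (IB.prod IM) (IB.prod IM) ∞ (triv ρ e he).symm (triv ρ e he).target := by
  intro y hy
  set c := (triv ρ e he).trans (chartAt (ModelProd HB HM) y) with hc
  have hcat : c ∈ IsManifold.maximalAtlas (IB.prod IM) ∞ (Assoc 𝒬 ρ) :=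
    IsManifold.subset_maximalAtlas ⟨e, he, y, rfl⟩
  have hyc : chartAt (ModelProd HB HM) y y ∈ c.target := by
    rw [hc, OpenPartialHomeomorph.trans_target]
    refine ⟨mem_chart_target _ y, ?_⟩
    change (chartAt (ModelProd HB HM) y).symm (chartAt (ModelProd HB HM) y y) ∈
      (triv ρ e he).target
    rwa [(chartAt (ModelProd HB HM) y).left_inv (mem_chart_source _ y)]
  have h1 := (contMDiffOn_symm_of_mem_maximalAtlas hcat).contMDiffAt (c.open_target.mem_nhds hyc)
  have h2 : ContMDiffAt (IB.prod IM) (IB.prod IM) ∞ (chartAt (ModelProd HB HM) y) y :=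
    (contMDiffOn_chart (I := IB.prod IM) (x := y)).contMDiffAt
      ((chartAt (ModelProd HB HM) y).open_source.mem_nhds (mem_chart_source _ y))
  refine ((h1.comp y h2).congr_of_eventuallyEq ?_).contMDiffWithinAt
  filter_upwards [(chartAt (ModelProd HB HM) y).open_source.mem_nhds (mem_chart_source _ y)] with w hw
  change _ = (triv ρ e he).symm ((chartAt (ModelProd HB HM) y).symm (chartAt (ModelProd HB HM) y w))
  rw [(chartAt (ModelProd HB HM) y).left_inv hw]

theorem contMDiff_mk : ContMDiff (IP.prod IM) (IB.prod IM) ∞ (mk 𝒬 ρ) := by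
  rintro ⟨p, m⟩
  obtain ⟨e, hb, he⟩ := exists_isTriv 𝒬 (𝒬.proj p)
  have hp : p ∈ e.source := e.mem_source.2 hb
  have hsrc : mk 𝒬 ρ (p, m) ∈ (triv ρ e he).source := hb
  have h1 : ContMDiffAt (IB.prod IM) (IB.prod IM) ∞ (triv ρ e he).symm
      (𝒬.proj p, ρ.smul (e p).2 m) := by
    refine (contMDiffOn_triv_symm 𝒬 ρ he).contMDiffAt ((triv ρ e he).open_target.mem_nhds ?_)
    rw [← triv_mk ρ he (z := (p, m)) hp]
    exact (triv ρ e he).map_source hsrc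
  have he' : ContMDiffAt (IP.prod IM) (IB.prod IG) ∞ (fun z : P × M => e z.1) (p, m) :=
    ContMDiffAt.comp (p, m) (he.1.contMDiffAt (e.open_source.mem_nhds hp)) contMDiffAt_fst
  have h2 : ContMDiffAt (IP.prod IM) (IB.prod IM) ∞
      (fun z : P × M => (𝒬.proj z.1, ρ.smul (e z.1).2 z.2)) (p, m) := by
    refine ContMDiffAt.prodMk (𝒬.contMDiff_proj.contMDiffAt.comp _ contMDiffAt_fst) ?_
    exact ρ.contMDiff_smul.contMDiffAt.comp (p, m)
      ((contMDiffAt_snd.comp _ he').prodMk contMDiffAt_snd)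
  refine (h1.comp (p, m) h2).congr_of_eventuallyEq ?_
  filter_upwards [(e.open_source.preimage continuous_fst).mem_nhds hp] with z hz
  change _ = (triv ρ e he).symm (𝒬.proj z.1, ρ.smul (e z.1).2 z.2)
  rw [← triv_mk ρ he hz]
  exact ((triv ρ e he).left_inv (e.mem_source.1 hz)).symm

/-- The quotient map of an associated bundle has a smooth local section through each point. -/
theorem exists_section_mk (p : P) (m : M) :
    ∃ s : Assoc 𝒬 ρ → P × M, ContMDiffAt (IB.prod IM) (IP.prod IM) ∞ s (mk 𝒬 ρ (p, m)) ∧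
      s (mk 𝒬 ρ (p, m)) = (p, m) ∧ ∀ᶠ z in nhds (mk 𝒬 ρ (p, m)), mk 𝒬 ρ (s z) = z := by
  obtain ⟨e, hb, he⟩ := exists_isTriv 𝒬 (𝒬.proj p)
  have hp : p ∈ e.source := e.mem_source.2 hb
  have hsrc : mk 𝒬 ρ (p, m) ∈ (triv ρ e he).source := hb
  set g := (e p).2 with hg
  have hmk : triv ρ e he (mk 𝒬 ρ (p, m)) = (𝒬.proj p, ρ.smul g m) := triv_mk ρ he hp
  refine ⟨fun z => (e.toOpenPartialHomeomorph.symm ((triv ρ e he z).1, g),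
    ρ.smul g⁻¹ (triv ρ e he z).2), ?_, ?_, ?_⟩
  · have h1 : ContMDiffAt (IB.prod IM) (IB.prod IM) ∞ (triv ρ e he) (mk 𝒬 ρ (p, m)) :=
      (contMDiffOn_triv 𝒬 ρ he).contMDiffAt ((triv ρ e he).open_source.mem_nhds hsrc)
    refine ContMDiffAt.prodMk ?_ ?_
    · refine ContMDiffAt.comp (I' := IB.prod IG) (g := e.toOpenPartialHomeomorph.symm)
        (f := fun z => ((triv ρ e he z).1, g)) _ ?_
        ((contMDiffAt_fst.comp _ h1).prodMk contMDiffAt_const)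
      refine he.2.1.contMDiffAt (e.open_target.mem_nhds (e.mem_target.2 ?_))
      rw [hmk]
      exact hb
    · exact ρ.contMDiff_smul.contMDiffAt.comp _ (contMDiffAt_const.prodMk (contMDiffAt_snd.comp _ h1))
  · have : (𝒬.proj p, g) = e p := Prod.ext (e.coe_fst hp).symm rfl
    simp only [hmk, this]
    refine Prod.ext (e.toOpenPartialHomeomorph.left_inv hp) ?_
    change ρ.smul g⁻¹ (ρ.smul g m) = m
    rw [← ρ.mul_smul, inv_mul_cancel, ρ.one_smul]
  · filter_upwards [(triv ρ e he).open_source.mem_nhds hsrc] with z hz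
    have hb' : (triv ρ e he z).1 ∈ e.baseSet := ((triv ρ e he).map_source hz).1
    have ht : ((triv ρ e he z).1, g) ∈ e.target := e.mem_target.2 hb'
    have hs : e.toOpenPartialHomeomorph.symm ((triv ρ e he z).1, g) ∈ e.source :=
      e.toOpenPartialHomeomorph.map_target ht
    refine (triv ρ e he).injOn (e.mem_source.1 hs) hz ?_
    refine (triv_mk ρ he hs).trans (Prod.ext (e.proj_symm_apply' hb') ?_)
    change ρ.smul (e (e.toOpenPartialHomeomorph.symm ((triv ρ e he z).1, g))).2
      (ρ.smul g⁻¹ (triv ρ e he z).2) = _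
    rw [e.apply_symm_apply ht, ← ρ.mul_smul, mul_inv_cancel, ρ.one_smul]

theorem surjective_mfderiv_mk (y : P × M) :
    Function.Surjective (mfderiv (IP.prod IM) (IB.prod IM) (mk 𝒬 ρ) y) := by
  obtain ⟨p, m⟩ := y
  obtain ⟨s, hs, hsp, hps⟩ := exists_section_mk 𝒬 ρ p m
  intro v
  have h1 : MDifferentiableAt (IP.prod IM) (IB.prod IM) (mk 𝒬 ρ) (p, m) :=
    (contMDiff_mk 𝒬 ρ).contMDiffAt.mdifferentiableAt (by simp)
  have h2 := mfderiv_comp_of_eq (x := mk 𝒬 ρ (p, m)) h1 (hs.mdifferentiableAt (by simp)) hsp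
  have h3 : mfderiv (IB.prod IM) (IB.prod IM) (mk 𝒬 ρ ∘ s) (mk 𝒬 ρ (p, m)) v = v := by
    have : mk 𝒬 ρ ∘ s =ᶠ[nhds (mk 𝒬 ρ (p, m))] id := hps
    rw [this.mfderiv_eq, mfderiv_id]
    rfl
  have h4 : ∀ q, q = (p, m) → ∀ w : EP × EM,
      (mfderiv (IP.prod IM) (IB.prod IM) (mk 𝒬 ρ) q w : EB × EM) =
        mfderiv (IP.prod IM) (IB.prod IM) (mk 𝒬 ρ) (p, m) w := by
    rintro _ rfl w; rfl
  refine ⟨(mfderiv (IB.prod IM) (IP.prod IM) s (mk 𝒬 ρ (p, m)) v : EP × EM), ?_⟩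
  rw [h2] at h3
  exact (h4 _ hsp _).symm.trans h3

variable {𝒬 ρ}

/-- A map out of an associated bundle is smooth if it is smooth on `P × M`. -/
theorem contMDiff_of_comp_mk {EN HN : Type*} [NormedAddCommGroup EN] [NormedSpace ℝ EN]
    [TopologicalSpace HN] {IN : ModelWithCorners ℝ EN HN} {N : Type*} [TopologicalSpace N]
    [ChartedSpace HN N] {f : Assoc 𝒬 ρ → N}
    (hf : ContMDiff (IP.prod IM) IN ∞ (fun z => f (mk 𝒬 ρ z))) : ContMDiff (IB.prod IM) IN ∞ f := by
  intro z
  obtain ⟨⟨p, m⟩, rfl⟩ := mk_surjective 𝒬 ρ z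
  obtain ⟨s, hs, -, hps⟩ := exists_section_mk 𝒬 ρ p m
  refine (hf.contMDiffAt.comp _ hs).congr_of_eventuallyEq ?_
  filter_upwards [hps] with w hw
  simp only [Function.comp, hw]

/-- A map on `P ×_G M × N'` is smooth if it is smooth on `P × M × N'`. -/
theorem contMDiff_of_comp_mk_prod {EN HN : Type*} [NormedAddCommGroup EN] [NormedSpace ℝ EN]
    [TopologicalSpace HN] {IN : ModelWithCorners ℝ EN HN} {N : Type*} [TopologicalSpace N]
    [ChartedSpace HN N] {EN' HN' : Type*} [NormedAddCommGroup EN'] [NormedSpace ℝ EN']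
    [TopologicalSpace HN'] {IN' : ModelWithCorners ℝ EN' HN'} {N' : Type*} [TopologicalSpace N']
    [ChartedSpace HN' N'] {f : Assoc 𝒬 ρ × N' → N}
    (hf : ContMDiff ((IP.prod IM).prod IN') IN ∞ (fun z : (P × M) × N' => f (mk 𝒬 ρ z.1, z.2))) :
    ContMDiff ((IB.prod IM).prod IN') IN ∞ f := by
  rintro ⟨z, n⟩
  obtain ⟨⟨p, m⟩, rfl⟩ := mk_surjective 𝒬 ρ z
  obtain ⟨s, hs, -, hps⟩ := exists_section_mk 𝒬 ρ p m
  have h1 : ContMDiffAt ((IB.prod IM).prod IN') ((IP.prod IM).prod IN') ∞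
      (fun y : Assoc 𝒬 ρ × N' => (s y.1, y.2)) (mk 𝒬 ρ (p, m), n) :=
    (ContMDiffAt.comp (mk 𝒬 ρ (p, m), n) hs contMDiffAt_fst).prodMk contMDiffAt_snd
  refine (hf.contMDiffAt.comp _ h1).congr_of_eventuallyEq ?_
  have h2 : ∀ᶠ y in nhds (mk 𝒬 ρ (p, m), n), mk 𝒬 ρ (s y.1) = y.1 :=
    (continuous_fst.tendsto (mk 𝒬 ρ (p, m), n)).eventually hps
  filter_upwards [h2] with w hw
  simp only [Function.comp, hw]

end Assoc
end Associated

/-! ### Differentials as linear maps of the model spaces -/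

section Dmap

variable {E H E' H' E'' H'' : Type*} [NormedAddCommGroup E] [NormedSpace ℝ E] [TopologicalSpace H]
  [NormedAddCommGroup E'] [NormedSpace ℝ E'] [TopologicalSpace H']
  [NormedAddCommGroup E''] [NormedSpace ℝ E''] [TopologicalSpace H'']
  (I : ModelWithCorners ℝ E H) (I' : ModelWithCorners ℝ E' H') (I'' : ModelWithCorners ℝ E'' H'')
  {M M' M'' : Type*} [TopologicalSpace M] [ChartedSpace H M] [TopologicalSpace M']
  [ChartedSpace H' M'] [TopologicalSpace M''] [ChartedSpace H'' M'']

/-- The differential of `f` at `x`, as a map between the model vector spaces (to which all tangent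
spaces are equal by definition); its type does not depend on `x`. -/
noncomputable def dmap (f : M → M') (x : M) : E →L[ℝ] E' := mfderiv I I' f x

variable {I I' I''}

theorem dmap_comp {g : M' → M''} {f : M → M'} {x : M} (hg : MDifferentiableAt I' I'' g (f x))
    (hf : MDifferentiableAt I I' f x) :
    dmap I I'' (fun y => g (f y)) x = (dmap I' I'' g (f x)).comp (dmap I I' f x) :=
  mfderiv_comp x hg hf

theorem dmap_comp_apply {g : M' → M''} {f : M → M'} {x : M}
    (hg : MDifferentiableAt I' I'' g (f x)) (hf : MDifferentiableAt I I' f x) (v : E) :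
    dmap I I'' (fun y => g (f y)) x v = dmap I' I'' g (f x) (dmap I I' f x v) := by
  rw [dmap_comp hg hf]; rfl

theorem dmap_id (x : M) : dmap I I (fun y : M => y) x = .id ℝ E := mfderiv_id

theorem dmap_const (x : M) (y : M') : dmap I I' (fun _ : M => y) x = 0 := mfderiv_const

theorem dmap_eq_fderiv {f : E → E'} {x : E} : dmap 𝓘(ℝ, E) 𝓘(ℝ, E') f x = fderiv ℝ f x :=
  mfderiv_eq_fderiv

theorem dmap_prodMk {f : M → M'} {g : M → M''} {x : M} (hf : MDifferentiableAt I I' f x)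
    (hg : MDifferentiableAt I I'' g x) :
    dmap I (I'.prod I'') (fun y => (f y, g y)) x = (dmap I I' f x).prod (dmap I I'' g x) :=
  mfderiv_prodMk hf hg

theorem dmap_prod_left {f : M × M' → M''} {x : M} {y : M'}
    (hf : MDifferentiableAt (I.prod I') I'' f (x, y)) (v : E) :
    dmap (I.prod I') I'' f (x, y) (v, 0) = dmap I I'' (fun x' => f (x', y)) x v := by
  rw [dmap_comp_apply (f := fun x' => (x', y)) hf
    (mdifferentiableAt_id.prodMk mdifferentiableAt_const),
    dmap_prodMk (f := fun x' => x') mdifferentiableAt_id mdifferentiableAt_const, dmap_id, dmap_const]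
  rfl

theorem dmap_prod_right {f : M × M' → M''} {x : M} {y : M'}
    (hf : MDifferentiableAt (I.prod I') I'' f (x, y)) (w : E') :
    dmap (I.prod I') I'' f (x, y) (0, w) = dmap I' I'' (fun y' => f (x, y')) y w := by
  rw [dmap_comp_apply (f := fun y' => (x, y')) hf
    (mdifferentiableAt_const.prodMk mdifferentiableAt_id),
    dmap_prodMk (g := fun x' => x') mdifferentiableAt_const mdifferentiableAt_id, dmap_id, dmap_const]
  rfl

/-- The derivative along the ray through `ξ` is the differential evaluated on `ξ`. -/
theorem dmap_smul {F : Type*} [NormedAddCommGroup F] [NormedSpace ℝ F] {f : F → M}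
    (hf : MDifferentiableAt 𝓘(ℝ, F) I f 0) (ξ : F) :
    dmap 𝓘(ℝ, ℝ) I (fun t : ℝ => f (t • ξ)) 0 1 = dmap 𝓘(ℝ, F) I f 0 ξ := by
  have h0 : MDifferentiableAt 𝓘(ℝ, F) I f ((0 : ℝ) • ξ) := by rwa [zero_smul]
  have h1 : HasFDerivAt (fun t : ℝ => t • ξ) (ContinuousLinearMap.toSpanSingleton ℝ ξ) 0 :=
    (ContinuousLinearMap.toSpanSingleton ℝ ξ).hasFDerivAt
  rw [dmap_comp_apply (f := fun t : ℝ => t • ξ) h0 h1.differentiableAt.mdifferentiableAt,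
    dmap_eq_fderiv, h1.fderiv, zero_smul]
  simp

/-- The value of a one-form as a linear map on the model vector space. -/
noncomputable def OneForm.val {F : Type*} [NormedAddCommGroup F] [NormedSpace ℝ F]
    (α : OneForm I M F) (x : M) : E →L[ℝ] F := α x

end Dmap

/-! ### Fundamental vector fields -/

section AssociatedTangent

variable {EB HB EG HG EP HP EM HM : Type*}
  [NormedAddCommGroup EB] [NormedSpace ℝ EB] [TopologicalSpace HB]
  [NormedAddCommGroup EG] [NormedSpace ℝ EG] [TopologicalSpace HG]
  [NormedAddCommGroup EP] [NormedSpace ℝ EP] [TopologicalSpace HP]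
  [NormedAddCommGroup EM] [NormedSpace ℝ EM] [TopologicalSpace HM]
  {IB : ModelWithCorners ℝ EB HB} {IG : ModelWithCorners ℝ EG HG}
  {IP : ModelWithCorners ℝ EP HP} {IM : ModelWithCorners ℝ EM HM}
  {B G P M : Type*}
  [TopologicalSpace B] [ChartedSpace HB B] [TopologicalSpace G] [ChartedSpace HG G] [Group G]
  [TopologicalSpace P] [ChartedSpace HP P] [TopologicalSpace M] [ChartedSpace HM M]
  (𝒬 : PrincipalBundle IB IG IP B G P) (ρ : SmoothLeftAction IG IM G M)

theorem PrincipalBundle.contMDiff_act_right (g : G) : ContMDiff IP IP ∞ (fun p => 𝒬.act p g) :=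
  𝒬.contMDiff_act.comp (contMDiff_id.prodMk contMDiff_const)

theorem PrincipalBundle.contMDiff_act_left (p : P) : ContMDiff IG IP ∞ (fun g => 𝒬.act p g) :=
  𝒬.contMDiff_act.comp (contMDiff_const.prodMk contMDiff_id)

theorem SmoothLeftAction.contMDiff_smul_left (g : G) : ContMDiff IM IM ∞ (fun m => ρ.smul g m) :=
  ρ.contMDiff_smul.comp (contMDiff_const.prodMk contMDiff_id)

theorem SmoothLeftAction.contMDiff_smul_right (m : M) : ContMDiff IG IM ∞ (fun g => ρ.smul g m) :=
  ρ.contMDiff_smul.comp (contMDiff_id.prodMk contMDiff_const)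

/-- The fundamental vector fields of the action on `P` and on `M` have the same image in the tangent
space of `P ×_G M`. -/
theorem Assoc.dmap_mk_fund [IsManifold IB ∞ B] [IsManifold IM ∞ M] (p : P) (m : M) {γ : ℝ → G}
    (hγ : MDifferentiableAt 𝓘(ℝ, ℝ) IG γ 0) (h1 : γ 0 = 1) :
    dmap (IP.prod IM) (IB.prod IM) (Assoc.mk 𝒬 ρ) (p, m)
        (dmap 𝓘(ℝ, ℝ) IP (fun t => 𝒬.act p (γ t)) 0 1, 0) =
      dmap (IP.prod IM) (IB.prod IM) (Assoc.mk 𝒬 ρ) (p, m)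
        (0, dmap 𝓘(ℝ, ℝ) IM (fun t => ρ.smul (γ t) m) 0 1) := by
  have hmk : ∀ z, MDifferentiableAt (IP.prod IM) (IB.prod IM) (Assoc.mk 𝒬 ρ) z := fun z =>
    (Assoc.contMDiff_mk 𝒬 ρ).contMDiffAt.mdifferentiableAt (by simp)
  have ha : MDifferentiableAt 𝓘(ℝ, ℝ) IP (fun t => 𝒬.act p (γ t)) 0 :=
    ((𝒬.contMDiff_act_left p).contMDiffAt.mdifferentiableAt (by simp)).comp 0 hγ
  have hb : MDifferentiableAt 𝓘(ℝ, ℝ) IM (fun t => ρ.smul (γ t) m) 0 :=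
    ((ρ.contMDiff_smul_right m).contMDiffAt.mdifferentiableAt (by simp)).comp 0 hγ
  have e1 := dmap_comp_apply (g := Assoc.mk 𝒬 ρ) (f := fun t => (𝒬.act p (γ t), m)) (hmk _)
    (ha.prodMk mdifferentiableAt_const) (1 : ℝ)
  have e2 := dmap_comp_apply (g := Assoc.mk 𝒬 ρ) (f := fun t => (p, ρ.smul (γ t) m)) (hmk _)
    (mdifferentiableAt_const.prodMk hb) (1 : ℝ)
  rw [dmap_prodMk ha mdifferentiableAt_const, dmap_const, h1, 𝒬.act_one] at e1
  rw [dmap_prodMk mdifferentiableAt_const hb, dmap_const, h1, ρ.one_smul] at e2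
  refine e1.symm.trans (Eq.trans ?_ e2)
  simp only [Assoc.mk_act]

/-- Vectors tangent to the orbits of the structure group are vertical. -/
theorem PrincipalBundle.dmap_proj_vertical (p : P) {F : Type*} [NormedAddCommGroup F]
    [NormedSpace ℝ F] {HF : Type*} [TopologicalSpace HF] {IF : ModelWithCorners ℝ F HF}
    {N : Type*} [TopologicalSpace N] [ChartedSpace HF N] {γ : N → G} {x : N}
    (hγ : MDifferentiableAt IF IG γ x) (h1 : γ x = 1) (v : F) :
    dmap IP IB 𝒬.proj p (dmap IF IP (fun t => 𝒬.act p (γ t)) x v) = 0 := by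
  have ha : MDifferentiableAt IF IP (fun t => 𝒬.act p (γ t)) x :=
    ((𝒬.contMDiff_act_left p).contMDiffAt.mdifferentiableAt (by simp)).comp x hγ
  have e1 := dmap_comp_apply (g := 𝒬.proj) (f := fun t => 𝒬.act p (γ t))
    (𝒬.contMDiff_proj.contMDiffAt.mdifferentiableAt (by simp)) ha v
  rw [h1, 𝒬.act_one] at e1
  rw [← e1]
  simp only [𝒬.proj_act, dmap_const]
  rfl

end AssociatedTangent

/-! ### The exponential map of `Sp(1)` -/

theorem contMDiff_expSp1 : ContMDiff 𝓘(ℝ, ℍ[ℝ]) (𝓡 3) ∞ expSp1 := by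
  have him : ContDiff ℝ ∞ (fun ξ : ℍ[ℝ] => ξ.im) := by
    have : (fun ξ : ℍ[ℝ] => ξ.im) = fun ξ => ξ - ((ξ.re : ℝ) : ℍ[ℝ]) := by
      funext ξ
      rw [eq_sub_iff_add_eq, add_comm, Quaternion.re_add_im]
    rw [this]
    have h2 : ContDiff ℝ ∞ (fun ξ : ℍ[ℝ] => algebraMap ℝ ℍ[ℝ] (inner ℝ 1 ξ)) :=
      (Algebra.linearMap ℝ ℍ[ℝ]).toContinuousLinearMap.contDiff.comp
        (contDiff_const.inner ℝ contDiff_id)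
    have h3 : (fun ξ : ℍ[ℝ] => ((ξ.re : ℝ) : ℍ[ℝ])) =
        fun ξ => algebraMap ℝ ℍ[ℝ] (inner ℝ 1 ξ) := by
      funext ξ
      simp [Quaternion.inner_def]
    exact contDiff_id.sub (h3 ▸ h2)
  have hexp : ContDiff ℝ ∞ (NormedSpace.exp : ℍ[ℝ] → ℍ[ℝ]) := by
    rw [contDiff_iff_contDiffAt]
    intro x
    exact (NormedSpace.exp_analytic (𝕂 := ℝ) x).contDiffAt
  have h : ContMDiff 𝓘(ℝ, ℍ[ℝ]) 𝓘(ℝ, ℍ[ℝ]) ∞ (fun ξ : ℍ[ℝ] => NormedSpace.exp ξ.im) :=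
    (hexp.comp him).contMDiff
  exact h.codRestrict_sphere (n := 3) fun ξ => (expSp1 ξ).2

theorem expSp1_zero : expSp1 0 = 1 := by
  apply Subtype.ext
  simp [expSp1]

theorem fderiv_coe_expSp1 (ξ : ℍ[ℝ]) :
    dmap 𝓘(ℝ, ℝ) 𝓘(ℝ, ℍ[ℝ]) (fun t : ℝ => ((expSp1 (t • ξ) : Sp1) : ℍ[ℝ])) 0 1 = ξ.im := by
  have h0 : HasFDerivAt (NormedSpace.exp : ℍ[ℝ] → ℍ[ℝ]) (1 : ℍ[ℝ] →L[ℝ] ℍ[ℝ]) 0 :=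
    hasFDerivAt_exp_zero
  have h1 : HasFDerivAt (fun t : ℝ => t • ξ.im) (ContinuousLinearMap.toSpanSingleton ℝ ξ.im) 0 :=
    (ContinuousLinearMap.toSpanSingleton ℝ ξ.im).hasFDerivAt
  have h2 : HasFDerivAt (fun t : ℝ => NormedSpace.exp (t • ξ.im))
      ((1 : ℍ[ℝ] →L[ℝ] ℍ[ℝ]).comp (ContinuousLinearMap.toSpanSingleton ℝ ξ.im)) 0 := by
    refine HasFDerivAt.comp (0 : ℝ) (g := (NormedSpace.exp : ℍ[ℝ] → ℍ[ℝ])) ?_ h1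
    rwa [zero_smul]
  rw [dmap_eq_fderiv]
  have : (fun t : ℝ => ((expSp1 (t • ξ) : Sp1) : ℍ[ℝ])) =
      fun t : ℝ => NormedSpace.exp (t • ξ.im) := by
    funext t
    simp [expSp1]
  rw [this, h2.fderiv]
  simp

/-! ### The coframe of the frame bundle -/

section FrameBundle

variable {X : Type*} [TopologicalSpace X] [ChartedSpace (EuclideanSpace ℝ (Fin 4)) X]
  [IsManifold (𝓡 4) ∞ X]
  {g : Metric4 X} {o : ∀ x : X, Orientation ℝ (TangentSpace (𝓡 4) x) (Fin 4)}
  {Q : Type*} [TopologicalSpace Q] [ChartedSpace (EuclideanSpace ℝ (Fin 10)) Q]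
  [IsManifold (𝓡 10) ∞ Q]
  {S : SpinStructure g o Q} (L : LeviCivita S)

/-- The one-parameter subgroup of `Spin(4)` generated by `(ξ, ζ)`. -/
noncomputable def expSpin4 (ξ ζ : ℍ[ℝ]) (t : ℝ) : Spin4 := (expSp1 (t • ξ), expSp1 (t • ζ))

theorem expSpin4_zero (ξ ζ : ℍ[ℝ]) : expSpin4 ξ ζ 0 = 1 := by
  simp [expSpin4, expSp1_zero]

theorem mdifferentiableAt_expSp1_smul (ξ : ℍ[ℝ]) :
    MDifferentiableAt 𝓘(ℝ, ℝ) (𝓡 3) (fun t : ℝ => expSp1 (t • ξ)) 0 :=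
  MDifferentiableAt.comp (0 : ℝ) (contMDiff_expSp1.contMDiffAt.mdifferentiableAt (by simp))
    ((ContinuousLinearMap.toSpanSingleton ℝ ξ).differentiableAt.mdifferentiableAt)

theorem mdifferentiableAt_expSpin4 (ξ ζ : ℍ[ℝ]) :
    MDifferentiableAt 𝓘(ℝ, ℝ) ISpin4 (expSpin4 ξ ζ) 0 :=
  (mdifferentiableAt_expSp1_smul ξ).prodMk (mdifferentiableAt_expSp1_smul ζ)

theorem SpinStructure.theta_eq_zero_iff (f : Q) (v : TangentSpace (𝓡 10) f) :
    S.theta f v = 0 ↔ mfderiv (𝓡 10) (𝓡 4) S.proj f v = 0 :=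
  (S.frame f).map_eq_zero_iff

theorem SpinStructure.theta_fund (f : Q) (ξ ζ : ℍ[ℝ]) : S.theta f (S.fund f ξ ζ) = 0 := by
  rw [SpinStructure.theta_eq_zero_iff]
  exact S.toPrincipalBundle.dmap_proj_vertical f (mdifferentiableAt_expSpin4 ξ ζ)
    (expSpin4_zero ξ ζ) (1 : ℝ)

theorem SpinStructure.theta_surjective (f : Q) : Function.Surjective (S.theta f) :=
  (S.frame f).surjective.comp (S.toPrincipalBundle.surjective_mfderiv_proj f)

namespace LeviCivita

theorem exists_coframe_eq (f : Q) (c ξ ζ : ℍ[ℝ]) (hξ : ξ.re = 0) (hζ : ζ.re = 0) :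
    ∃ v : TangentSpace (𝓡 10) f, S.theta f v = c ∧ L.φ f v = ξ ∧ L.ψ f v = ζ := by
  obtain ⟨v, hv⟩ := S.theta_surjective f c
  refine ⟨v + S.fund f (ξ - L.φ f v) (ζ - L.ψ f v), ?_, ?_, ?_⟩
  · rw [map_add, S.theta_fund, hv, add_zero]
  · rw [map_add, L.φ_fund]
    have : (ξ - L.φ f v).im = ξ - L.φ f v := by
      conv_rhs => rw [← Quaternion.re_add_im (ξ - L.φ f v)]
      simp [hξ, L.re_φ]
    rw [this]
    abel
  · rw [map_add, L.ψ_fund]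
    have : (ζ - L.ψ f v).im = ζ - L.ψ f v := by
      conv_rhs => rw [← Quaternion.re_add_im (ζ - L.ψ f v)]
      simp [hζ, L.re_ψ]
    rw [this]
    abel

/-- The forms `θ`, `φ`, `ψ` trivialize the tangent bundle of `Q`. -/
theorem coframe_injective (f : Q) {v v' : TangentSpace (𝓡 10) f} (h1 : S.theta f v = S.theta f v')
    (h2 : L.φ f v = L.φ f v') (h3 : L.ψ f v = L.ψ f v') : v = v' := by
  -- adding two real parameters for the real parts of `φ` and `ψ` makes the dimensions equal
  let T : (EuclideanSpace ℝ (Fin 10)) × ℝ × ℝ →ₗ[ℝ] ℍ[ℝ] × ℍ[ℝ] × ℍ[ℝ] :=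
    ((S.theta.val f).toLinearMap.comp (.fst ℝ _ _)).prod
      (((L.φ.val f).toLinearMap.comp (.fst ℝ _ _) +
          (Algebra.linearMap ℝ ℍ[ℝ]).comp ((LinearMap.fst ℝ ℝ ℝ).comp (.snd ℝ _ _))).prod
        ((L.ψ.val f).toLinearMap.comp (.fst ℝ _ _) +
          (Algebra.linearMap ℝ ℍ[ℝ]).comp ((LinearMap.snd ℝ ℝ ℝ).comp (.snd ℝ _ _))))
  have hsurj : Function.Surjective T := by
    rintro ⟨c, ξ, ζ⟩
    obtain ⟨v, e1, e2, e3⟩ := L.exists_coframe_eq f c ξ.im ζ.im (by simp) (by simp)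
    refine ⟨(v, ξ.re, ζ.re), Prod.ext e1 (Prod.ext ?_ ?_)⟩
    · change L.φ f v + ((ξ.re : ℝ) : ℍ[ℝ]) = ξ
      rw [e2, add_comm, Quaternion.re_add_im]
    · change L.ψ f v + ((ζ.re : ℝ) : ℍ[ℝ]) = ζ
      rw [e3, add_comm, Quaternion.re_add_im]
  have hrank : Module.finrank ℝ ((EuclideanSpace ℝ (Fin 10)) × ℝ × ℝ) =
      Module.finrank ℝ (ℍ[ℝ] × ℍ[ℝ] × ℍ[ℝ]) := by
    simp [Quaternion.finrank_eq_four]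
  have hinj : Function.Injective T :=
    (LinearMap.injective_iff_surjective_of_finrank_eq_finrank hrank).2 hsurj
  have : T (v, 0, 0) = T (v', 0, 0) := by
    refine Prod.ext h1 (Prod.ext ?_ ?_)
    · change L.φ f v + _ = L.φ f v' + _
      rw [h2]
      rfl
    · change L.ψ f v + _ = L.ψ f v' + _
      rw [h3]
      rfl
  exact congrArg Prod.fst (hinj this)

theorem lift_spec (f : Q) (c : ℍ[ℝ]) :
    S.theta f (L.lift f c) = c ∧ L.φ f (L.lift f c) = 0 ∧ L.ψ f (L.lift f c) = 0 := by
  obtain ⟨v, h1, h2, h3⟩ := L.exists_coframe_eq f c 0 0 (by simp) (by simp)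
  have h := Function.invFun_eq
    (f := fun v : TangentSpace (𝓡 10) f => (S.theta f v, L.φ f v, L.ψ f v)) (b := (c, 0, 0))
    ⟨v, by simp only [h1, h2, h3]⟩
  exact ⟨congrArg Prod.fst h, congrArg (fun z => z.2.1) h, congrArg (fun z => z.2.2) h⟩

theorem lift_add (f : Q) (c c' : ℍ[ℝ]) : L.lift f (c + c') = L.lift f c + L.lift f c' := by
  apply L.coframe_injective f <;> simp only [map_add, L.lift_spec, add_zero]

theorem lift_smul (f : Q) (r : ℝ) (c : ℍ[ℝ]) : L.lift f (r • c) = r • L.lift f c := by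
  apply L.coframe_injective f <;> simp only [map_smul, L.lift_spec, smul_zero]

theorem im_φ (f : Q) (v : TangentSpace (𝓡 10) f) : (L.φ f v).im = L.φ f v := by
  conv_rhs => rw [← Quaternion.re_add_im (L.φ f v)]
  simp [L.re_φ]

theorem im_ψ (f : Q) (v : TangentSpace (𝓡 10) f) : (L.ψ f v).im = L.ψ f v := by
  conv_rhs => rw [← Quaternion.re_add_im (L.ψ f v)]
  simp [L.re_ψ]

/-- Every tangent vector is the sum of a horizontal lift and a fundamental vector. -/
theorem eq_lift_add_fund (f : Q) (v : TangentSpace (𝓡 10) f) :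
    v = L.lift f (S.theta f v) + S.fund f (L.φ f v) (L.ψ f v) := by
  apply L.coframe_injective f
  · rw [map_add, (L.lift_spec f _).1, S.theta_fund, add_zero]
  · rw [map_add, (L.lift_spec f _).2.1, L.φ_fund, L.im_φ, zero_add]
  · rw [map_add, (L.lift_spec f _).2.2, L.ψ_fund, L.im_ψ, zero_add]

end LeviCivita

end FrameBundle

/-! ### Horizontal lifts and Killing fields on the bundle over `ℝ⁴` -/

section LiftedBundleGeometry

variable {k : ℕ} {G : Type*} [TopologicalSpace G] [ChartedSpace (EuclideanSpace ℝ (Fin k)) G]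
  [Group G]
  {P : Type*} [TopologicalSpace P] [ChartedSpace (EuclideanSpace ℝ (Fin (4 + k))) P]
  [IsManifold (𝓡 (4 + k)) ∞ P] {PB : LiftedBundle k G P}

namespace LiftedBundle

theorem mfderiv_proj_fundamental (p : P) (ξ : LieAlg k) :
    dmap (𝓡 (4 + k)) 𝓘(ℝ, ℍ[ℝ]) PB.proj p (dmap (𝓡 k) (𝓡 (4 + k)) (fun g => PB.act p g) 1 ξ) = 0 :=
  PB.toPrincipalBundle.dmap_proj_vertical p (γ := fun g => g) mdifferentiableAt_id rfl ξ

theorem form_fundamental (a : PB.Conn) (p : P) (ξ : LieAlg k) :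
    a.form.val p (dmap (𝓡 k) (𝓡 (4 + k)) (fun g => PB.act p g) 1 ξ) = ξ := by
  have h : a.form.val (PB.act p 1) (dmap (𝓡 k) (𝓡 (4 + k)) (fun g => PB.act p g) 1 ξ) = ξ :=
    a.fundamental p ξ
  rwa [PB.act_one] at h

theorem exists_eq (a : PB.Conn) (p : P) (e : ℍ[ℝ]) (ξ : LieAlg k) :
    ∃ w : EuclideanSpace ℝ (Fin (4 + k)),
      dmap (𝓡 (4 + k)) 𝓘(ℝ, ℍ[ℝ]) PB.proj p w = e ∧ a.form.val p w = ξ := by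
  obtain ⟨w, hw⟩ : ∃ w : EuclideanSpace ℝ (Fin (4 + k)),
      dmap (𝓡 (4 + k)) 𝓘(ℝ, ℍ[ℝ]) PB.proj p w = e :=
    PB.toPrincipalBundle.surjective_mfderiv_proj p e
  refine ⟨w + dmap (𝓡 k) (𝓡 (4 + k)) (fun g => PB.act p g) 1 (ξ - a.form.val p w), ?_, ?_⟩
  · rw [map_add, mfderiv_proj_fundamental, hw, add_zero]
  · rw [map_add, form_fundamental, add_sub_cancel]

/-- The differential of the projection and the connection form trivialize the tangent bundle of
`P`. -/
theorem coframe_injective (a : PB.Conn) (p : P) {w w' : EuclideanSpace ℝ (Fin (4 + k))}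
    (h1 : dmap (𝓡 (4 + k)) 𝓘(ℝ, ℍ[ℝ]) PB.proj p w = dmap (𝓡 (4 + k)) 𝓘(ℝ, ℍ[ℝ]) PB.proj p w')
    (h2 : a.form.val p w = a.form.val p w') : w = w' := by
  let T : EuclideanSpace ℝ (Fin (4 + k)) →ₗ[ℝ] ℍ[ℝ] × LieAlg k :=
    ((dmap (𝓡 (4 + k)) 𝓘(ℝ, ℍ[ℝ]) PB.proj p).prod (a.form.val p)).toLinearMap
  have hsurj : Function.Surjective T := by
    rintro ⟨e, ξ⟩
    obtain ⟨w, e1, e2⟩ := exists_eq a p e ξ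
    exact ⟨w, Prod.ext e1 e2⟩
  have hrank : Module.finrank ℝ (EuclideanSpace ℝ (Fin (4 + k))) =
      Module.finrank ℝ (ℍ[ℝ] × LieAlg k) := by
    simp [Quaternion.finrank_eq_four]
  exact (LinearMap.injective_iff_surjective_of_finrank_eq_finrank hrank).2 hsurj (Prod.ext h1 h2)

theorem hlift_spec (a : PB.Conn) (p : P) (e : ℍ[ℝ]) :
    dmap (𝓡 (4 + k)) 𝓘(ℝ, ℍ[ℝ]) PB.proj p (hlift a p e) = e ∧ a.form.val p (hlift a p e) = 0 := by
  obtain ⟨w, h1, h2⟩ := exists_eq a p e 0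
  have h := Function.invFun_eq (f := fun w : TangentSpace (𝓡 (4 + k)) p =>
    ((mfderiv (𝓡 (4 + k)) 𝓘(ℝ, ℍ[ℝ]) PB.proj p w : ℍ[ℝ]), a.form p w)) (b := (e, 0))
    ⟨w, Prod.ext h1 h2⟩
  exact ⟨congrArg Prod.fst h, congrArg Prod.snd h⟩

theorem hlift_add (a : PB.Conn) (p : P) (e e' : ℍ[ℝ]) :
    hlift a p (e + e') = hlift a p e + hlift a p e' := by
  refine coframe_injective a p ?_ ?_
  · erw [map_add]
    rw [(hlift_spec a p _).1, (hlift_spec a p _).1, (hlift_spec a p _).1]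
  · erw [map_add]
    rw [(hlift_spec a p _).2, (hlift_spec a p _).2, (hlift_spec a p _).2, add_zero]

theorem hlift_smul (a : PB.Conn) (p : P) (r : ℝ) (e : ℍ[ℝ]) :
    hlift a p (r • e) = r • hlift a p e := by
  refine coframe_injective a p ?_ ?_
  · erw [map_smul]
    rw [(hlift_spec a p _).1, (hlift_spec a p _).1]
  · erw [map_smul]
    rw [(hlift_spec a p _).2, (hlift_spec a p _).2, smul_zero]

/-- The horizontal lift as a linear map. -/
noncomputable def hliftLin (a : PB.Conn) (p : P) : ℍ[ℝ] →ₗ[ℝ] EuclideanSpace ℝ (Fin (4 + k)) where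
  toFun e := hlift a p e
  map_add' e e' := hlift_add a p e e'
  map_smul' r e := hlift_smul a p r e

/-- Every tangent vector is the sum of a horizontal lift and a fundamental vector. -/
theorem eq_hlift_add_fundamental (a : PB.Conn) (p : P) (w : EuclideanSpace ℝ (Fin (4 + k))) :
    w = hliftLin a p (dmap (𝓡 (4 + k)) 𝓘(ℝ, ℍ[ℝ]) PB.proj p w) +
      dmap (𝓡 k) (𝓡 (4 + k)) (fun g => PB.act p g) 1 (a.form.val p w) := by
  refine coframe_injective a p ?_ ?_
  · rw [map_add, mfderiv_proj_fundamental, add_zero]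
    exact (hlift_spec a p _).1.symm
  · rw [map_add, form_fundamental]
    refine (zero_add _).symm.trans (congrArg (· + _) ?_)
    exact (hlift_spec a p _).2.symm

theorem contMDiff_lift_expSp1 : ContMDiff (𝓘(ℝ, ℍ[ℝ]).prod (𝓡 (4 + k))) (𝓡 (4 + k)) ∞
    (fun z : ℍ[ℝ] × P => PB.lift.smul (expSp1 z.1) z.2) :=
  PB.lift.contMDiff_smul.comp ((contMDiff_expSp1.comp contMDiff_fst).prodMk contMDiff_snd)

/-- The Killing field `K_ξ` is the differential of `ξ ↦ exp(ξ) p` at `0`. -/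
theorem killing_eq (ξ : ℍ[ℝ]) (p : P) :
    PB.killing ξ p = dmap 𝓘(ℝ, ℍ[ℝ]) (𝓡 (4 + k)) (fun ξ => PB.lift.smul (expSp1 ξ) p) 0 ξ :=
  dmap_smul ((contMDiff_lift_expSp1.comp
    (contMDiff_id.prodMk contMDiff_const)).contMDiffAt.mdifferentiableAt (by simp)) ξ

/-- The Killing fields at a point, as a linear map. -/
noncomputable def killingLin (PB : LiftedBundle k G P) (p : P) :
    ℍ[ℝ] →L[ℝ] EuclideanSpace ℝ (Fin (4 + k)) :=
  dmap 𝓘(ℝ, ℍ[ℝ]) (𝓡 (4 + k)) (fun ξ => PB.lift.smul (expSp1 ξ) p) 0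

/-- The Killing field `K_ξ` projects to the vector field `x ↦ ξ x` on `ℍ`. -/
theorem dmap_proj_killing (ξ : ℍ[ℝ]) (p : P) :
    dmap (𝓡 (4 + k)) 𝓘(ℝ, ℍ[ℝ]) PB.proj p (PB.killing ξ p) = ξ.im * PB.proj p := by
  have h1 : MDifferentiableAt 𝓘(ℝ, ℝ) (𝓡 (4 + k))
      (fun t : ℝ => PB.lift.smul (expSp1 (t • ξ)) p) 0 :=
    ((PB.lift.contMDiff_smul_right p).contMDiffAt.mdifferentiableAt (by simp)).comp 0
      (mdifferentiableAt_expSp1_smul ξ)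
  have e1 := dmap_comp_apply (g := PB.proj) (f := fun t : ℝ => PB.lift.smul (expSp1 (t • ξ)) p)
    (PB.contMDiff_proj.contMDiffAt.mdifferentiableAt (by simp)) h1 (1 : ℝ)
  rw [zero_smul, expSp1_zero, PB.lift.one_smul] at e1
  refine e1.symm.trans ?_
  simp only [PB.proj_lift]
  have h2 : MDifferentiableAt 𝓘(ℝ, ℝ) 𝓘(ℝ, ℍ[ℝ]) (fun t : ℝ => ((expSp1 (t • ξ) : Sp1) : ℍ[ℝ])) 0 :=
    MDifferentiableAt.comp (0 : ℝ) (g := fun q : Sp1 => (q : ℍ[ℝ]))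
      ((contMDiff_coe_sphere (m := ∞)).contMDiffAt.mdifferentiableAt (by simp))
      (mdifferentiableAt_expSp1_smul ξ)
  have h3 := fderiv_coe_expSp1 ξ
  rw [dmap_eq_fderiv] at h3 ⊢
  rw [(h2.differentiableAt.hasFDerivAt.mul_const' (PB.proj p)).fderiv]
  simp [h3]

end LiftedBundle

end LiftedBundleGeometry

/-! ### The pull-back of a connection to `Q × P` -/

/-- The pull-back of a smooth one-form to a product is smooth in the pair of tangent vectors. -/
theorem OneForm.IsSmooth.contMDiff_pullback_prod {E₁ H₁ E₂ H₂ E H F : Type*}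
    [NormedAddCommGroup E₁] [NormedSpace ℝ E₁] [TopologicalSpace H₁] [NormedAddCommGroup E₂]
    [NormedSpace ℝ E₂] [TopologicalSpace H₂] [NormedAddCommGroup E] [NormedSpace ℝ E]
    [TopologicalSpace H] [NormedAddCommGroup F] [NormedSpace ℝ F]
    {I₁ : ModelWithCorners ℝ E₁ H₁} {I₂ : ModelWithCorners ℝ E₂ H₂} {I : ModelWithCorners ℝ E H}
    {M₁ M₂ N : Type*} [TopologicalSpace M₁] [ChartedSpace H₁ M₁] [TopologicalSpace M₂]
    [ChartedSpace H₂ M₂] [TopologicalSpace N] [ChartedSpace H N] [IsManifold I₁ ∞ M₁]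
    [IsManifold I₂ ∞ M₂] [IsManifold I ∞ N] {α : OneForm I N F} (hα : α.IsSmooth)
    {f : M₁ × M₂ → N} (hf : ContMDiff (I₁.prod I₂) I ∞ f) :
    ContMDiff (I₁.tangent.prod I₂.tangent) 𝓘(ℝ, F) ∞
      (fun z : TangentBundle I₁ M₁ × TangentBundle I₂ M₂ =>
        α.val (f (z.1.1, z.2.1)) (dmap (I₁.prod I₂) I f (z.1.1, z.2.1) (z.1.2, z.2.2))) := by
  have : IsManifold I₁ 1 M₁ := IsManifold.of_le (n := ∞) (by simp)
  have : IsManifold I₂ 1 M₂ := IsManifold.of_le (n := ∞) (by simp)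
  have : IsManifold I₁ (∞ + 1) M₁ := by simpa using ‹IsManifold I₁ ∞ M₁›
  have : IsManifold I₂ (∞ + 1) M₂ := by simpa using ‹IsManifold I₂ ∞ M₂›
  have : IsManifold I (∞ + 1) N := by simpa using ‹IsManifold I ∞ N›
  have h1 := hf.contMDiff_tangentMap (m := ∞) (by simp)
  have h2 := contMDiff_equivTangentBundleProd_symm (I := I₁) (M := M₁) (I' := I₂) (M' := M₂)
    (n := ∞)
  exact ContMDiff.comp (I' := I.tangent) hα (h1.comp h2)

section PullBack

variable {k : ℕ} {G : Type*} [TopologicalSpace G] [ChartedSpace (EuclideanSpace ℝ (Fin k)) G]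
  [Group G]
  {P : Type*} [TopologicalSpace P] [ChartedSpace (EuclideanSpace ℝ (Fin (4 + k))) P]
  [IsManifold (𝓡 (4 + k)) ∞ P]
  {X : Type*} [TopologicalSpace X] [ChartedSpace (EuclideanSpace ℝ (Fin 4)) X]
  [IsManifold (𝓡 4) ∞ X]
  {g : Metric4 X} {o : ∀ x : X, Orientation ℝ (TangentSpace (𝓡 4) x) (Fin 4)}
  {Q : Type*} [TopologicalSpace Q] [ChartedSpace (EuclideanSpace ℝ (Fin 10)) Q]
  [IsManifold (𝓡 10) ∞ Q]
  {S : SpinStructure g o Q} {PB : LiftedBundle k G P}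

theorem mdifferentiableAt_mkP (z : Q × P) :
    MDifferentiableAt ((𝓡 10).prod (𝓡 (4 + k))) ((𝓡 4).prod (𝓡 (4 + k)))
      (Assoc.mk S.toPrincipalBundle PB.spinAct) z :=
  (Assoc.contMDiff_mk S.toPrincipalBundle PB.spinAct).contMDiffAt.mdifferentiableAt (by simp)

theorem contMDiff_actP : ContMDiff (((𝓡 4).prod (𝓡 (4 + k))).prod (𝓡 k)) ((𝓡 4).prod (𝓡 (4 + k))) ∞
    (fun z : PTotal S PB × G => actP S PB z.1 z.2) := by
  apply Assoc.contMDiff_of_comp_mk_prod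
  exact (Assoc.contMDiff_mk S.toPrincipalBundle PB.spinAct).comp
    ((contMDiff_fst.comp contMDiff_fst).prodMk
      (PB.contMDiff_act.comp ((contMDiff_snd.comp contMDiff_fst).prodMk contMDiff_snd)))

theorem contMDiff_projP : ContMDiff ((𝓡 4).prod (𝓡 (4 + k))) ((𝓡 4).prod 𝓘(ℝ, ℍ[ℝ])) ∞
    (projP S PB) := by
  apply Assoc.contMDiff_of_comp_mk
  exact (Assoc.contMDiff_mk S.toPrincipalBundle spinRep).comp
    (contMDiff_fst.prodMk (PB.contMDiff_proj.comp contMDiff_snd))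

theorem actP_one (z : PTotal S PB) : actP S PB z 1 = z := by
  obtain ⟨⟨f, p⟩, rfl⟩ := Assoc.mk_surjective _ _ z
  change Assoc.mk S.toPrincipalBundle PB.spinAct (f, PB.act p 1) = _
  rw [PB.act_one]

/-- The pull-back to `Q × P` of a connection on `ℙ`. -/
noncomputable def ConnP.pull (A : ConnP S PB) (f : Q) (p : P) :
    EuclideanSpace ℝ (Fin 10) × EuclideanSpace ℝ (Fin (4 + k)) →L[ℝ] LieAlg k :=
  (A.form.val (Assoc.mk S.toPrincipalBundle PB.spinAct (f, p))).comp
    (dmap ((𝓡 10).prod (𝓡 (4 + k))) ((𝓡 4).prod (𝓡 (4 + k)))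
      (Assoc.mk S.toPrincipalBundle PB.spinAct) (f, p))

namespace ConnP

variable (A : ConnP S PB)

theorem contMDiff_pull : ContMDiff ((𝓡 10).tangent.prod (𝓡 (4 + k)).tangent) 𝓘(ℝ, LieAlg k) ∞
    (fun z : TangentBundle (𝓡 10) Q × TangentBundle (𝓡 (4 + k)) P =>
      A.pull z.1.1 z.2.1 (z.1.2, z.2.2)) := by
  exact A.smooth.contMDiff_pullback_prod (Assoc.contMDiff_mk S.toPrincipalBundle PB.spinAct)

/-- As `[f · h, p] = [f, h · p]`, a vector generating the action on `Q` may be replaced by the vector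
generating the action on `P`. -/
theorem pull_fund (f : Q) (p : P) (ξ ζ : ℍ[ℝ]) :
    A.pull f p (S.fund f ξ ζ, 0) = A.pull f p (0, PB.killing ξ p) :=
  congrArg (A.form.val (Assoc.mk S.toPrincipalBundle PB.spinAct (f, p)))
    (Assoc.dmap_mk_fund S.toPrincipalBundle PB.spinAct f p (mdifferentiableAt_expSpin4 ξ ζ)
      (expSpin4_zero ξ ζ))

theorem pull_act (f : Q) (p : P) (h : Spin4) (v : EuclideanSpace ℝ (Fin 10))
    (w : EuclideanSpace ℝ (Fin (4 + k))) :
    A.pull (S.act f h) p (dmap (𝓡 10) (𝓡 10) (fun f' => S.act f' h) f v, w) =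
      A.pull f (PB.lift.smul h.1 p)
        (v, dmap (𝓡 (4 + k)) (𝓡 (4 + k)) (fun p' => PB.lift.smul h.1 p') p w) := by
  have h1 : MDifferentiableAt (𝓡 10) (𝓡 10) (fun f' => S.act f' h) f :=
    (S.toPrincipalBundle.contMDiff_act_right h).contMDiffAt.mdifferentiableAt (by simp)
  have h2 : MDifferentiableAt (𝓡 (4 + k)) (𝓡 (4 + k)) (fun p' => PB.lift.smul h.1 p') p :=
    (PB.lift.contMDiff_smul_left h.1).contMDiffAt.mdifferentiableAt (by simp)
  have e1 := dmap_comp_apply (I := (𝓡 10).prod (𝓡 (4 + k))) (x := ((f, p) : Q × P))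
    (g := Assoc.mk S.toPrincipalBundle PB.spinAct)
    (f := fun z : Q × P => (S.act z.1 h, z.2)) (mdifferentiableAt_mkP _)
    ((h1.comp (f, p) mdifferentiableAt_fst).prodMk mdifferentiableAt_snd) (v, w)
  have e2 := dmap_comp_apply (I := (𝓡 10).prod (𝓡 (4 + k))) (x := ((f, p) : Q × P))
    (g := Assoc.mk S.toPrincipalBundle PB.spinAct)
    (f := fun z : Q × P => (z.1, PB.lift.smul h.1 z.2)) (mdifferentiableAt_mkP _)
    (mdifferentiableAt_fst.prodMk (h2.comp (f, p) mdifferentiableAt_snd)) (v, w)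
  have d1 : dmap ((𝓡 10).prod (𝓡 (4 + k))) ((𝓡 10).prod (𝓡 (4 + k)))
      (fun z : Q × P => (S.act z.1 h, z.2)) (f, p) (v, w) =
      (dmap (𝓡 10) (𝓡 10) (fun f' => S.act f' h) f v, w) :=
    DFunLike.congr_fun (mfderiv_prodMap (p := ((f, p) : Q × P)) (g := fun p : P => p)
      h1 mdifferentiableAt_id) (v, w) |>.trans (Prod.ext rfl (DFunLike.congr_fun (dmap_id p) w))
  have d2 : dmap ((𝓡 10).prod (𝓡 (4 + k))) ((𝓡 10).prod (𝓡 (4 + k)))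
      (fun z : Q × P => (z.1, PB.lift.smul h.1 z.2)) (f, p) (v, w) =
      (v, dmap (𝓡 (4 + k)) (𝓡 (4 + k)) (fun p' => PB.lift.smul h.1 p') p w) :=
    DFunLike.congr_fun (mfderiv_prodMap (p := ((f, p) : Q × P)) (f := fun f : Q => f)
      mdifferentiableAt_id h2) (v, w) |>.trans (Prod.ext (DFunLike.congr_fun (dmap_id f) v) rfl)
  have hmk : ∀ z : Q × P, Assoc.mk S.toPrincipalBundle PB.spinAct (S.act z.1 h, z.2) =
      Assoc.mk S.toPrincipalBundle PB.spinAct (z.1, PB.lift.smul h.1 z.2) := fun z =>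
    Assoc.mk_act S.toPrincipalBundle PB.spinAct z.1 h z.2
  rw [d1] at e1
  rw [d2] at e2
  simp only [hmk] at e1
  change A.form.val (Assoc.mk S.toPrincipalBundle PB.spinAct (S.act f h, p)) _ =
    A.form.val (Assoc.mk S.toPrincipalBundle PB.spinAct (f, PB.lift.smul h.1 p)) _
  rw [hmk (f, p)]
  exact congrArg _ (e1.symm.trans e2)

theorem pull_act_right (f : Q) (p : P) (c : G) (v : EuclideanSpace ℝ (Fin 10))
    (w : EuclideanSpace ℝ (Fin (4 + k))) :
    A.pull f (PB.act p c) (v, dmap (𝓡 (4 + k)) (𝓡 (4 + k)) (fun p' => PB.act p' c) p w) =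
      Ad c⁻¹ (A.pull f p (v, w)) := by
  have h2 : MDifferentiableAt (𝓡 (4 + k)) (𝓡 (4 + k)) (fun p' => PB.act p' c) p :=
    (PB.toPrincipalBundle.contMDiff_act_right c).contMDiffAt.mdifferentiableAt (by simp)
  have e2 := dmap_comp_apply (I := (𝓡 10).prod (𝓡 (4 + k))) (x := ((f, p) : Q × P))
    (g := Assoc.mk S.toPrincipalBundle PB.spinAct)
    (f := fun z : Q × P => (z.1, PB.act z.2 c)) (mdifferentiableAt_mkP _)
    (mdifferentiableAt_fst.prodMk (h2.comp (f, p) mdifferentiableAt_snd)) (v, w)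
  have d2 : dmap ((𝓡 10).prod (𝓡 (4 + k))) ((𝓡 10).prod (𝓡 (4 + k)))
      (fun z : Q × P => (z.1, PB.act z.2 c)) (f, p) (v, w) =
      (v, dmap (𝓡 (4 + k)) (𝓡 (4 + k)) (fun p' => PB.act p' c) p w) :=
    DFunLike.congr_fun (mfderiv_prodMap (p := ((f, p) : Q × P)) (f := fun f : Q => f)
      mdifferentiableAt_id h2) (v, w) |>.trans (Prod.ext (DFunLike.congr_fun (dmap_id f) v) rfl)
  have hact : MDifferentiableAt ((𝓡 4).prod (𝓡 (4 + k))) ((𝓡 4).prod (𝓡 (4 + k)))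
      (fun z : PTotal S PB => actP S PB z c) (Assoc.mk S.toPrincipalBundle PB.spinAct (f, p)) :=
    (contMDiff_actP.comp (contMDiff_id.prodMk contMDiff_const)).contMDiffAt.mdifferentiableAt
      (by simp)
  have e1 := dmap_comp_apply (I := (𝓡 10).prod (𝓡 (4 + k))) (x := ((f, p) : Q × P)) hact
    (f := Assoc.mk S.toPrincipalBundle PB.spinAct) (mdifferentiableAt_mkP _) (v, w)
  rw [d2] at e2
  refine (congrArg (A.form.val (Assoc.mk S.toPrincipalBundle PB.spinAct (f, PB.act p c)))
    e2.symm).trans ?_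
  refine Eq.trans ?_ (A.equivariant _ c _)
  exact congrArg (A.form.val (Assoc.mk S.toPrincipalBundle PB.spinAct (f, PB.act p c))) e1

theorem pull_fundamental (f : Q) (p : P) (ξ : LieAlg k) :
    A.pull f p (0, dmap (𝓡 k) (𝓡 (4 + k)) (fun c => PB.act p c) 1 ξ) = ξ := by
  have h2 : MDifferentiableAt (𝓡 k) (𝓡 (4 + k)) (fun c => PB.act p c) 1 :=
    (PB.toPrincipalBundle.contMDiff_act_left p).contMDiffAt.mdifferentiableAt (by simp)
  have e2 := dmap_comp_apply (g := Assoc.mk S.toPrincipalBundle PB.spinAct)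
    (f := fun c : G => (f, PB.act p c)) (mdifferentiableAt_mkP _)
    (mdifferentiableAt_const.prodMk h2) ξ
  rw [dmap_prodMk mdifferentiableAt_const h2, dmap_const, PB.act_one] at e2
  have h3 := A.fundamental (Assoc.mk S.toPrincipalBundle PB.spinAct (f, p)) ξ
  have h4 : A.form.val (actP S PB (Assoc.mk S.toPrincipalBundle PB.spinAct (f, p)) 1)
    (dmap (𝓡 k) ((𝓡 4).prod (𝓡 (4 + k)))
      (fun c => actP S PB (Assoc.mk S.toPrincipalBundle PB.spinAct (f, p)) c) 1 ξ) = ξ := h3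
  rw [actP_one] at h4
  exact (congrArg (A.form.val _) e2.symm).trans h4

end ConnP

/-! ### Killing fields under the actions -/

namespace LiftedBundle

theorem dmap_act_killing (ξ : ℍ[ℝ]) (p : P) (c : G) :
    dmap (𝓡 (4 + k)) (𝓡 (4 + k)) (fun p' => PB.act p' c) p (PB.killing ξ p) =
      PB.killing ξ (PB.act p c) := by
  have h1 : MDifferentiableAt 𝓘(ℝ, ℝ) (𝓡 (4 + k))
      (fun t : ℝ => PB.lift.smul (expSp1 (t • ξ)) p) 0 :=
    ((PB.lift.contMDiff_smul_right p).contMDiffAt.mdifferentiableAt (by simp)).comp 0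
      (mdifferentiableAt_expSp1_smul ξ)
  have h2 : ∀ p, MDifferentiableAt (𝓡 (4 + k)) (𝓡 (4 + k)) (fun p' => PB.act p' c) p := fun p =>
    (PB.toPrincipalBundle.contMDiff_act_right c).contMDiffAt.mdifferentiableAt (by simp)
  have e := dmap_comp_apply (g := fun p' => PB.act p' c) (h2 _) h1 (1 : ℝ)
  rw [zero_smul, expSp1_zero, PB.lift.one_smul] at e
  refine e.symm.trans ?_
  simp only [← PB.lift_act]
  rfl

theorem expSp1_conj (q : Sp1) (ξ : ℍ[ℝ]) (t : ℝ) :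
    q * expSp1 (t • (star (q : ℍ[ℝ]) * ξ * q)) = expSp1 (t • ξ) * q := by
  have him : (t • (star (q : ℍ[ℝ]) * ξ * q)).im = star (q : ℍ[ℝ]) * (t • ξ).im * q := by
    apply Quaternion.ext <;> simp only [Quaternion.re_im, Quaternion.imI_im, Quaternion.imJ_im,
      Quaternion.imK_im, Quaternion.imI_smul, Quaternion.imJ_smul,
      Quaternion.imK_smul, Quaternion.re_mul, Quaternion.imI_mul, Quaternion.imJ_mul,
      Quaternion.imK_mul, Quaternion.re_star, Quaternion.imI_star, Quaternion.imJ_star,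
      Quaternion.imK_star, smul_eq_mul] <;> ring
  have hq : (q : ℍ[ℝ]) * star (q : ℍ[ℝ]) = 1 := by
    rw [Quaternion.self_mul_star, Quaternion.normSq_eq_norm_mul_self, norm_eq_of_mem_sphere]
    simp
  have hq0 : star (q : ℍ[ℝ]) ≠ 0 := right_ne_zero_of_mul_eq_one hq
  have hinv : (star (q : ℍ[ℝ]))⁻¹ = q := (eq_inv_of_mul_eq_one_left hq).symm
  apply Subtype.ext
  change (q : ℍ[ℝ]) * NormedSpace.exp (t • (star (q : ℍ[ℝ]) * ξ * q)).im =
    NormedSpace.exp (t • ξ).im * q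
  let _ : NormedAlgebra ℚ ℍ[ℝ] := NormedAlgebra.restrictScalars ℚ ℝ ℍ[ℝ]
  have e := NormedSpace.exp_conj (star (q : ℍ[ℝ])) (t • ξ).im hq0
  rw [hinv] at e
  rw [him, e, ← mul_assoc, ← mul_assoc, hq, one_mul]

theorem dmap_smul_killing (ξ : ℍ[ℝ]) (p : P) (q : Sp1) :
    dmap (𝓡 (4 + k)) (𝓡 (4 + k)) (fun p' => PB.lift.smul q p') p
      (PB.killing (star (q : ℍ[ℝ]) * ξ * q) p) = PB.killing ξ (PB.lift.smul q p) := by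
  have h1 : MDifferentiableAt 𝓘(ℝ, ℝ) (𝓡 (4 + k))
      (fun t : ℝ => PB.lift.smul (expSp1 (t • (star (q : ℍ[ℝ]) * ξ * q))) p) 0 :=
    ((PB.lift.contMDiff_smul_right p).contMDiffAt.mdifferentiableAt (by simp)).comp 0
      (mdifferentiableAt_expSp1_smul _)
  have h2 : ∀ p, MDifferentiableAt (𝓡 (4 + k)) (𝓡 (4 + k)) (fun p' => PB.lift.smul q p') p :=
    fun p => (PB.lift.contMDiff_smul_left q).contMDiffAt.mdifferentiableAt (by simp)
  have e := dmap_comp_apply (g := fun p' => PB.lift.smul q p') (h2 _) h1 (1 : ℝ)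
  rw [zero_smul, expSp1_zero, PB.lift.one_smul] at e
  refine e.symm.trans ?_
  simp only [← PB.lift.mul_smul, expSp1_conj]
  simp only [PB.lift.mul_smul]
  rfl

end LiftedBundle
end PullBack

/-! ### The decomposition of a connection -/

section Decomposition

variable {k : ℕ} {G : Type*} [TopologicalSpace G] [ChartedSpace (EuclideanSpace ℝ (Fin k)) G]
  [Group G]
  {P : Type*} [TopologicalSpace P] [ChartedSpace (EuclideanSpace ℝ (Fin (4 + k))) P]
  [IsManifold (𝓡 (4 + k)) ∞ P]
  {X : Type*} [TopologicalSpace X] [ChartedSpace (EuclideanSpace ℝ (Fin 4)) X]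
  [IsManifold (𝓡 4) ∞ X]
  {g : Metric4 X} {o : ∀ x : X, Orientation ℝ (TangentSpace (𝓡 4) x) (Fin 4)}
  {Q : Type*} [TopologicalSpace Q] [ChartedSpace (EuclideanSpace ℝ (Fin 10)) Q]
  [IsManifold (𝓡 10) ∞ Q]
  {S : SpinStructure g o Q} {PB : LiftedBundle k G P}

theorem quaternion_eq_sum_inner (ξ : ℍ[ℝ]) :
    ξ = (inner ℝ (qvec 0) ξ : ℝ) • qvec 0 + (inner ℝ (qvec 1) ξ : ℝ) • qvec 1 +
      (inner ℝ (qvec 2) ξ : ℝ) • qvec 2 + (inner ℝ (qvec 3) ξ : ℝ) • qvec 3 := by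
  have h0 : ∀ q : ℍ[ℝ], (inner ℝ q ξ : ℝ) =
      q.re * ξ.re + q.imI * ξ.imI + q.imJ * ξ.imJ + q.imK * ξ.imK := by
    intro q
    rw [Quaternion.inner_def, Quaternion.re_mul, Quaternion.re_star, Quaternion.imI_star,
      Quaternion.imJ_star, Quaternion.imK_star]
    ring
  have h : (inner ℝ (qvec 0) ξ : ℝ) = ξ.re ∧ (inner ℝ (qvec 1) ξ : ℝ) = ξ.imI ∧
      (inner ℝ (qvec 2) ξ : ℝ) = ξ.imJ ∧ (inner ℝ (qvec 3) ξ : ℝ) = ξ.imK := by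
    rw [h0, h0, h0, h0]
    simp [qvec]
  rw [h.1, h.2.1, h.2.2.1, h.2.2.2]
  exact quaternion_eq_sum ξ

/-- The value of `b ∈ Ω¹(X; 𝕃)` as a linear map on the model vector space of `Q`. -/
noncomputable def OneFormL.val (b : OneFormL S PB) (f : Q) (p : P) :
    EuclideanSpace ℝ (Fin 10) →L[ℝ] LieAlg k := b.toFun f p

theorem killing_eq_killingLin (ξ : ℍ[ℝ]) (p : P) :
    PB.killing ξ p = LiftedBundle.killingLin PB p ξ := LiftedBundle.killing_eq ξ p

namespace ConnP

variable (A : ConnP S PB)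

theorem contMDiff_pull_right : ContMDiff ((𝓡 10).prod (𝓡 (4 + k)).tangent) 𝓘(ℝ, LieAlg k) ∞
    (fun z : Q × TangentBundle (𝓡 (4 + k)) P => A.pull z.1 z.2.1 (0, z.2.2)) := by
  have h0 : ContMDiff (𝓡 10) (𝓡 10).tangent ∞
      (zeroSection (EuclideanSpace ℝ (Fin 10)) (fun f : Q => TangentSpace (𝓡 10) f)) :=
    contMDiff_zeroSection ℝ _
  exact A.contMDiff_pull.comp ((h0.comp contMDiff_fst).prodMk contMDiff_snd)

theorem contMDiff_pull_left : ContMDiff ((𝓡 10).tangent.prod (𝓡 (4 + k))) 𝓘(ℝ, LieAlg k) ∞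
    (fun z : TangentBundle (𝓡 10) Q × P => A.pull z.1.1 z.2 (z.1.2, 0)) := by
  have h0 : ContMDiff (𝓡 (4 + k)) (𝓡 (4 + k)).tangent ∞
      (zeroSection (EuclideanSpace ℝ (Fin (4 + k))) (fun p : P => TangentSpace (𝓡 (4 + k)) p)) :=
    contMDiff_zeroSection ℝ _
  exact A.contMDiff_pull.comp (contMDiff_fst.prodMk (h0.comp contMDiff_snd))

/-- The restriction of a connection on `ℙ` to the fibre of `ℙ → X` over `π f`, identified with
`P` by `f`. -/
noncomputable def fibreConn (f : Q) : PB.Conn where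
  form p := (A.pull f p).comp
    (.inr ℝ (EuclideanSpace ℝ (Fin 10)) (EuclideanSpace ℝ (Fin (4 + k))))
  smooth := A.contMDiff_pull_right.comp (contMDiff_const.prodMk contMDiff_id)
  fundamental p ξ := by
    have h : A.pull f (PB.act p 1) (0, dmap (𝓡 k) (𝓡 (4 + k)) (fun c => PB.act p c) 1 ξ) = ξ := by
      rw [PB.act_one]
      exact A.pull_fundamental f p ξ
    exact h
  equivariant p c w := by
    have h := A.pull_act_right f p c 0 w
    exact h

/-- The section of `𝔸` given by the restrictions of a connection on `ℙ` to the fibres of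
`ℙ → X`. -/
noncomputable def toSectionA : SectionA S PB where
  toFun f := A.fibreConn f
  equivariant f h p w := by
    have e := A.pull_act f p h 0 w
    rw [map_zero] at e
    exact e
  smooth := A.contMDiff_pull_right

theorem contMDiff_pull_killing (q : ℍ[ℝ]) : ContMDiff ((𝓡 10).prod (𝓡 (4 + k))) 𝓘(ℝ, LieAlg k) ∞
    (fun z : Q × P => A.pull z.1 z.2 (0, PB.killing q z.2)) := by
  have : IsManifold (𝓡 (4 + k)) 1 P := IsManifold.of_le (n := ∞) (by simp)
  -- the Killing field is a value of the tangent map of `(ξ, p) ↦ exp(ξ) p` at `ξ = 0`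
  have h1 := (LiftedBundle.contMDiff_lift_expSp1 (PB := PB)).contMDiff_tangentMap (m := ∞) (by simp)
  have h2 := contMDiff_equivTangentBundleProd_symm (I := 𝓘(ℝ, ℍ[ℝ])) (M := ℍ[ℝ])
    (I' := 𝓡 (4 + k)) (M' := P) (n := ∞)
  have h0 : ContMDiff (𝓡 (4 + k)) (𝓡 (4 + k)).tangent ∞
      (zeroSection (EuclideanSpace ℝ (Fin (4 + k))) (fun p : P => TangentSpace (𝓡 (4 + k)) p)) :=
    contMDiff_zeroSection ℝ _
  have hq : ContMDiff (𝓡 (4 + k)) 𝓘(ℝ, ℍ[ℝ]).tangent ∞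
      (fun _ : P => (⟨0, q⟩ : TangentBundle 𝓘(ℝ, ℍ[ℝ]) ℍ[ℝ])) := contMDiff_const
  have h3 := (h1.comp h2).comp (hq.prodMk h0)
  refine (A.contMDiff_pull_right.comp (contMDiff_fst.prodMk (h3.comp contMDiff_snd))).congr ?_
  rintro ⟨f, p⟩
  change _ = A.pull f (PB.lift.smul (expSp1 0) p)
    (0, dmap (𝓘(ℝ, ℍ[ℝ]).prod (𝓡 (4 + k))) (𝓡 (4 + k))
      (fun z : ℍ[ℝ] × P => PB.lift.smul (expSp1 z.1) z.2) (0, p) (q, 0))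
  rw [dmap_prod_left (LiftedBundle.contMDiff_lift_expSp1.contMDiffAt.mdifferentiableAt (by simp)),
    expSp1_zero, PB.lift.one_smul]
  exact congrArg (fun w => A.pull f p (0, w)) (LiftedBundle.killing_eq q p)

variable (L : LeviCivita S)

/-- The value of the form `v ↦ A(v, -K_{φ(v)})` on `Q`, which is the `b` of the decomposition. It is
horizontal, as `(v, -K_{φ(v)})` is tangent to an orbit of `Spin(4)` on `Q × P` for vertical `v`. -/
noncomputable def horizontalForm (f : Q) (p : P) : EuclideanSpace ℝ (Fin 10) →L[ℝ] LieAlg k :=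
  (A.pull f p).comp ((ContinuousLinearMap.id ℝ _).prod
    (-(LiftedBundle.killingLin PB p).comp (L.φ.val f)))

theorem horizontalForm_apply (f : Q) (p : P) (v : EuclideanSpace ℝ (Fin 10)) :
    A.horizontalForm L f p v = A.pull f p (v, -LiftedBundle.killingLin PB p (L.φ.val f v)) := rfl

theorem pull_killing_eq_sum (f : Q) (p : P) (ξ : ℍ[ℝ]) :
    A.pull f p (0, LiftedBundle.killingLin PB p ξ) =
      (inner ℝ (qvec 0) ξ : ℝ) • A.pull f p (0, PB.killing (qvec 0) p) +
      (inner ℝ (qvec 1) ξ : ℝ) • A.pull f p (0, PB.killing (qvec 1) p) +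
      (inner ℝ (qvec 2) ξ : ℝ) • A.pull f p (0, PB.killing (qvec 2) p) +
      (inner ℝ (qvec 3) ξ : ℝ) • A.pull f p (0, PB.killing (qvec 3) p) := by
  have hinr : ∀ ξ, A.pull f p (0, LiftedBundle.killingLin PB p ξ) =
      (A.pull f p).comp ((ContinuousLinearMap.inr ℝ (EuclideanSpace ℝ (Fin 10)) _).comp
        (LiftedBundle.killingLin PB p)) ξ := fun ξ => rfl
  simp only [killing_eq_killingLin]
  simp only [hinr]
  conv_lhs => rw [quaternion_eq_sum_inner ξ]
  simp only [map_add, map_smul]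

theorem horizontalForm_eq_sub (f : Q) (p : P) (v : EuclideanSpace ℝ (Fin 10)) :
    A.horizontalForm L f p v =
      A.pull f p (v, 0) - A.pull f p (0, LiftedBundle.killingLin PB p (L.φ.val f v)) := by
  rw [horizontalForm_apply, ← map_sub]
  simp

theorem contMDiff_horizontalForm : ContMDiff ((𝓡 10).tangent.prod (𝓡 (4 + k))) 𝓘(ℝ, LieAlg k) ∞
    (fun z : TangentBundle (𝓡 10) Q × P => A.horizontalForm L z.1.1 z.2 z.1.2) := by
  have hφ : ContMDiff ((𝓡 10).tangent.prod (𝓡 (4 + k))) 𝓘(ℝ, ℍ[ℝ]) ∞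
      (fun z : TangentBundle (𝓡 10) Q × P => L.φ.val z.1.1 z.1.2) :=
    ContMDiff.comp L.smooth_φ contMDiff_fst
  have hK : ∀ q, ContMDiff ((𝓡 10).tangent.prod (𝓡 (4 + k))) 𝓘(ℝ, LieAlg k) ∞
      (fun z : TangentBundle (𝓡 10) Q × P =>
        (inner ℝ q (L.φ.val z.1.1 z.1.2) : ℝ) • A.pull z.1.1 z.2 (0, PB.killing q z.2)) := by
    intro q
    refine ContDiff.comp_contMDiff (g := fun x : ℝ × LieAlg k => x.1 • x.2)
      (contDiff_fst.smul contDiff_snd) (ContMDiff.prodMk_space ?_ ?_)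
    · exact ContDiff.comp_contMDiff (g := fun x : ℍ[ℝ] => (inner ℝ q x : ℝ))
        (contDiff_const.inner ℝ contDiff_id) hφ
    · exact (A.contMDiff_pull_killing q).comp
        (((contMDiff_proj _).comp contMDiff_fst).prodMk contMDiff_snd)
  refine (A.contMDiff_pull_left.sub
    ((((hK (qvec 0)).add (hK (qvec 1))).add (hK (qvec 2))).add (hK (qvec 3)))).congr ?_
  rintro ⟨⟨f, v⟩, p⟩
  exact (A.horizontalForm_eq_sub L f p v).trans
    (congrArg (A.pull f p (v, 0) - ·) (A.pull_killing_eq_sum f p _))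

theorem horizontalForm_act_right (f : Q) (p : P) (c : G) (v : EuclideanSpace ℝ (Fin 10)) :
    A.horizontalForm L f (PB.act p c) v = Ad c⁻¹ (A.horizontalForm L f p v) := by
  have h := LiftedBundle.dmap_act_killing (PB := PB) (L.φ.val f v) p c
  rw [killing_eq_killingLin, killing_eq_killingLin] at h
  rw [horizontalForm_apply, horizontalForm_apply, ← pull_act_right, map_neg, h]

theorem horizontalForm_act (f : Q) (h : Spin4) (p : P) (v : EuclideanSpace ℝ (Fin 10)) :
    A.horizontalForm L (S.act f h) p (dmap (𝓡 10) (𝓡 10) (fun f' => S.act f' h) f v) =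
      A.horizontalForm L f (PB.lift.smul h.1 p) v := by
  have h1 := LiftedBundle.dmap_smul_killing (PB := PB) (L.φ.val f v) p h.1
  rw [killing_eq_killingLin, killing_eq_killingLin] at h1
  have h2 : L.φ.val (S.act f h) (dmap (𝓡 10) (𝓡 10) (fun f' => S.act f' h) f v) =
    star (h.1 : ℍ[ℝ]) * L.φ.val f v * (h.1 : ℍ[ℝ]) := L.φ_equivariant f h v
  rw [horizontalForm_apply, horizontalForm_apply, pull_act, map_neg, h2, h1]

theorem horizontalForm_fund (f : Q) (p : P) {ξ ζ : ℍ[ℝ]} (hξ : ξ.im = ξ)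
    {v : EuclideanSpace ℝ (Fin 10)} (hv : v = S.fund f ξ ζ) : A.horizontalForm L f p v = 0 := by
  have h1 := A.pull_fund f p ξ ζ
  have h2 : L.φ.val f (S.fund f ξ ζ) = ξ := (L.φ_fund f ξ ζ).trans hξ
  rw [killing_eq_killingLin] at h1
  rw [← hv] at h1 h2
  rw [horizontalForm_eq_sub, h2, h1, sub_self]

/-- The horizontal one-form on `X` with values in `𝕃` determined by a connection on `ℙ`. -/
noncomputable def toOneFormL : OneFormL S PB where
  toFun f p := A.horizontalForm L f p
  act_right f p c v := A.horizontalForm_act_right L f p c v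
  horizontal f p v hv := by
    rw [← S.theta_eq_zero_iff] at hv
    have e := L.eq_lift_add_fund f v
    have h0 : L.lift f (S.theta f v) = 0 := by
      rw [hv]
      have := L.lift_smul f 0 0
      simpa using this
    rw [h0, zero_add] at e
    exact A.horizontalForm_fund L f p (L.im_φ f v) e
  equivariant f h p v := A.horizontalForm_act L f h p v
  smooth := A.contMDiff_horizontalForm L

theorem pull_eq (f : Q) (p : P) (v : EuclideanSpace ℝ (Fin 10))
    (w : EuclideanSpace ℝ (Fin (4 + k))) :
    A.pull f p (v, w) = A.pull f p (0, w + LiftedBundle.killingLin PB p (L.φ.val f v)) +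
      A.horizontalForm L f p v := by
  rw [horizontalForm_apply, ← map_add]
  simp

/-- `IsSum` in terms of the pull-back. -/
theorem isSum_iff (a : SectionA S PB) (b : OneFormL S PB) :
    IsSum L A a b ↔ ∀ (f : Q) (p : P) (v : EuclideanSpace ℝ (Fin 10))
      (w : EuclideanSpace ℝ (Fin (4 + k))), A.pull f p (v, w) =
        (a.toFun f).form.val p (w + LiftedBundle.killingLin PB p (L.φ.val f v)) +
          b.val f p v := by
  have h : ∀ (f : Q) (p : P) (v : EuclideanSpace ℝ (Fin 10)) (w : EuclideanSpace ℝ (Fin (4 + k))),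
      _ := fun f p v w => congrArg (fun z : EuclideanSpace ℝ (Fin (4 + k)) =>
      (a.toFun f).form.val p (w + z) + b.val f p v) (killing_eq_killingLin (PB := PB) (L.φ.val f v) p)
  exact ⟨fun H f p v w => (H f p v w).trans (h f p v w),
    fun H f p v w => (H f p v w).trans (h f p v w).symm⟩

theorem isSum_toSectionA_toOneFormL : IsSum L A A.toSectionA (A.toOneFormL L) :=
  (A.isSum_iff L _ _).2 fun f p v w => A.pull_eq L f p v w

theorem sectionA_ext {a a' : SectionA S PB}
    (h : ∀ f p (w : EuclideanSpace ℝ (Fin (4 + k))),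
      (a.toFun f).form.val p w = (a'.toFun f).form.val p w) : a = a' := by
  obtain ⟨a, _, _⟩ := a
  obtain ⟨a', _, _⟩ := a'
  have : a = a' := by
    funext f
    have h1 := h f
    change ∀ p (w : EuclideanSpace ℝ (Fin (4 + k))), (a f).form.val p w = (a' f).form.val p w at h1
    generalize a f = c at h1 ⊢
    generalize a' f = c' at h1 ⊢
    obtain ⟨c, _, _, _⟩ := c
    obtain ⟨c', _, _, _⟩ := c'
    have : c = c' := by
      funext p
      ext1 w
      exact h1 p w
    subst this
    rfl
  subst this
  rfl

theorem oneFormL_ext {b b' : OneFormL S PB}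
    (h : ∀ f p (v : EuclideanSpace ℝ (Fin 10)), b.val f p v = b'.val f p v) : b = b' := by
  obtain ⟨b, _, _, _, _⟩ := b
  obtain ⟨b', _, _, _, _⟩ := b'
  have : b = b' := by
    funext f p
    ext1 v
    exact h f p v
  subst this
  rfl

/-- Every connection on `ℙ` is `â + b̂` for exactly one pair `(a, b)`. -/
theorem existsUnique_isSum :
    ∃! ab : SectionA S PB × OneFormL S PB, IsSum L A ab.1 ab.2 := by
  refine ⟨(A.toSectionA, A.toOneFormL L), A.isSum_toSectionA_toOneFormL L, ?_⟩
  rintro ⟨a, b⟩ h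
  have h1 := (A.isSum_iff L a b).1 h
  have h2 := (A.isSum_iff L _ _).1 (A.isSum_toSectionA_toOneFormL L)
  -- `a` is determined by the vectors `(0, w)`, and then `b` by the vectors `(v, 0)`
  have ha : a = A.toSectionA := by
    refine sectionA_ext fun f p w => ?_
    have e1 := h1 f p 0 w
    have e2 := h2 f p 0 w
    simp only [map_zero, add_zero] at e1 e2
    rw [← e1, ← e2]
  subst ha
  refine Prod.ext rfl (oneFormL_ext fun f p v => ?_)
  have e := (h1 f p v 0).symm.trans (h2 f p v 0)
  exact add_left_cancel e

end ConnP
end Decomposition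

/-! ### Naturality of the exterior derivative -/

section ExteriorDerivative

variable {E H : Type*} [NormedAddCommGroup E] [NormedSpace ℝ E]
  [TopologicalSpace H] {I : ModelWithCorners ℝ E H}
  {N : Type*} [TopologicalSpace N] [ChartedSpace H N]
  {E₁ H₁ : Type*} [NormedAddCommGroup E₁] [NormedSpace ℝ E₁] [FiniteDimensional ℝ E₁]
  [TopologicalSpace H₁] {I₁ : ModelWithCorners ℝ E₁ H₁} [I₁.Boundaryless]
  {M₁ : Type*} [TopologicalSpace M₁] [ChartedSpace H₁ M₁] [IsManifold I₁ ∞ M₁]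
  {E₂ H₂ : Type*} [NormedAddCommGroup E₂] [NormedSpace ℝ E₂] [FiniteDimensional ℝ E₂]
  [TopologicalSpace H₂] {I₂ : ModelWithCorners ℝ E₂ H₂} [I₂.Boundaryless]
  {M₂ : Type*} [TopologicalSpace M₂] [ChartedSpace H₂ M₂] [IsManifold I₂ ∞ M₂]
  {F F' : Type*} [NormedAddCommGroup F] [NormedSpace ℝ F] [NormedAddCommGroup F']
  [NormedSpace ℝ F']

/-- The exterior derivative, with tangent vectors in the model vector space. -/
noncomputable def OneForm.dval (α : OneForm I N F) (x : N) (u v : E) : F := α.d x u v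

theorem OneForm.dval_add_left (α : OneForm I N F) (x : N) (u u' v : E) :
    α.dval x (u + u') v = α.dval x u v + α.dval x u' v := by
  change fderiv ℝ (α.inChart x) (extChartAt I x x) (u + u') v -
    fderiv ℝ (α.inChart x) (extChartAt I x x) v (u + u') = (_ - _) + (_ - _)
  rw [map_add, map_add, add_apply, add_sub_add_comm]

theorem OneForm.dval_swap (α : OneForm I N F) (x : N) (u v : E) :
    α.dval x u v = -α.dval x v u := (neg_sub _ _).symm

theorem OneForm.dval_smul_left (α : OneForm I N F) (x : N) (r : ℝ) (u v : E) :
    α.dval x (r • u) v = r • α.dval x u v := by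
  change fderiv ℝ (α.inChart x) (extChartAt I x x) (r • u) v -
    fderiv ℝ (α.inChart x) (extChartAt I x x) v (r • u) = r • (_ - _)
  rw [map_smul, map_smul, smul_apply, smul_sub]

theorem extChartAt_symm_self (x : N) : (extChartAt I x).symm (extChartAt I x x) = x :=
  extChartAt_to_inv x

variable [I.Boundaryless] [IsManifold I ∞ N]

theorem dmap_extChartAt_symm_self (x : N) :
    dmap 𝓘(ℝ, E) I (extChartAt I x).symm (extChartAt I x x) = .id ℝ E := by
  have : IsManifold I 1 N := IsManifold.of_le (n := ∞) (by simp)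
  ext1 v
  exact mfderiv_extChartAt_symm_self x v

theorem contMDiffAt_extChartAt_symm' {x : N} {s : E} (hs : s ∈ (extChartAt I x).target) :
    ContMDiffAt 𝓘(ℝ, E) I ∞ (extChartAt I x).symm s :=
  (contMDiffOn_extChartAt_symm x).contMDiffAt ((isOpen_extChartAt_target x).mem_nhds hs)

variable [FiniteDimensional ℝ E]

/-- The pull-back of a one-form by a map of manifolds. -/
noncomputable def OneForm.comap (α : OneForm I N F) (f : M₁ → N) : OneForm I₁ M₁ F :=
  let T : M₁ → E₁ →L[ℝ] F := fun x => (α.val (f x)).comp (dmap I₁ I f x)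
  T

/-- The exterior derivative commutes with pull-backs. -/
theorem OneForm.IsSmooth.dval_dmap {α : OneForm I N F} (hα : α.IsSmooth) {f : M₁ → N}
    (hf : ContMDiff I₁ I ∞ f) (x : M₁) (u v : E₁) :
    α.dval (f x) (dmap I₁ I f x u) (dmap I₁ I f x v) =
      OneForm.dval (I := I₁) (α.comap f) x u v := by
  set c := extChartAt I₁ x with hc
  have hcx : c x ∈ c.target := mem_extChartAt_target x
  have hcs : ∀ s ∈ c.target, MDifferentiableAt 𝓘(ℝ, E₁) I₁ c.symm s := fun s hs =>
    (contMDiffAt_extChartAt_symm' hs).mdifferentiableAt (by simp)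
  have hff : ∀ z, MDifferentiableAt I₁ I f z := fun z => hf.contMDiffAt.mdifferentiableAt (by simp)
  have hΨ : ∀ᶠ s in nhds (c x), ContMDiffAt 𝓘(ℝ, E₁) I ∞ (fun s => f (c.symm s)) s := by
    filter_upwards [(isOpen_extChartAt_target (I := I₁) x).mem_nhds hcx] with s hs
    exact hf.contMDiffAt.comp s (contMDiffAt_extChartAt_symm' hs)
  have h := hα.d_pullback_of_eq hΨ (congrArg f (extChartAt_symm_self (I := I₁) x)) u v
  have hd : dmap 𝓘(ℝ, E₁) I (fun s => f (c.symm s)) (c x) = dmap I₁ I f x := by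
    rw [dmap_comp (hff _) (hcs _ hcx), dmap_extChartAt_symm_self, extChartAt_symm_self]
    rfl
  have hp : α.pullback (fun s => f (c.symm s)) =ᶠ[nhds (c x)]
      OneForm.inChart (I := I₁) (α.comap f) x := by
    filter_upwards [(isOpen_extChartAt_target (I := I₁) x).mem_nhds hcx] with s hs
    change (α.val (f (c.symm s))).comp (dmap 𝓘(ℝ, E₁) I (fun s => f (c.symm s)) s) =
      ((α.val (f (c.symm s))).comp (dmap I₁ I f (c.symm s))).comp (dmap 𝓘(ℝ, E₁) I₁ c.symm s)
    rw [dmap_comp (hff _) (hcs _ hs)]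
    rfl
  rw [hp.fderiv_eq] at h
  change α.dval (f x) (dmap 𝓘(ℝ, E₁) I (fun s => f (c.symm s)) (c x) u)
    (dmap 𝓘(ℝ, E₁) I (fun s => f (c.symm s)) (c x) v) = _ at h
  rw [hd] at h
  exact h

theorem dmap_prod_extChartAt_symm {x : M₁} {y : M₂} {s : E₁} {t : E₂}
    (hs : s ∈ (extChartAt I₁ x).target) (ht : t ∈ (extChartAt I₂ y).target) (u : E₁) (w : E₂) :
    dmap 𝓘(ℝ, E₁ × E₂) (I₁.prod I₂)
      (fun z : E₁ × E₂ => ((extChartAt I₁ x).symm z.1, (extChartAt I₂ y).symm z.2)) (s, t) (u, w) =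
      (dmap 𝓘(ℝ, E₁) I₁ (extChartAt I₁ x).symm s u,
        dmap 𝓘(ℝ, E₂) I₂ (extChartAt I₂ y).symm t w) := by
  have h1 : MDifferentiableAt 𝓘(ℝ, E₁) I₁ (extChartAt I₁ x).symm s :=
    (contMDiffAt_extChartAt_symm' hs).mdifferentiableAt (by simp)
  have h2 : MDifferentiableAt 𝓘(ℝ, E₂) I₂ (extChartAt I₂ y).symm t :=
    (contMDiffAt_extChartAt_symm' ht).mdifferentiableAt (by simp)
  have hfst : MDifferentiableAt 𝓘(ℝ, E₁ × E₂) 𝓘(ℝ, E₁) (Prod.fst : E₁ × E₂ → E₁) (s, t) :=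
    differentiableAt_fst.mdifferentiableAt
  have hsnd : MDifferentiableAt 𝓘(ℝ, E₁ × E₂) 𝓘(ℝ, E₂) (Prod.snd : E₁ × E₂ → E₂) (s, t) :=
    differentiableAt_snd.mdifferentiableAt
  refine (DFunLike.congr_fun (dmap_prodMk (f := fun z : E₁ × E₂ => (extChartAt I₁ x).symm z.1)
    (g := fun z : E₁ × E₂ => (extChartAt I₂ y).symm z.2) (MDifferentiableAt.comp (s, t) h1 hfst)
    (MDifferentiableAt.comp (s, t) h2 hsnd)) (u, w)).trans ?_
  refine Prod.ext ?_ ?_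
  · refine (dmap_comp_apply (g := (extChartAt I₁ x).symm) (f := (Prod.fst : E₁ × E₂ → E₁))
      h1 hfst (u, w)).trans ?_
    rw [dmap_eq_fderiv, fderiv_fst]
    rfl
  · refine (dmap_comp_apply (g := (extChartAt I₂ y).symm) (f := (Prod.snd : E₁ × E₂ → E₂))
      h2 hsnd (u, w)).trans ?_
    rw [dmap_eq_fderiv, fderiv_snd]
    rfl

/-- The exterior derivative of the pull-back of a one-form to a product, on vectors tangent to
different factors. -/
theorem OneForm.IsSmooth.dval_prod {α : OneForm I N F} (hα : α.IsSmooth) {f : M₁ × M₂ → N}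
    (hf : ContMDiff (I₁.prod I₂) I ∞ f) (x : M₁) (y : M₂) (u : E₁) (w : E₂) :
    α.dval (f (x, y)) (dmap (I₁.prod I₂) I f (x, y) (u, 0))
        (dmap (I₁.prod I₂) I f (x, y) (0, w)) =
      dmap I₁ 𝓘(ℝ, F) (fun x' => α.val (f (x', y)) (dmap (I₁.prod I₂) I f (x', y) (0, w))) x u -
      dmap I₂ 𝓘(ℝ, F) (fun y' => α.val (f (x, y')) (dmap (I₁.prod I₂) I f (x, y') (u, 0))) y w := by
  set c := extChartAt I₁ x with hc
  set e := extChartAt I₂ y with he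
  have hcx : c x ∈ c.target := mem_extChartAt_target x
  have hey : e y ∈ e.target := mem_extChartAt_target y
  have hcsy : c.symm (c x) = x := extChartAt_symm_self x
  have hesy : e.symm (e y) = y := extChartAt_symm_self y
  have hU : IsOpen (c.target ×ˢ e.target) :=
    (isOpen_extChartAt_target x).prod (isOpen_extChartAt_target y)
  -- the map `f` in charts of the two factors
  set Ψ : E₁ × E₂ → N := fun z => f (c.symm z.1, e.symm z.2) with hΨ
  have hΨs : ContMDiffOn 𝓘(ℝ, E₁ × E₂) I ∞ Ψ (c.target ×ˢ e.target) := by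
    refine hf.comp_contMDiffOn (ContMDiffOn.prodMk ?_ ?_)
    · exact (contMDiffOn_extChartAt_symm (n := ∞) x).comp contDiff_fst.contMDiff.contMDiffOn
        fun z hz => hz.1
    · exact (contMDiffOn_extChartAt_symm (n := ∞) y).comp contDiff_snd.contMDiff.contMDiffOn
        fun z hz => hz.2
  have hff : ∀ z, MDifferentiableAt (I₁.prod I₂) I f z := fun z =>
    hf.contMDiffAt.mdifferentiableAt (by simp)
  have hpull : ∀ s ∈ c.target, ∀ t ∈ e.target, ∀ u w,
      α.pullback Ψ (s, t) (u, w) = α.val (f (c.symm s, e.symm t))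
        (dmap (I₁.prod I₂) I f (c.symm s, e.symm t)
          (dmap 𝓘(ℝ, E₁) I₁ c.symm s u, dmap 𝓘(ℝ, E₂) I₂ e.symm t w)) := by
    intro s hs t ht u w
    have hcs : MDifferentiableAt 𝓘(ℝ, E₁ × E₂) (I₁.prod I₂)
        (fun z : E₁ × E₂ => (c.symm z.1, e.symm z.2)) (s, t) :=
      (MDifferentiableAt.comp (s, t) ((contMDiffAt_extChartAt_symm' hs).mdifferentiableAt (by simp))
        differentiableAt_fst.mdifferentiableAt).prodMk
      (MDifferentiableAt.comp (s, t) ((contMDiffAt_extChartAt_symm' ht).mdifferentiableAt (by simp))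
        differentiableAt_snd.mdifferentiableAt)
    rw [← dmap_prod_extChartAt_symm hs ht]
    exact congrArg (α.val (f (c.symm s, e.symm t))) (dmap_comp_apply (g := f)
      (f := fun z : E₁ × E₂ => (c.symm z.1, e.symm z.2)) (hff _) hcs (u, w))
  have hsm : DifferentiableAt ℝ (α.pullback Ψ) (c x, e y) :=
    ((hα.contDiffOn_pullback hU hΨs).contDiffAt (hU.mem_nhds ⟨hcx, hey⟩)).differentiableAt (by simp)
  have h := hα.d_pullback_of_eq (Ψ := Ψ) (x := (c x, e y)) (z := f (x, y))
    (Filter.eventually_of_mem (hU.mem_nhds ⟨hcx, hey⟩) fun z hz => hΨs.contMDiffAt (hU.mem_nhds hz))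
    (by simp only [hΨ, hcsy, hesy]) (u, 0) (0, w)
  have hdΨ : ∀ z : E₁ × E₂, dmap 𝓘(ℝ, E₁ × E₂) I Ψ (c x, e y) z =
      dmap (I₁.prod I₂) I f (x, y) z := by
    rintro ⟨u, w⟩
    have hcs : MDifferentiableAt 𝓘(ℝ, E₁ × E₂) (I₁.prod I₂)
        (fun z : E₁ × E₂ => (c.symm z.1, e.symm z.2)) (c x, e y) :=
      (MDifferentiableAt.comp (c x, e y) ((contMDiffAt_extChartAt_symm' hcx).mdifferentiableAt
        (by simp)) differentiableAt_fst.mdifferentiableAt).prodMk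
      (MDifferentiableAt.comp (c x, e y) ((contMDiffAt_extChartAt_symm' hey).mdifferentiableAt
        (by simp)) differentiableAt_snd.mdifferentiableAt)
    rw [hΨ, dmap_comp_apply (g := f) (f := fun z : E₁ × E₂ => (c.symm z.1, e.symm z.2)) (hff _) hcs,
      dmap_prod_extChartAt_symm hcx hey, dmap_extChartAt_symm_self, dmap_extChartAt_symm_self]
    simp only [hcsy, hesy]
    rfl
  change α.dval (f (x, y)) (dmap 𝓘(ℝ, E₁ × E₂) I Ψ (c x, e y) (u, 0))
    (dmap 𝓘(ℝ, E₁ × E₂) I Ψ (c x, e y) (0, w)) = _ at h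
  rw [hdΨ, hdΨ] at h
  rw [h]
  have hsmooth := hα.contMDiff_pullback_prod hf
  congr 1
  · have hdiff : MDifferentiableAt I₁ 𝓘(ℝ, F)
        (fun x' => α.val (f (x', y)) (dmap (I₁.prod I₂) I f (x', y) (0, w))) x := by
      have h0 : ContMDiff I₁ I₁.tangent ∞ (zeroSection E₁ (fun x : M₁ => TangentSpace I₁ x)) :=
        contMDiff_zeroSection ℝ _
      have h1 : ContMDiff I₁ I₂.tangent ∞ (fun _ : M₁ => (⟨y, w⟩ : TangentBundle I₂ M₂)) :=
        contMDiff_const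
      exact (hsmooth.comp (h0.prodMk h1)).contMDiffAt.mdifferentiableAt (by simp)
    have h1 := (hsm.hasFDerivAt.comp (c x) (f := fun s : E₁ => (s, e y))
      (hasFDerivAt_prodMk_left (c x) (e y))).clm_apply
        (hasFDerivAt_const ((0, w) : E₁ × E₂) (c x))
    have h6 := h1.fderiv
    simp only [Function.comp_def] at h6
    have h7 : (fun s : E₁ => α.pullback Ψ (s, e y) (0, w)) =ᶠ[nhds (c x)] fun s =>
        α.val (f (c.symm s, y)) (dmap (I₁.prod I₂) I f (c.symm s, y) (0, w)) := by
      filter_upwards [(isOpen_extChartAt_target (I := I₁) x).mem_nhds hcx] with s hs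
      rw [hpull s hs _ hey, dmap_extChartAt_symm_self, hesy, map_zero]
      rfl
    have h8 := h7.fderiv_eq (𝕜 := ℝ)
    rw [h6] at h8
    have h9 := DFunLike.congr_fun h8 u
    have h10 := dmap_comp_apply (I := 𝓘(ℝ, E₁)) (x := c x) (f := c.symm)
      (g := fun x' => α.val (f (x', y)) (dmap (I₁.prod I₂) I f (x', y) (0, w)))
      (by rw [hcsy]; exact hdiff) ((contMDiffAt_extChartAt_symm' hcx).mdifferentiableAt (by simp)) u
    rw [dmap_eq_fderiv, dmap_extChartAt_symm_self, hcsy] at h10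
    refine Eq.trans ?_ (h9.trans h10)
    simp
  · have hdiff : MDifferentiableAt I₂ 𝓘(ℝ, F)
        (fun y' => α.val (f (x, y')) (dmap (I₁.prod I₂) I f (x, y') (u, 0))) y := by
      have h0 : ContMDiff I₂ I₂.tangent ∞ (zeroSection E₂ (fun y : M₂ => TangentSpace I₂ y)) :=
        contMDiff_zeroSection ℝ _
      have h1 : ContMDiff I₂ I₁.tangent ∞ (fun _ : M₂ => (⟨x, u⟩ : TangentBundle I₁ M₁)) :=
        contMDiff_const
      exact (hsmooth.comp (h1.prodMk h0)).contMDiffAt.mdifferentiableAt (by simp)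
    have h1 := (hsm.hasFDerivAt.comp (e y) (f := fun t : E₂ => (c x, t))
      (hasFDerivAt_prodMk_right (c x) (e y))).clm_apply
        (hasFDerivAt_const ((u, 0) : E₁ × E₂) (e y))
    have h6 := h1.fderiv
    simp only [Function.comp_def] at h6
    have h7 : (fun t : E₂ => α.pullback Ψ (c x, t) (u, 0)) =ᶠ[nhds (e y)] fun t =>
        α.val (f (x, e.symm t)) (dmap (I₁.prod I₂) I f (x, e.symm t) (u, 0)) := by
      filter_upwards [(isOpen_extChartAt_target (I := I₂) y).mem_nhds hey] with t ht
      rw [hpull _ hcx t ht, dmap_extChartAt_symm_self, hcsy, map_zero]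
      rfl
    have h8 := h7.fderiv_eq (𝕜 := ℝ)
    rw [h6] at h8
    have h9 := DFunLike.congr_fun h8 w
    have h10 := dmap_comp_apply (I := 𝓘(ℝ, E₂)) (x := e y) (f := e.symm)
      (g := fun y' => α.val (f (x, y')) (dmap (I₁.prod I₂) I f (x, y') (u, 0)))
      (by rw [hesy]; exact hdiff) ((contMDiffAt_extChartAt_symm' hey).mdifferentiableAt (by simp)) w
    rw [dmap_eq_fderiv, dmap_extChartAt_symm_self, hesy] at h10
    refine Eq.trans ?_ (h9.trans h10)
    simp

theorem OneForm.IsSmooth.differentiableAt_inChart {α : OneForm I N F} (hα : α.IsSmooth) (x : N) :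
    DifferentiableAt ℝ (α.inChart x) (extChartAt I x x) :=
  ((hα.contDiffOn_pullback (isOpen_extChartAt_target x)
    (contMDiffOn_extChartAt_symm x)).contDiffAt ((isOpen_extChartAt_target x).mem_nhds
      (mem_extChartAt_target x))).differentiableAt (by simp)

/-- The exterior derivative of `T α + β`, where `T` is a function with values in linear maps, on
vectors on which `α` vanishes. -/
theorem OneForm.dval_clm_comp_add {α : OneForm I N F} (hα : α.IsSmooth) {β : OneForm I N F'}
    (hβ : β.IsSmooth) {T : N → F →L[ℝ] F'} {x : N}
    (hT : DifferentiableAt ℝ (fun s => T ((extChartAt I x).symm s)) (extChartAt I x x)) {u v : E}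
    (hu : α.val x u = 0) (hv : α.val x v = 0) :
    OneForm.dval (I := I) (fun y => (T y).comp (α.val y) + β.val y) x u v =
      T x (α.dval x u v) + β.dval x u v := by
  set c := extChartAt I x with hc
  have : IsManifold I 1 N := IsManifold.of_le (n := ∞) (by simp)
  have e : OneForm.inChart (I := I) (fun y => (T y).comp (α.val y) + β.val y) x =
      fun s => (T (c.symm s)).comp (α.inChart x s) + β.inChart x s := by
    funext s
    ext1 w
    rfl
  have h1 := (hT.hasFDerivAt.clm_comp (hα.differentiableAt_inChart x).hasFDerivAt).add
    (hβ.differentiableAt_inChart x).hasFDerivAt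
  have hD : ∀ u v : E, α.val x v = 0 → fderiv ℝ (OneForm.inChart (I := I)
      (fun y => (T y).comp (α.val y) + β.val y) x) (c x) u v =
      T x (fderiv ℝ (α.inChart x) (c x) u v) + fderiv ℝ (β.inChart x) (c x) u v := by
    intro u v hv
    have h0 : α.inChart x (c x) v = 0 := (OneForm.inChart_self α x v).trans hv
    have hcs : c.symm (c x) = x := extChartAt_symm_self x
    have h2 := DFunLike.congr_fun (DFunLike.congr_fun h1.fderiv u) v
    rw [e]
    refine h2.trans ?_
    change (T (c.symm (c x)) (fderiv ℝ (α.inChart x) (c x) u v) + _) + _ = _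
    rw [hcs]
    refine congrArg (· + _) ((congrArg (_ + ·) ?_).trans (add_zero _))
    exact (congrArg (fderiv ℝ (fun s => T (c.symm s)) (c x) u) h0).trans (map_zero _)
  change fderiv ℝ (OneForm.inChart (I := I) (fun y => (T y).comp (α.val y) + β.val y) x) (c x) u v -
      fderiv ℝ (OneForm.inChart (I := I) (fun y => (T y).comp (α.val y) + β.val y) x) (c x) v u =
    T x (fderiv ℝ (α.inChart x) (c x) u v - fderiv ℝ (α.inChart x) (c x) v u) +
      (fderiv ℝ (β.inChart x) (c x) u v - fderiv ℝ (β.inChart x) (c x) v u)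
  rw [hD u v hv, hD v u hu, map_sub, add_sub_add_comm]

end ExteriorDerivative

/-! ### The curvature of `â + b̂` -/

section Curvature

variable {k : ℕ} {G : Type*} [TopologicalSpace G] [ChartedSpace (EuclideanSpace ℝ (Fin k)) G]
  [Group G]
  {P : Type*} [TopologicalSpace P] [ChartedSpace (EuclideanSpace ℝ (Fin (4 + k))) P]
  [IsManifold (𝓡 (4 + k)) ∞ P]
  {X : Type*} [TopologicalSpace X] [ChartedSpace (EuclideanSpace ℝ (Fin 4)) X]
  [IsManifold (𝓡 4) ∞ X]
  {g : Metric4 X} {o : ∀ x : X, Orientation ℝ (TangentSpace (𝓡 4) x) (Fin 4)}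
  {Q : Type*} [TopologicalSpace Q] [ChartedSpace (EuclideanSpace ℝ (Fin 10)) Q]
  [IsManifold (𝓡 10) ∞ Q]
  {S : SpinStructure g o Q} {PB : LiftedBundle k G P}

/-- The horizontal lift as a linear map. -/
noncomputable def LeviCivita.liftLin (L : LeviCivita S) (f : Q) :
    ℍ[ℝ] →ₗ[ℝ] EuclideanSpace ℝ (Fin 10) where
  toFun c := L.lift f c
  map_add' c c' := L.lift_add f c c'
  map_smul' r c := L.lift_smul f r c

theorem LeviCivita.φ_liftLin (L : LeviCivita S) (f : Q) (c : ℍ[ℝ]) :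
    L.φ.val f (L.liftLin f c) = 0 := (L.lift_spec f c).2.1

theorem LiftedBundle.form_hliftLin (a : PB.Conn) (p : P) (e : ℍ[ℝ]) :
    a.form.val p (hliftLin a p e) = 0 := (hlift_spec a p e).2

/-- The function `f ↦ (ξ ↦ a_f(K_ξ))` on `Q` with values in linear maps. -/
noncomputable def SectionA.killingForm (a : SectionA S PB) (p : P) (f : Q) : ℍ[ℝ] →L[ℝ] LieAlg k :=
  ((a.toFun f).form.val p).comp (LiftedBundle.killingLin PB p)

theorem SectionA.contMDiff_apply (a : SectionA S PB) (p : P)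
    (w : EuclideanSpace ℝ (Fin (4 + k))) :
    ContMDiff (𝓡 10) 𝓘(ℝ, LieAlg k) ∞ (fun f => (a.toFun f).form.val p w) :=
  a.smooth.comp (contMDiff_id.prodMk
    (contMDiff_const (c := (⟨p, w⟩ : TangentBundle (𝓡 (4 + k)) P))))

theorem SectionA.differentiableAt_killingForm (a : SectionA S PB) (p : P) (f : Q) :
    DifferentiableAt ℝ (fun s => a.killingForm p ((extChartAt (𝓡 10) f).symm s))
      (extChartAt (𝓡 10) f f) := by
  have h : ContDiffOn ℝ ∞ (fun s => a.killingForm p ((extChartAt (𝓡 10) f).symm s))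
      (extChartAt (𝓡 10) f).target :=
    contDiffOn_clm_apply.2 fun q => contMDiffOn_iff_contDiffOn.1
      ((a.contMDiff_apply p (LiftedBundle.killingLin PB p q)).comp_contMDiffOn
        (contMDiffOn_extChartAt_symm f))
  exact (h.contDiffAt ((isOpen_extChartAt_target f).mem_nhds
    (mem_extChartAt_target f))).differentiableAt (by simp)

/-- The restriction of `b ∈ Ω¹(X; 𝕃)` to a point of `P`, as a one-form on `Q`. -/
noncomputable def OneFormL.at (b : OneFormL S PB) (p : P) : OneForm (𝓡 10) Q (LieAlg k) :=
  fun f => b.toFun f p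

theorem OneFormL.isSmooth_at (b : OneFormL S PB) (p : P) : (b.at p).IsSmooth :=
  b.smooth.comp (contMDiff_id.prodMk contMDiff_const)

namespace ConnP

variable {A : ConnP S PB} {L : LeviCivita S} {a : SectionA S PB} {b : OneFormL S PB}

/-- The exterior derivative of the pull-back to `Q × P` of a connection on `ℙ`. -/
noncomputable def pullD (A : ConnP S PB) (f : Q) (p : P)
    (z z' : EuclideanSpace ℝ (Fin 10) × EuclideanSpace ℝ (Fin (4 + k))) : LieAlg k :=
  A.form.dval (Assoc.mk S.toPrincipalBundle PB.spinAct (f, p))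
    (dmap ((𝓡 10).prod (𝓡 (4 + k))) ((𝓡 4).prod (𝓡 (4 + k)))
      (Assoc.mk S.toPrincipalBundle PB.spinAct) (f, p) z)
    (dmap ((𝓡 10).prod (𝓡 (4 + k))) ((𝓡 4).prod (𝓡 (4 + k)))
      (Assoc.mk S.toPrincipalBundle PB.spinAct) (f, p) z')

theorem pullD_add_left (f : Q) (p : P)
    (z₁ z₂ z' : EuclideanSpace ℝ (Fin 10) × EuclideanSpace ℝ (Fin (4 + k))) :
    A.pullD f p (z₁ + z₂) z' = A.pullD f p z₁ z' + A.pullD f p z₂ z' := by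
  rw [pullD, map_add, OneForm.dval_add_left]; rfl

theorem pullD_swap (f : Q) (p : P)
    (z z' : EuclideanSpace ℝ (Fin 10) × EuclideanSpace ℝ (Fin (4 + k))) :
    A.pullD f p z z' = -A.pullD f p z' z := OneForm.dval_swap _ _ _ _

theorem pullD_smul_left (f : Q) (p : P) (r : ℝ)
    (z z' : EuclideanSpace ℝ (Fin 10) × EuclideanSpace ℝ (Fin (4 + k))) :
    A.pullD f p (r • z) z' = r • A.pullD f p z z' := by
  rw [pullD, map_smul, OneForm.dval_smul_left]; rfl

theorem pull_zero_left (h : IsSum L A a b) (f : Q) (p : P) (w : EuclideanSpace ℝ (Fin (4 + k))) :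
    A.pull f p (0, w) = (a.toFun f).form.val p w := by
  have h1 := (A.isSum_iff L a b).1 h f p 0 w
  rwa [map_zero, map_zero, map_zero, add_zero, add_zero] at h1

/-- On the fibre of `ℙ → X` over `π f`, the connection restricts to `a_f`. -/
theorem pullD_fibre (h : IsSum L A a b) (f : Q) (p : P)
    (w w' : EuclideanSpace ℝ (Fin (4 + k))) :
    A.pullD f p (0, w) (0, w') = (a.toFun f).form.dval p w w' := by
  have hm : ContMDiff (𝓡 (4 + k)) ((𝓡 4).prod (𝓡 (4 + k))) ∞
      (fun p => Assoc.mk S.toPrincipalBundle PB.spinAct (f, p)) :=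
    (Assoc.contMDiff_mk S.toPrincipalBundle PB.spinAct).comp (contMDiff_const.prodMk contMDiff_id)
  have e := A.smooth.dval_dmap hm p w w'
  have hc : A.form.comap (I₁ := 𝓡 (4 + k))
      (fun p => Assoc.mk S.toPrincipalBundle PB.spinAct (f, p)) = (a.toFun f).form := by
    funext p
    ext1 w
    refine Eq.trans ?_ (pull_zero_left h f p w)
    exact congrArg (A.form.val _) (dmap_prod_right (mdifferentiableAt_mkP (f, p)) w).symm
  rw [hc] at e
  rw [← e, pullD, dmap_prod_right (mdifferentiableAt_mkP (f, p)),
    dmap_prod_right (mdifferentiableAt_mkP (f, p))]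

/-- Along `Q × {p}` the connection is the form `v ↦ a(K_{φ(v)}) + b(v)`; on vectors on which `φ`
vanishes, the derivative of `a` does not contribute. -/
theorem pullD_base (h : IsSum L A a b) (f : Q) (p : P) {v v' : EuclideanSpace ℝ (Fin 10)}
    (hv : L.φ.val f v = 0) (hv' : L.φ.val f v' = 0) :
    A.pullD f p (v, 0) (v', 0) =
      (a.toFun f).form.val p (LiftedBundle.killingLin PB p (L.φ.dval f v v')) +
        (b.at p).dval f v v' := by
  have hm : ContMDiff (𝓡 10) ((𝓡 4).prod (𝓡 (4 + k))) ∞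
      (fun f => Assoc.mk S.toPrincipalBundle PB.spinAct (f, p)) :=
    (Assoc.contMDiff_mk S.toPrincipalBundle PB.spinAct).comp (contMDiff_id.prodMk contMDiff_const)
  have e := A.smooth.dval_dmap hm f v v'
  have hc : A.form.comap (I₁ := 𝓡 10)
      (fun f => Assoc.mk S.toPrincipalBundle PB.spinAct (f, p)) =
      fun f => (a.killingForm p f).comp (L.φ.val f) + (b.at p).val f := by
    funext f
    ext1 v
    have h1 := (A.isSum_iff L a b).1 h f p v 0
    rw [zero_add] at h1
    refine Eq.trans ?_ h1
    exact congrArg (A.form.val _) (dmap_prod_left (mdifferentiableAt_mkP (f, p)) v).symm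
  rw [hc, OneForm.dval_clm_comp_add L.smooth_φ (b.isSmooth_at p)
    (a.differentiableAt_killingForm p f) hv hv'] at e
  rw [pullD, dmap_prod_left (mdifferentiableAt_mkP (f, p)),
    dmap_prod_left (mdifferentiableAt_mkP (f, p)), e]
  rfl

/-- On vectors tangent to different factors of `Q × P`, only the cross derivatives contribute. -/
theorem pullD_mixed (h : IsSum L A a b) (f : Q) (p : P) (v : EuclideanSpace ℝ (Fin 10))
    (hv : L.φ.val f v = 0) (w : EuclideanSpace ℝ (Fin (4 + k))) :
    A.pullD f p (v, 0) (0, w) =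
      dmap (𝓡 10) 𝓘(ℝ, LieAlg k) (fun f' => (a.toFun f').form.val p w) f v -
        dmap (𝓡 (4 + k)) 𝓘(ℝ, LieAlg k) (fun p' => b.val f p' v) p w := by
  have e := A.smooth.dval_prod (Assoc.contMDiff_mk S.toPrincipalBundle PB.spinAct) f p v w
  refine e.trans ?_
  have h1 : ∀ f' : Q, A.pull f' p (0, w) = (a.toFun f').form.val p w :=
    fun f' => pull_zero_left h f' p w
  have h2 : ∀ p' : P, A.pull f p' (v, 0) = b.val f p' v := by
    intro p'
    have h2 := (A.isSum_iff L a b).1 h f p' v 0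
    rwa [hv, map_zero, zero_add, map_zero, zero_add] at h2
  rw [← funext h1, ← funext h2]
  rfl

/-- The curvature of a connection on `ℙ`, pulled back to `Q × P` and evaluated on the horizontal
lift of `(c, e)` to `T_f Q × T_p P`. -/
noncomputable def liftedCurv (A : ConnP S PB) (L : LeviCivita S) (a : SectionA S PB) (f : Q) (p : P)
    (s t : ℍ[ℝ] × ℍ[ℝ]) : LieAlg k :=
  A.pullD f p (L.liftLin f s.1, LiftedBundle.hliftLin (a.toFun f) p s.2)
      (L.liftLin f t.1, LiftedBundle.hliftLin (a.toFun f) p t.2) +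
    lieBr G (A.pull f p (L.liftLin f s.1, LiftedBundle.hliftLin (a.toFun f) p s.2))
      (A.pull f p (L.liftLin f t.1, LiftedBundle.hliftLin (a.toFun f) p t.2))

theorem pull_lift (h : IsSum L A a b) (f : Q) (p : P) (c e : ℍ[ℝ]) :
    A.pull f p (L.liftLin f c, LiftedBundle.hliftLin (a.toFun f) p e) =
      b.val f p (L.liftLin f c) := by
  rw [(A.isSum_iff L a b).1 h f p, L.φ_liftLin, map_zero, add_zero, LiftedBundle.form_hliftLin,
    zero_add]

/-- The component of the curvature along `X` is `F_b + ι_Φ a`. -/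
theorem liftedCurv_base (h : IsSum L A a b) (f : Q) (p : P) (c c' : ℍ[ℝ]) :
    A.liftedCurv L a f p (c, 0) (c', 0) = iotaPhi L a f p c c' + curvB L b f p c c' := by
  have hΦ : L.Phi f c c' = L.φ.dval f (L.liftLin f c) (L.liftLin f c') := by
    rw [LeviCivita.Phi, (L.lift_spec f c).2.1, (L.lift_spec f c').2.1, zero_mul, sub_zero, add_zero]
    rfl
  have hι : iotaPhi L a f p c c' = (a.toFun f).form.val p
      (LiftedBundle.killingLin PB p (L.φ.dval f (L.liftLin f c) (L.liftLin f c'))) := by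
    rw [← hΦ]
    exact congrArg ((a.toFun f).form.val p) (killing_eq_killingLin _ p)
  rw [liftedCurv, pull_lift h, pull_lift h, map_zero,
    pullD_base h f p (L.φ_liftLin f c) (L.φ_liftLin f c'), hι, add_assoc]
  rfl

variable [LieGroup (𝓡 k) ∞ G]

theorem lieBr_zero_left (x : LieAlg k) : lieBr G 0 x = 0 := by
  simpa using lieBr_smul_left (G := G) 0 x x

theorem lieBr_zero_right (x : LieAlg k) : lieBr G x 0 = 0 := by
  simpa using lieBr_smul_right (G := G) 0 x x

/-- The component of the curvature along `ℝ⁴` is the curvature of `a`. -/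
theorem liftedCurv_fibre (h : IsSum L A a b) (f : Q) (p : P) (e e' : ℍ[ℝ]) :
    A.liftedCurv L a f p (0, e) (0, e') = LiftedBundle.curv (a.toFun f) p e e' := by
  rw [liftedCurv, pull_lift h, pull_lift h, map_zero, map_zero, pullD_fibre h]
  refine congrArg (fun x : LieAlg k => (a.toFun f).form.dval p _ _ + x) ?_
  change _ = lieBr G ((a.toFun f).form.val p (LiftedBundle.hliftLin (a.toFun f) p e)) _
  rw [LiftedBundle.form_hliftLin, lieBr_zero_left, lieBr_zero_left]

/-- The mixed component of the curvature is `∇ᴮ a`. -/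
theorem liftedCurv_mixed (h : IsSum L A a b) (f : Q) (p : P) (c e : ℍ[ℝ]) :
    A.liftedCurv L a f p (c, 0) (0, e) = nablaB L a b f p c e := by
  have hn : nablaB L a b f p c e =
      dmap (𝓡 10) 𝓘(ℝ, LieAlg k) (fun f' => (a.toFun f').form.val p
        (LiftedBundle.hliftLin (a.toFun f) p e)) f (L.liftLin f c) -
      (dmap (𝓡 (4 + k)) 𝓘(ℝ, LieAlg k) (fun p' => b.val f p' (L.liftLin f c)) p
        (LiftedBundle.hliftLin (a.toFun f) p e) +
      lieBr G ((a.toFun f).form.val p (LiftedBundle.hliftLin (a.toFun f) p e))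
        (b.val f p (L.liftLin f c))) := rfl
  rw [hn, liftedCurv, pull_lift h, pull_lift h, map_zero, map_zero, map_zero,
    pullD_mixed h f p _ (L.φ_liftLin f c), LiftedBundle.form_hliftLin, lieBr_zero_left,
    lieBr_zero_right, add_zero, add_zero]

theorem liftedCurv_swap (f : Q) (p : P) (s t : ℍ[ℝ] × ℍ[ℝ]) :
    A.liftedCurv L a f p s t = -A.liftedCurv L a f p t s := by
  rw [liftedCurv, pullD_swap, lieBr_skew, ← neg_add]; rfl

theorem liftedCurv_add_left (f : Q) (p : P) (s s' t : ℍ[ℝ] × ℍ[ℝ]) :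
    A.liftedCurv L a f p (s + s') t = A.liftedCurv L a f p s t + A.liftedCurv L a f p s' t := by
  simp only [liftedCurv, Prod.fst_add, Prod.snd_add, map_add, ← Prod.mk_add_mk, pullD_add_left,
    lieBr_add_left]
  exact add_add_add_comm _ _ _ _

theorem liftedCurv_smul_left (f : Q) (p : P) (r : ℝ) (s t : ℍ[ℝ] × ℍ[ℝ]) :
    A.liftedCurv L a f p (r • s) t = r • A.liftedCurv L a f p s t := by
  simp only [liftedCurv, Prod.smul_fst, Prod.smul_snd, map_smul, ← Prod.smul_mk, pullD_smul_left,
    lieBr_smul_left, smul_add]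

/-- The curvature on horizontal lifts, as a bilinear map. -/
noncomputable def liftedCurvLin (A : ConnP S PB) (L : LeviCivita S) (a : SectionA S PB) (f : Q)
    (p : P) : ℍ[ℝ] × ℍ[ℝ] →ₗ[ℝ] ℍ[ℝ] × ℍ[ℝ] →ₗ[ℝ] LieAlg k :=
  LinearMap.mk₂ ℝ (A.liftedCurv L a f p) (liftedCurv_add_left f p) (liftedCurv_smul_left f p)
    (fun s t t' => by
      rw [liftedCurv_swap, liftedCurv_add_left, neg_add, ← liftedCurv_swap, ← liftedCurv_swap])
    (fun r s t => by
      rw [liftedCurv_swap, liftedCurv_smul_left, ← smul_neg, ← liftedCurv_swap])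

theorem liftedCurvLin_apply (f : Q) (p : P) (s t : ℍ[ℝ] × ℍ[ℝ]) :
    A.liftedCurvLin L a f p s t = A.liftedCurv L a f p s t := rfl

theorem liftedCurvLin_self (f : Q) (p : P) (s : ℍ[ℝ] × ℍ[ℝ]) :
    A.liftedCurvLin L a f p s s = 0 := by
  have h := eq_neg_iff_add_eq_zero.1 (liftedCurv_swap (A := A) (L := L) (a := a) f p s s)
  rw [← two_smul ℝ] at h
  exact (smul_eq_zero.1 h).resolve_left two_ne_zero

end ConnP

end Curvature

/-! ### The coframes of the `Spin(7)`-structure and anti-self-duality -/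

section Coframe

variable {k : ℕ} {G : Type*} [TopologicalSpace G] [ChartedSpace (EuclideanSpace ℝ (Fin k)) G]
  [Group G]
  {P : Type*} [TopologicalSpace P] [ChartedSpace (EuclideanSpace ℝ (Fin (4 + k))) P]
  [IsManifold (𝓡 (4 + k)) ∞ P]
  {X : Type*} [TopologicalSpace X] [ChartedSpace (EuclideanSpace ℝ (Fin 4)) X]
  [IsManifold (𝓡 4) ∞ X]
  {g : Metric4 X} {o : ∀ x : X, Orientation ℝ (TangentSpace (𝓡 4) x) (Fin 4)}
  {Q : Type*} [TopologicalSpace Q] [ChartedSpace (EuclideanSpace ℝ (Fin 10)) Q]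
  [IsManifold (𝓡 10) ∞ Q]
  {S : SpinStructure g o Q} {PB : LiftedBundle k G P}

/-- The differential of the quotient map `Q × ℍ → 𝕎⁺`. -/
noncomputable def SpinStructure.dmkW (S : SpinStructure g o Q) (f : Q) (x : ℍ[ℝ]) :
    EuclideanSpace ℝ (Fin 10) × ℍ[ℝ] →L[ℝ] EuclideanSpace ℝ (Fin 4) × ℍ[ℝ] :=
  dmap ((𝓡 10).prod 𝓘(ℝ, ℍ[ℝ])) ((𝓡 4).prod 𝓘(ℝ, ℍ[ℝ]))
    (Assoc.mk S.toPrincipalBundle spinRep) (f, x)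

/-- The differential of the quotient map `Q × P → ℙ`. -/
noncomputable def dmkP (S : SpinStructure g o Q) (PB : LiftedBundle k G P) (f : Q) (p : P) :
    EuclideanSpace ℝ (Fin 10) × EuclideanSpace ℝ (Fin (4 + k)) →L[ℝ]
      EuclideanSpace ℝ (Fin 4) × EuclideanSpace ℝ (Fin (4 + k)) :=
  dmap ((𝓡 10).prod (𝓡 (4 + k))) ((𝓡 4).prod (𝓡 (4 + k)))
    (Assoc.mk S.toPrincipalBundle PB.spinAct) (f, p)

/-- The differential of the projection `ℙ → 𝕎⁺` at `[f, p]`. -/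
noncomputable def dprojP (S : SpinStructure g o Q) (PB : LiftedBundle k G P) (f : Q) (p : P) :
    EuclideanSpace ℝ (Fin 4) × EuclideanSpace ℝ (Fin (4 + k)) →L[ℝ]
      EuclideanSpace ℝ (Fin 4) × ℍ[ℝ] :=
  dmap ((𝓡 4).prod (𝓡 (4 + k))) ((𝓡 4).prod 𝓘(ℝ, ℍ[ℝ])) (projP S PB) (mkP S PB f p)

/-- The fundamental vector field, with values in the model vector space. -/
noncomputable def SpinStructure.fundVal (S : SpinStructure g o Q) (f : Q) (ξ ζ : ℍ[ℝ]) :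
    EuclideanSpace ℝ (Fin 10) := S.fund f ξ ζ

theorem LeviCivita.eq_liftLin_add_fundVal (L : LeviCivita S) (f : Q)
    (v : EuclideanSpace ℝ (Fin 10)) :
    v = L.liftLin f (S.theta.val f v) + S.fundVal f (L.φ.val f v) (L.ψ.val f v) :=
  L.eq_lift_add_fund f v

theorem SpinStructure.dmkW_fundVal (f : Q) (x ξ ζ : ℍ[ℝ]) :
    S.dmkW f x (S.fundVal f ξ ζ, 0) = S.dmkW f x (0, ξ.im * x) := by
  have h := Assoc.dmap_mk_fund S.toPrincipalBundle spinRep f x (mdifferentiableAt_expSpin4 ξ ζ)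
    (expSpin4_zero ξ ζ)
  refine h.trans (congrArg (S.dmkW f x) (Prod.ext rfl ?_))
  have h2 : MDifferentiableAt 𝓘(ℝ, ℝ) 𝓘(ℝ, ℍ[ℝ]) (fun t : ℝ => ((expSp1 (t • ξ) : Sp1) : ℍ[ℝ])) 0 :=
    MDifferentiableAt.comp (0 : ℝ) (g := fun q : Sp1 => (q : ℍ[ℝ]))
      ((contMDiff_coe_sphere (m := ∞)).contMDiffAt.mdifferentiableAt (by simp))
      (mdifferentiableAt_expSp1_smul ξ)
  have h3 := fderiv_coe_expSp1 ξ
  change dmap 𝓘(ℝ, ℝ) 𝓘(ℝ, ℍ[ℝ]) (fun t : ℝ => ((expSp1 (t • ξ) : Sp1) : ℍ[ℝ]) * x) 0 1 = _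
  rw [dmap_eq_fderiv] at h3 ⊢
  rw [(h2.differentiableAt.hasFDerivAt.mul_const' x).fderiv]
  simp [h3]

/-- The differential of the quotient map `Q × ℍ → 𝕎⁺` factors through `(θ, η)`. -/
theorem LeviCivita.dmkW_eq (L : LeviCivita S) (f : Q) (x : ℍ[ℝ]) (v : EuclideanSpace ℝ (Fin 10))
    (y : ℍ[ℝ]) :
    S.dmkW f x (v, y) = S.dmkW f x (L.liftLin f (S.theta.val f v), y + L.φ.val f v * x) := by
  have h1 := S.dmkW_fundVal f x (L.φ.val f v) (L.ψ.val f v)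
  have h2 : (L.φ.val f v).im = L.φ.val f v := L.im_φ f v
  rw [h2] at h1
  have h3 := L.eq_liftLin_add_fundVal f v
  have h4 : (v, y) = (L.liftLin f (S.theta.val f v), y) +
      ((S.fundVal f (L.φ.val f v) (L.ψ.val f v), 0) : EuclideanSpace ℝ (Fin 10) × ℍ[ℝ]) :=
    Prod.ext h3 (add_zero y).symm
  have h5 : (L.liftLin f (S.theta.val f v), y + L.φ.val f v * x) =
      (L.liftLin f (S.theta.val f v), y) +
      ((0, L.φ.val f v * x) : EuclideanSpace ℝ (Fin 10) × ℍ[ℝ]) :=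
    Prod.ext (add_zero _).symm rfl
  rw [h5, map_add, ← h1, ← map_add, ← h4]

/-- The coframe defined by a point of `Q × ℍ` exists: `(θ, η)` has the same kernel as the
differential of the quotient map `Q × ℍ → 𝕎⁺`. -/
theorem LeviCivita.exists_isCoframe (L : LeviCivita S) (f : Q) (x : ℍ[ℝ]) :
    ∃ u, L.IsCoframe f x u := by
  let j : ℍ[ℝ] × ℍ[ℝ] →ₗ[ℝ] EuclideanSpace ℝ (Fin 4) × ℍ[ℝ] :=
    (S.dmkW f x).toLinearMap ∘ₗ ((L.liftLin f).prodMap LinearMap.id)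
  have hj : Function.Surjective j := by
    intro z
    obtain ⟨⟨v, y⟩, hz⟩ := Assoc.surjective_mfderiv_mk S.toPrincipalBundle spinRep (f, x) z
    exact ⟨(S.theta.val f v, y + L.φ.val f v * x), (L.dmkW_eq f x v y).symm.trans hz⟩
  have hd : Module.finrank ℝ (ℍ[ℝ] × ℍ[ℝ]) =
      Module.finrank ℝ (EuclideanSpace ℝ (Fin 4) × ℍ[ℝ]) := by
    simp [Module.finrank_prod, Quaternion.finrank_eq_four]
  have hb : Function.Bijective j :=
    ⟨(LinearMap.injective_iff_surjective_of_finrank_eq_finrank hd).2 hj, hj⟩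
  let J : (ℍ[ℝ] × ℍ[ℝ]) ≃L[ℝ] EuclideanSpace ℝ (Fin 4) × ℍ[ℝ] :=
    (LinearEquiv.ofBijective j hb).toContinuousLinearEquiv
  exact ⟨J.symm, fun v y => (congrArg J.symm (L.dmkW_eq f x v y)).trans
    (J.symm_apply_apply (S.theta.val f v, y + L.φ.val f v * x))⟩

theorem dprojP_dmkP (f : Q) (p : P) (v : EuclideanSpace ℝ (Fin 10))
    (w : EuclideanSpace ℝ (Fin (4 + k))) :
    dprojP S PB f p (dmkP S PB f p (v, w)) =
      S.dmkW f (PB.proj p) (v, dmap (𝓡 (4 + k)) 𝓘(ℝ, ℍ[ℝ]) PB.proj p w) := by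
  have hp : MDifferentiableAt (𝓡 (4 + k)) 𝓘(ℝ, ℍ[ℝ]) PB.proj p :=
    PB.contMDiff_proj.contMDiffAt.mdifferentiableAt (by simp)
  have hp' : MDifferentiableAt ((𝓡 10).prod (𝓡 (4 + k))) 𝓘(ℝ, ℍ[ℝ])
      (fun z : Q × P => PB.proj z.2) (f, p) :=
    MDifferentiableAt.comp (f, p) (g := PB.proj) (f := fun z : Q × P => z.2) hp
      (mdifferentiableAt_snd (I := 𝓡 10))
  have e1 := dmap_comp_apply (g := projP S PB) (f := Assoc.mk S.toPrincipalBundle PB.spinAct)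
    (contMDiff_projP.contMDiffAt.mdifferentiableAt (by simp)) (mdifferentiableAt_mkP (f, p)) (v, w)
  have hf : MDifferentiableAt ((𝓡 10).prod (𝓡 (4 + k))) (𝓡 10) (fun z : Q × P => z.1) (f, p) :=
    mdifferentiableAt_fst
  have hs : MDifferentiableAt ((𝓡 10).prod (𝓡 (4 + k))) (𝓡 (4 + k)) (fun z : Q × P => z.2) (f, p) :=
    mdifferentiableAt_snd
  have e2 := dmap_comp_apply (I := (𝓡 10).prod (𝓡 (4 + k))) (I' := (𝓡 10).prod 𝓘(ℝ, ℍ[ℝ]))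
    (I'' := (𝓡 4).prod 𝓘(ℝ, ℍ[ℝ])) (g := Assoc.mk S.toPrincipalBundle spinRep)
    (f := fun z : Q × P => (z.1, PB.proj z.2)) (x := (f, p))
    ((Assoc.contMDiff_mk S.toPrincipalBundle spinRep).contMDiffAt.mdifferentiableAt (by simp))
    (hf.prodMk hp') (v, w)
  have e3 := dmap_comp_apply (g := PB.proj) (f := fun z : Q × P => z.2) (x := (f, p))
    hp hs (v, w)
  refine e1.symm.trans (e2.trans ?_)
  refine congrArg (S.dmkW f (PB.proj p)) ?_
  rw [dmap_prodMk hf hp']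
  refine Prod.ext ?_ ?_
  · exact DFunLike.congr_fun (mfderiv_fst (I := 𝓡 10) (I' := 𝓡 (4 + k)) (x := (f, p))) (v, w)
  · refine e3.trans (congrArg (dmap (𝓡 (4 + k)) 𝓘(ℝ, ℍ[ℝ]) PB.proj p) ?_)
    exact DFunLike.congr_fun (mfderiv_snd (I := 𝓡 10) (I' := 𝓡 (4 + k)) (x := (f, p))) (v, w)

/-- The horizontal lift of `(c, e) ∈ ℍ ⊕ ℍ ≅ T 𝕎⁺` to the tangent space of `ℙ` at `[f, p]`. -/
noncomputable def horizontalLift (L : LeviCivita S) (a : SectionA S PB) (f : Q) (p : P)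
    (s : ℍ[ℝ] × ℍ[ℝ]) : EuclideanSpace ℝ (Fin 4) × EuclideanSpace ℝ (Fin (4 + k)) :=
  dmkP S PB f p (L.liftLin f s.1, LiftedBundle.hliftLin (a.toFun f) p s.2)

section

variable {L : LeviCivita S} {f : Q} {p : P}
  {u : (EuclideanSpace ℝ (Fin 4) × ℍ[ℝ]) ≃L[ℝ] ℍ[ℝ] × ℍ[ℝ]}

/-- The pull-back to `Q × P` of the coframe of `𝕎⁺`. -/
theorem coframe_dmkP (hu : L.IsCoframe f (PB.proj p) u) (v : EuclideanSpace ℝ (Fin 10))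
    (w : EuclideanSpace ℝ (Fin (4 + k))) :
    u (dprojP S PB f p (dmkP S PB f p (v, w))) = (S.theta.val f v,
      dmap (𝓡 (4 + k)) 𝓘(ℝ, ℍ[ℝ]) PB.proj p w + L.φ.val f v * PB.proj p) := by
  rw [dprojP_dmkP]
  exact hu v _

theorem coframe_horizontalLift (hu : L.IsCoframe f (PB.proj p) u) (a : SectionA S PB)
    (s : ℍ[ℝ] × ℍ[ℝ]) : u (dprojP S PB f p (horizontalLift L a f p s)) = s := by
  rw [horizontalLift, coframe_dmkP hu, L.φ_liftLin, zero_mul, add_zero]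
  exact Prod.ext (L.lift_spec f s.1).1 (LiftedBundle.hlift_spec (a.toFun f) p s.2).1

/-- The fundamental vectors of `P` are mapped to those of `ℙ`. -/
theorem dmkP_fundamental (f : Q) (p : P) (ξ : LieAlg k) :
    dmkP S PB f p (0, dmap (𝓡 k) (𝓡 (4 + k)) (fun c => PB.act p c) 1 ξ) =
      dmap (𝓡 k) ((𝓡 4).prod (𝓡 (4 + k))) (fun c => actP S PB (mkP S PB f p) c) 1 ξ := by
  have h2 : MDifferentiableAt (𝓡 k) (𝓡 (4 + k)) (fun c => PB.act p c) 1 :=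
    (PB.toPrincipalBundle.contMDiff_act_left p).contMDiffAt.mdifferentiableAt (by simp)
  have e2 := dmap_comp_apply (g := Assoc.mk S.toPrincipalBundle PB.spinAct)
    (f := fun c : G => (f, PB.act p c)) (mdifferentiableAt_mkP _)
    (mdifferentiableAt_const.prodMk h2) ξ
  rw [dmap_prodMk mdifferentiableAt_const h2, dmap_const, PB.act_one] at e2
  exact e2.symm

/-- Every tangent vector of `ℙ` is the sum of a horizontal lift and a vertical vector. -/
theorem exists_eq_horizontalLift_add (hu : L.IsCoframe f (PB.proj p) u) (a : SectionA S PB)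
    (V : EuclideanSpace ℝ (Fin 4) × EuclideanSpace ℝ (Fin (4 + k))) :
    ∃ ξ : LieAlg k, V = horizontalLift L a f p (u (dprojP S PB f p V)) +
      dmap (𝓡 k) ((𝓡 4).prod (𝓡 (4 + k))) (fun c => actP S PB (mkP S PB f p) c) 1 ξ := by
  obtain ⟨⟨v, w⟩, hV⟩ : ∃ z, dmkP S PB f p z = V :=
    Assoc.surjective_mfderiv_mk S.toPrincipalBundle PB.spinAct (f, p) V
  subst hV
  rw [coframe_dmkP hu, horizontalLift]
  have h1 : dmkP S PB f p (S.fundVal f (L.φ.val f v) (L.ψ.val f v), 0) =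
      dmkP S PB f p (0, LiftedBundle.killingLin PB p (L.φ.val f v)) :=
    (Assoc.dmap_mk_fund S.toPrincipalBundle PB.spinAct f p
      (mdifferentiableAt_expSpin4 (L.φ.val f v) (L.ψ.val f v)) (expSpin4_zero _ _)).trans
      (congrArg (fun K : EuclideanSpace ℝ (Fin (4 + k)) => dmkP S PB f p (0, K))
        (killing_eq_killingLin (PB := PB) (L.φ.val f v) p))
  have hK : dmap (𝓡 (4 + k)) 𝓘(ℝ, ℍ[ℝ]) PB.proj p (LiftedBundle.killingLin PB p (L.φ.val f v)) =
      L.φ.val f v * PB.proj p :=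
    (congrArg (dmap (𝓡 (4 + k)) 𝓘(ℝ, ℍ[ℝ]) PB.proj p)
      (killing_eq_killingLin (PB := PB) (L.φ.val f v) p).symm).trans
      ((LiftedBundle.dmap_proj_killing (PB := PB) (L.φ.val f v) p).trans
        (congrArg (· * PB.proj p) (L.im_φ f v)))
  generalize LiftedBundle.killingLin PB p (L.φ.val f v) = K at h1 hK
  have h3 := L.eq_liftLin_add_fundVal f v
  generalize S.fundVal f (L.φ.val f v) (L.ψ.val f v) = z at h1 h3
  refine ⟨(a.toFun f).form.val p (w + K), ?_⟩
  rw [← dmkP_fundamental, ← map_add, ← hK, ← map_add, Prod.mk_add_mk, add_zero,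
    ← LiftedBundle.eq_hlift_add_fundamental]
  have h4 : (v, w) = ((L.liftLin f (S.theta.val f v), w) + (z, 0) :
      EuclideanSpace ℝ (Fin 10) × EuclideanSpace ℝ (Fin (4 + k))) := by
    rw [Prod.mk_add_mk, add_zero, ← h3]
  have h5 : (L.liftLin f (S.theta.val f v), w + K) = ((L.liftLin f (S.theta.val f v), w) + (0, K) :
      EuclideanSpace ℝ (Fin 10) × EuclideanSpace ℝ (Fin (4 + k))) := by
    rw [Prod.mk_add_mk, add_zero]
  rw [h5, map_add, ← h1, ← map_add, ← h4]

end

/-! ### The curvature in a coframe -/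

namespace ConnP

variable (A : ConnP S PB)

/-- The curvature at `[f, p]`, with tangent vectors in the model vector space. -/
noncomputable def curvVal (f : Q) (p : P)
    (V V' : EuclideanSpace ℝ (Fin 4) × EuclideanSpace ℝ (Fin (4 + k))) : LieAlg k :=
  A.curvature (mkP S PB f p) V V'

theorem curvVal_eq (f : Q) (p : P)
    (V V' : EuclideanSpace ℝ (Fin 4) × EuclideanSpace ℝ (Fin (4 + k))) :
    A.curvVal f p V V' = A.form.dval (mkP S PB f p) V V' +
      lieBr G (A.form.val (mkP S PB f p) V) (A.form.val (mkP S PB f p) V') := rfl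

theorem curvVal_horizontalLift (L : LeviCivita S) (a : SectionA S PB) (f : Q) (p : P)
    (s t : ℍ[ℝ] × ℍ[ℝ]) :
    A.curvVal f p (horizontalLift L a f p s) (horizontalLift L a f p t) =
      A.liftedCurv L a f p s t := rfl

variable [LieGroup (𝓡 k) ∞ G]

theorem curvVal_add_left (f : Q) (p : P)
    (V₁ V₂ V' : EuclideanSpace ℝ (Fin 4) × EuclideanSpace ℝ (Fin (4 + k))) :
    A.curvVal f p (V₁ + V₂) V' = A.curvVal f p V₁ V' + A.curvVal f p V₂ V' := by
  simp only [curvVal_eq, OneForm.dval_add_left, map_add, lieBr_add_left]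
  exact add_add_add_comm _ _ _ _

theorem curvVal_swap (f : Q) (p : P)
    (V V' : EuclideanSpace ℝ (Fin 4) × EuclideanSpace ℝ (Fin (4 + k))) :
    A.curvVal f p V V' = -A.curvVal f p V' V := by
  rw [curvVal_eq, OneForm.dval_swap, lieBr_skew, ← neg_add]; rfl

theorem curvVal_vertical (f : Q) (p : P) (ξ : LieAlg k)
    (V : EuclideanSpace ℝ (Fin 4) × EuclideanSpace ℝ (Fin (4 + k))) :
    A.curvVal f p (dmap (𝓡 k) ((𝓡 4).prod (𝓡 (4 + k)))
      (fun c => actP S PB (mkP S PB f p) c) 1 ξ) V = 0 :=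
  A.curvature_vertical contMDiff_actP actP_one (mkP S PB f p) ξ V

/-- The curvature is the pull-back by the coframe of its values on horizontal lifts. -/
theorem curvVal_eq_liftedCurv {L : LeviCivita S} (a : SectionA S PB) {f : Q} {p : P}
    {u : (EuclideanSpace ℝ (Fin 4) × ℍ[ℝ]) ≃L[ℝ] ℍ[ℝ] × ℍ[ℝ]}
    (hu : L.IsCoframe f (PB.proj p) u)
    (V V' : EuclideanSpace ℝ (Fin 4) × EuclideanSpace ℝ (Fin (4 + k))) :
    A.curvVal f p V V' =
      A.liftedCurv L a f p (u (dprojP S PB f p V)) (u (dprojP S PB f p V')) := by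
  have h : ∀ V V', A.curvVal f p V V' =
      A.curvVal f p (horizontalLift L a f p (u (dprojP S PB f p V))) V' := by
    intro V V'
    obtain ⟨ξ, hξ⟩ := exists_eq_horizontalLift_add hu a V
    calc A.curvVal f p V V' = A.curvVal f p (horizontalLift L a f p (u (dprojP S PB f p V)) +
        dmap (𝓡 k) ((𝓡 4).prod (𝓡 (4 + k))) (fun c => actP S PB (mkP S PB f p) c) 1 ξ) V' :=
          congrArg (A.curvVal f p · V') hξ
      _ = _ := by rw [curvVal_add_left, curvVal_vertical, add_zero]
  rw [h, curvVal_swap, h, ← curvVal_swap, curvVal_horizontalLift]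

/-- Anti-self-duality is a condition on the values of the curvature on horizontal lifts. -/
theorem isASD_iff (L : LeviCivita S) (a : SectionA S PB) :
    IsASD L A ↔ ∀ (f : Q) (p : P) (s t : ℍ[ℝ] × ℍ[ℝ]),
      starCayley (A.liftedCurv L a f p) s t = -A.liftedCurv L a f p s t := by
  refine forall_congr' fun f => forall_congr' fun p => ⟨?_, fun h => ?_⟩
  · rintro ⟨u, hu, β, hβ, h⟩ s t
    have e : (fun s t => β s t) = A.liftedCurv L a f p := by
      funext s t
      have h1 : A.curvVal f p (horizontalLift L a f p s) (horizontalLift L a f p t) =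
        β (u (dprojP S PB f p (horizontalLift L a f p s)))
          (u (dprojP S PB f p (horizontalLift L a f p t))) :=
        hβ (horizontalLift L a f p s) (horizontalLift L a f p t)
      have h2 : ∀ s, u (dprojP S PB f p (horizontalLift L a f p s)) = s :=
        coframe_horizontalLift (u := u) hu a
      rw [h2, h2] at h1
      exact h1.symm
    rw [← e]
    exact h s t
  · obtain ⟨u, hu⟩ := L.exists_isCoframe f (PB.proj p)
    refine ⟨u, hu, LinearMap.toContinuousBilinearMap (A.liftedCurvLin L a f p), ?_, h⟩
    exact A.curvVal_eq_liftedCurv a hu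

end ConnP

end Coframe

/-! ### The equivalence with the Taubes-Pidstrygach equations -/

section Equivalence

theorem selfDual_add {V : Type*} [AddCommGroup V] [Module ℝ V] (B B' : ℍ[ℝ] → ℍ[ℝ] → V)
    (c c' : ℍ[ℝ]) :
    selfDual (fun c c' => B c c' + B' c c') c c' = selfDual B c c' + selfDual B' c c' := by
  simp only [selfDual, star2, smul_add, Finset.sum_add_distrib]
  abel

variable {k : ℕ} {G : Type*} [TopologicalSpace G] [ChartedSpace (EuclideanSpace ℝ (Fin k)) G]
  [Group G] [LieGroup (𝓡 k) ∞ G]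
  {P : Type*} [TopologicalSpace P] [ChartedSpace (EuclideanSpace ℝ (Fin (4 + k))) P]
  [IsManifold (𝓡 (4 + k)) ∞ P]
  {X : Type*} [TopologicalSpace X] [ChartedSpace (EuclideanSpace ℝ (Fin 4)) X]
  [IsManifold (𝓡 4) ∞ X]
  {g : Metric4 X} {o : ∀ x : X, Orientation ℝ (TangentSpace (𝓡 4) x) (Fin 4)}
  {Q : Type*} [TopologicalSpace Q] [ChartedSpace (EuclideanSpace ℝ (Fin 10)) Q]
  [IsManifold (𝓡 10) ∞ Q]
  {S : SpinStructure g o Q} {PB : LiftedBundle k G P}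

/-- The mixed component of the anti-self-duality equation is the Dirac equation, and the remaining one
is the curvature equation, with `ν ∘ a` the contribution of the curvature of `a` along the fibre. -/
theorem ConnP.isASD_iff_dirac {A : ConnP S PB} {L : LeviCivita S} {a : SectionA S PB}
    {b : OneFormL S PB} (h : IsSum L A a b) :
    IsASD L A ↔ (∀ (f : Q) (p : P) (c e : ℍ[ℝ]), dirac L a b f p c e = 0) ∧
      ∀ (f : Q) (p : P) (c c' : ℍ[ℝ]), selfDual (curvB L b f p) c c' + nu a f p c c' =
        -selfDual (iotaPhi L a f p) c c' := by
  rw [A.isASD_iff L a, ← forall_and]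
  refine forall_congr' fun f => ?_
  rw [← forall_and]
  refine forall_congr' fun p => ?_
  refine (starCayley_eq_neg_iff (A.liftedCurvLin L a f p) (liftedCurvLin_self f p)).trans ?_
  simp only [liftedCurvLin_apply, liftedCurv_mixed h, liftedCurv_base h, liftedCurv_fibre h,
    selfDual_add]
  refine and_congr Iff.rfl (forall_congr' fun c => forall_congr' fun c' => ?_)
  rw [eq_neg_iff_add_eq_zero, add_comm, add_assoc, add_left_comm, ← add_assoc]
  rw [← eq_iff_iff]
  congr 1
  simp only [nu, LiftedBundle.momentMap]
  abel

end Equivalence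

end SpinInstanton

theorem mainTheorem1
    {X : Type*} [TopologicalSpace X] [ChartedSpace (EuclideanSpace ℝ (Fin 4)) X]
    [IsManifold (𝓡 4) ∞ X] [CompactSpace X] [T2Space X]
    {g : SpinInstanton.Metric4 X}
    {o : ∀ x : X, Orientation ℝ (TangentSpace (𝓡 4) x) (Fin 4)}
    {Q : Type*} [TopologicalSpace Q] [ChartedSpace (EuclideanSpace ℝ (Fin 10)) Q]
    [IsManifold (𝓡 10) ∞ Q]
    {k : ℕ} {G : Type*} [TopologicalSpace G] [ChartedSpace (EuclideanSpace ℝ (Fin k)) G]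
    [Group G] [LieGroup (𝓡 k) ∞ G]
    {P : Type*} [TopologicalSpace P] [ChartedSpace (EuclideanSpace ℝ (Fin (4 + k))) P]
    [IsManifold (𝓡 (4 + k)) ∞ P]
    (S : SpinInstanton.SpinStructure g o Q) (L : SpinInstanton.LeviCivita S)
    (PB : SpinInstanton.LiftedBundle k G P) (A : SpinInstanton.ConnP S PB) :
    (∃! ab : SpinInstanton.SectionA S PB × SpinInstanton.OneFormL S PB,
      SpinInstanton.IsSum L A ab.1 ab.2) ∧
    ∀ (a : SpinInstanton.SectionA S PB) (b : SpinInstanton.OneFormL S PB),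
      SpinInstanton.IsSum L A a b →
      (SpinInstanton.IsASD L A ↔
        (∀ (f : Q) (p : P) (c e : ℍ[ℝ]), SpinInstanton.dirac L a b f p c e = 0) ∧
        (∀ (f : Q) (p : P) (c c' : ℍ[ℝ]),
          SpinInstanton.selfDual (SpinInstanton.curvB L b f p) c c' +
              SpinInstanton.nu a f p c c' =
            -SpinInstanton.selfDual (SpinInstanton.iotaPhi L a f p) c c')) := by
  exact ⟨A.existsUnique_isSum L, fun a b h => SpinInstanton.ConnP.isASD_iff_dirac h⟩
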